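/- Let $\mathcal I=\mathbb R/2\pi\mathbb Z$ and let $J\subset\mathcal I$ be a nonempty open set. **Weights.** Let $\Omega=\mathcal I\times(0,1)$ and let $\omega\subset\Omega$ be nonempty and open. Let $\psi_{\mathcal I}\in C^\infty(\mathcal I)$ satisfy $\psi_{\mathcal I}>0$ on $\mathcal I$ and $\{\psi_{\mathcal I}'=0\}\subset J_0$ for some nonempty open $J_0\Subset J$. Let $\psi_\Omega\in C^\infty(\overline\Omega)$ satisfy $\psi_\Omega>0$ in $\Omega$, $\psi_\Omega=0$ and $\partial_n\psi_\Omega=-1$ on $\partial\Omega$, and $\{\nabla\psi_\Omega=0\}\subset\omega_0$ for some nonempty open $\omega_0\Subset\omega$. Put $\Psi=\|\psi_\Omega\|_{L^\infty(\Omega)}+\|\psi_{\mathcal I}\|_{L^\infty(\mathcal I)}$. For a real $k\ge 2$, $\lambda\ge\mu>0$, $T>0$, $\ell(t)=t(T-t)$ and $(t,x)\in(0,T)\times\mathcal I$, put $$\varphi_0(t,x)=\frac{e^{\mu\psi_{\mathcal I}(x)+8\lambda\Psi}-e^{10\lambda\Psi}}{\ell(t)^{k/2}},\qquad \xi_0(t,x)=\frac{e^{\mu\psi_{\mathcal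 I}(x)+8\lambda\Psi}}{\ell(t)^{k/2}}.$$ **(i) Carleman estimate.** For all such $\omega,\psi_{\mathcal I},\psi_\Omega$ and every $k\ge2$ there exist $c_0>0$, $\mu_0\ge1$ and $\widehat s_0\ge1$ such that for all $\mu\ge\mu_0$, all $\lambda\ge\mu$, all $\alpha\ge0$ (including $\alpha=0$), all $T>0$, all $s\ge\widehat s_0(1+\alpha)(T^k+T^{k-1})$ and every real-valued $\eta\in C^2([0,T];C^4(\mathcal I))$, all the integrals below converge and $$\begin{aligned} &\iint_{(0,T)\times\mathcal I}e^{2s\varphi_0}\Big(s^7\mu^8\xi_0^7|\eta|^2+s^5\mu^6\xi_0^5|\partial_x\eta|^2+s^3\mu^4\xi_0^3|\partial_x^2\eta|^2+(1+\alpha^2)s^3\mu^4\xi_0^3|\partial_t\eta|^2\\ &\qquad\qquad+s\mu^2\xi_0|\partial_x^3\eta|^2+(1+\alpha^2)s\mu^2\xi_0|\partial_t\partial_x\eta|^2\Big)\\ &\le c_0\Big(\iint_{(0,T)\times J}e^{2s\varphi_0}\Big(s^7\mu^8\xi_0^7|\eta|^2+(1+\alpha^2)s^3\mu^4\xi_0^3|\partial_t\eta|^2+s\mu^2\xi_0|\partial_x^3\eta|^2+(1+\alpha^2)s\mu^2\xi_0|\partial_t\partial_x\eta|^2\Big)\\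 &\qquad+\alpha^2s^3\mu^4\iint_{(0,T)\times\mathcal I}\xi_0^3e^{2s\varphi_0}|\partial_t\eta|^2+\iint_{(0,T)\times\mathcal I}e^{2s\varphi_0}\big|\partial_t^2\eta-\alpha\partial_x^2\partial_t\eta+\partial_x^4\eta\big|^2\Big). \end{aligned}$$ **(ii) Unique continuation for the undamped beam.** Let $T>0$ and let $\eta\in C^2((0,T);C^4(\mathcal I))$ be real-valued. If $\partial_t^2\eta+\partial_x^4\eta=0$ on $(0,T)\times\mathcal I$ and $\eta=0$ on $(0,T)\times J$, then $\eta=0$ on $(0,T)\times\mathcal I$. -/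

import Mathlib

open Set MeasureTheory
open scoped ContDiff

noncomputable section

namespace BeamCarleman

/-- The one-dimensional torus `ℝ / 2πℤ`, with its length measure `volume` of total mass `2π`. -/
abbrev Torus : Type := AddCircle (2 * Real.pi)

instance factTwoPiPos : Fact (0 < 2 * Real.pi) := ⟨Real.two_pi_pos⟩

/-- The space derivative of a function on the torus. -/
def dx (f : Torus → ℝ) (x : Torus) : ℝ := deriv (fun h : ℝ => f (x + (h : Torus))) 0

theorem dx_coe (f : Torus → ℝ) (x : ℝ) :
    dx f (x : Torus) = deriv (fun y : ℝ => f (y : Torus)) x := by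
  have h := deriv_comp_const_add (fun y : ℝ => f (y : Torus)) x 0
  simpa [dx, AddCircle.coe_add] using h

/-- The time derivative of a function of time and space. -/
def dt (η : ℝ → Torus → ℝ) (t : ℝ) (x : Torus) : ℝ := deriv (fun τ : ℝ => η τ x) t

/-- `f` is of class `C^n` on the torus. -/
def TorusContDiff (n : WithTop ℕ∞) (f : Torus → ℝ) : Prop :=
  ContDiff ℝ n (fun x : ℝ => f (x : Torus))

/-- `η ∈ C²(S; C⁴(Torus))` for a set `S` of times. The norm of `C⁴(Torus)` is the one for which
`f ↦ (f, f', f'', f''', f'''')` is an isometric embedding into five copies of the Banach space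
`C(Torus)`, so the condition is that each slice is `C⁴` and that each of the five maps
`t ↦ ∂ₓʲ η(t, ·)` is of class `C²` from `S` into `C(Torus)`. -/
def IsC2C4On (S : Set ℝ) (η : ℝ → Torus → ℝ) : Prop :=
  (∀ t ∈ S, TorusContDiff 4 (η t)) ∧
  ∀ j : ℕ, j ≤ 4 → ∃ F : ℝ → C(Torus, ℝ), ContDiffOn ℝ 2 F S ∧
    ∀ t ∈ S, ∀ x : Torus, F t x = dx^[j] (η t) x

/-- The open cylinder `Ω = Torus × (0, 1)`. -/
def Omega : Set (Torus × ℝ) := univ ×ˢ Ioo 0 1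

/-- `ψ` is an admissible weight on the torus for the open set `J`: it is smooth and positive, and
its critical points lie in some nonempty open `J₀ ⋐ J`. -/
def IsTorusWeight (J : Set Torus) (ψ : Torus → ℝ) : Prop :=
  TorusContDiff ∞ ψ ∧ (∀ x, 0 < ψ x) ∧
  ∃ J₀ : Set Torus, IsOpen J₀ ∧ J₀.Nonempty ∧ closure J₀ ⊆ J ∧ ∀ x, dx ψ x = 0 → x ∈ J₀

/-- `ψ` is an admissible weight on the cylinder for the open set `W ⊆ Ω`: it is smooth up to the
boundary, positive in `Ω`, with `ψ = 0` and outward normal derivative `-1` on the boundary, and its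
critical points in the closed cylinder lie in some nonempty open `W₀ ⋐ W`. -/
def IsCylinderWeight (W : Set (Torus × ℝ)) (ψ : Torus → ℝ → ℝ) : Prop :=
  ContDiffOn ℝ ∞ (fun p : ℝ × ℝ => ψ (p.1 : Torus) p.2) (univ ×ˢ Icc 0 1) ∧
  (∀ p ∈ Omega, 0 < ψ p.1 p.2) ∧
  (∀ x, ψ x 0 = 0 ∧ ψ x 1 = 0) ∧
  (∀ x, -derivWithin (ψ x) (Icc 0 1) 0 = -1 ∧ derivWithin (ψ x) (Icc 0 1) 1 = -1) ∧
  ∃ W₀ : Set (Torus × ℝ), IsOpen W₀ ∧ W₀.Nonempty ∧ closure W₀ ⊆ W ∧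
    ∀ x, ∀ y ∈ Icc (0 : ℝ) 1,
      dx (fun x' => ψ x' y) x = 0 → derivWithin (ψ x) (Icc 0 1) y = 0 → (x, y) ∈ W₀

/-- `Ψ = ‖ψ_Ω‖_∞ + ‖ψ_I‖_∞`. -/
def Psi (ψI : Torus → ℝ) (ψΩ : Torus → ℝ → ℝ) : ℝ :=
  (⨆ p : Omega, |ψΩ p.1.1 p.1.2|) + ⨆ x : Torus, |ψI x|

/-- `ℓ(t) = t (T - t)`. -/
def ell (T t : ℝ) : ℝ := t * (T - t)

/-- The weight `φ₀`. -/
def phi0 (ψI : Torus → ℝ) (Ψ k lam μ T t : ℝ) (x : Torus) : ℝ :=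
  (Real.exp (μ * ψI x + 8 * lam * Ψ) - Real.exp (10 * lam * Ψ)) / ell T t ^ (k / 2)

/-- The weight `ξ₀`. -/
def xi0 (ψI : Torus → ℝ) (Ψ k lam μ T t : ℝ) (x : Torus) : ℝ :=
  Real.exp (μ * ψI x + 8 * lam * Ψ) / ell T t ^ (k / 2)

/-- The beam operator `∂ₜ² η - α ∂ₓ² ∂ₜ η + ∂ₓ⁴ η`. -/
def beamOp (α : ℝ) (η : ℝ → Torus → ℝ) (t : ℝ) (x : Torus) : ℝ :=
  dt (dt η) t x - α * dx^[2] (dt η t) x + dx^[4] (η t) x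

section Densities

variable (ψI : Torus → ℝ) (Ψ k lam μ T s α : ℝ) (η : ℝ → Torus → ℝ)

/-- The integrand of the left-hand side. -/
def energyDensity (p : ℝ × Torus) : ℝ :=
  Real.exp (2 * s * phi0 ψI Ψ k lam μ T p.1 p.2) *
    (s ^ 7 * μ ^ 8 * xi0 ψI Ψ k lam μ T p.1 p.2 ^ 7 * |η p.1 p.2| ^ 2
      + s ^ 5 * μ ^ 6 * xi0 ψI Ψ k lam μ T p.1 p.2 ^ 5 * |dx (η p.1) p.2| ^ 2
      + s ^ 3 * μ ^ 4 * xi0 ψI Ψ k lam μ T p.1 p.2 ^ 3 * |dx^[2] (η p.1) p.2| ^ 2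
      + (1 + α ^ 2) * s ^ 3 * μ ^ 4 * xi0 ψI Ψ k lam μ T p.1 p.2 ^ 3 * |dt η p.1 p.2| ^ 2
      + s * μ ^ 2 * xi0 ψI Ψ k lam μ T p.1 p.2 * |dx^[3] (η p.1) p.2| ^ 2
      + (1 + α ^ 2) * s * μ ^ 2 * xi0 ψI Ψ k lam μ T p.1 p.2
          * |dt (fun τ => dx (η τ)) p.1 p.2| ^ 2)

/-- The integrand of the local observation, with `η`, `∂ₜη`, `∂ₓ³η` and `∂ₜ∂ₓη`. -/
def observationDensity (p : ℝ × Torus) : ℝ :=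
  Real.exp (2 * s * phi0 ψI Ψ k lam μ T p.1 p.2) *
    (s ^ 7 * μ ^ 8 * xi0 ψI Ψ k lam μ T p.1 p.2 ^ 7 * |η p.1 p.2| ^ 2
      + (1 + α ^ 2) * s ^ 3 * μ ^ 4 * xi0 ψI Ψ k lam μ T p.1 p.2 ^ 3 * |dt η p.1 p.2| ^ 2
      + s * μ ^ 2 * xi0 ψI Ψ k lam μ T p.1 p.2 * |dx^[3] (η p.1) p.2| ^ 2
      + (1 + α ^ 2) * s * μ ^ 2 * xi0 ψI Ψ k lam μ T p.1 p.2
          * |dt (fun τ => dx (η τ)) p.1 p.2| ^ 2)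

/-- The integrand `ξ₀³ e^{2sφ₀} |∂ₜη|²` of the global velocity term. -/
def velocityDensity (p : ℝ × Torus) : ℝ :=
  xi0 ψI Ψ k lam μ T p.1 p.2 ^ 3 * Real.exp (2 * s * phi0 ψI Ψ k lam μ T p.1 p.2)
    * |dt η p.1 p.2| ^ 2

/-- The integrand of the source term. -/
def sourceDensity (p : ℝ × Torus) : ℝ :=
  Real.exp (2 * s * phi0 ψI Ψ k lam μ T p.1 p.2) * |beamOp α η p.1 p.2| ^ 2

end Densities

end BeamCarleman

end

/-! The estimate comes from a factorisation. If c² − αc + 1 = 0 and u = ∂ₜη − c ∂ₓ²η, then (∂ₓ² − c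
∂ₜ)u = −c (∂ₜ²η − α ∂ₓ²∂ₜη + ∂ₓ⁴η), so the beam operator is controlled by one complex second order
operator. Taking c to be a root of smaller modulus gives |c| ≤ 1 (`exists_characteristic_root`), and
every constant below is uniform over such c.

For ∂ₓ² − c ∂ₜ, conjugation by E = exp(sφ₀) produces a symmetric part S and a skew part A. Up to
divergences, 2⟨S, A⟩ is a quadratic form (`Weight.null_cross`) with leading coefficients 4 aₓ and 4
a² aₓ, where a = ∂ₓ log E. They are positive away from the critical points of the weight once μ is
large, and all terms caused by the time dependence of the weight are small once s is large. Since E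
decays faster than any power of the singularity at t = 0 and t = T, no boundary terms in time
appear. As 2⟨S, A⟩ ≤ ‖S + A‖², this gives `Weight.carleman_second_order`.

It remains to pass from u back to η. For α ≤ 1 the root has modulus 1 and real part α/2 ≤ 1/2, so
|u|² controls |∂ₜη|² + |∂ₓ²η|² by itself. For α ≥ 1, solving for ∂ₓ²η costs |c|⁻² ≤ 4α² times
|∂ₜη|², which is why the global velocity term stands on the right; the mixed derivative then follows
from an energy identity that exploits the damping (`Weight.integral_mixed_le`). A Hardy-type
inequality (`Weight.integral_term_le_deriv`) recovers η and ∂ₓη, and local interpolation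
(`Weight.integral_local_deriv_le`) removes ∂ₓη and ∂ₓ²η from the observation. `absorption` closes
the resulting system of inequalities.

For unique continuation, take α = 0: the velocity term disappears, observation and source vanish,
and the weighted energy must be zero. -/

noncomputable section

/-! ### Integration by parts on the cylinder against rapidly decaying weights. -/

namespace BeamCarleman

open Filter Topology

/-- The open space-time cylinder `(0, T) × Torus`. -/
def cyl (T : ℝ) : Set (ℝ × Torus) := Ioo 0 T ×ˢ univ

/-- The rate `ℓ(t)^{-k/2}` at which the weights blow up. -/
def blow (T k t : ℝ) : ℝ := (ell T t ^ (k / 2))⁻¹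

/-- Continuous functions on the cylinder of at most polynomial growth in `blow`. -/
@[fun_prop]
structure Moderate (T k : ℝ) (f : ℝ × Torus → ℝ) : Prop where
  cont : ContinuousOn f (cyl T)
  bound : ∃ (C : ℝ) (N : ℕ), ∀ p ∈ cyl T, |f p| ≤ C * (1 + blow T k p.1) ^ N

/-- Continuous functions on the cylinder which decay faster than every power of `blow`. -/
structure Rapid (T k : ℝ) (f : ℝ × Torus → ℝ) : Prop where
  cont : ContinuousOn f (cyl T)
  bound : ∀ N : ℕ, ∃ C : ℝ, ∀ p ∈ cyl T, |f p| * (1 + blow T k p.1) ^ N ≤ C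

variable {T k : ℝ} {f g f' g' : ℝ × Torus → ℝ}

theorem isOpen_cyl : IsOpen (cyl T) := isOpen_Ioo.prod isOpen_univ

theorem measurableSet_cyl : MeasurableSet (cyl T) := isOpen_cyl.measurableSet

theorem ell_pos {t : ℝ} (ht : t ∈ Ioo 0 T) : 0 < ell T t :=
  mul_pos ht.1 (sub_pos.2 ht.2)

theorem blow_pos {t : ℝ} (ht : t ∈ Ioo 0 T) : 0 < blow T k t :=
  inv_pos.2 (Real.rpow_pos_of_pos (ell_pos ht) _)

theorem one_le_one_add_blow {p : ℝ × Torus} (hp : p ∈ cyl T) : 1 ≤ 1 + blow T k p.1 := by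
  have := blow_pos (k := k) hp.1
  linarith

@[fun_prop]
theorem Moderate.add (hf : Moderate T k f) (hg : Moderate T k g) :
    Moderate T k (fun p => f p + g p) := by
  obtain ⟨C, N, h⟩ := hf.bound
  obtain ⟨D, M, h'⟩ := hg.bound
  refine ⟨hf.cont.add hg.cont, |C| + |D|, N + M, fun p hp => ?_⟩
  have h1 := one_le_one_add_blow (k := k) hp
  have e1 : C * (1 + blow T k p.1) ^ N ≤ |C| * (1 + blow T k p.1) ^ (N + M) := by
    gcongr
    · exact le_abs_self C
    · omega
  have e2 : D * (1 + blow T k p.1) ^ M ≤ |D| * (1 + blow T k p.1) ^ (N + M) := by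
    gcongr
    · exact le_abs_self D
    · omega
  calc |f p + g p| ≤ |f p| + |g p| := abs_add_le _ _
    _ ≤ _ := by linarith [h p hp, h' p hp]

@[fun_prop]
theorem Moderate.mul (hf : Moderate T k f) (hg : Moderate T k g) :
    Moderate T k (fun p => f p * g p) := by
  obtain ⟨C, N, h⟩ := hf.bound
  obtain ⟨D, M, h'⟩ := hg.bound
  refine ⟨hf.cont.mul hg.cont, C * D, N + M, fun p hp => ?_⟩
  rw [abs_mul, pow_add]
  calc |f p| * |g p| ≤ (C * (1 + blow T k p.1) ^ N) * (D * (1 + blow T k p.1) ^ M) :=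
        mul_le_mul (h p hp) (h' p hp) (abs_nonneg _) ((abs_nonneg _).trans (h p hp))
    _ = _ := by ring

@[fun_prop]
theorem Moderate.const (c : ℝ) : Moderate T k (fun _ => c) :=
  ⟨continuousOn_const, |c|, 0, fun p _ => by simp⟩

@[fun_prop]
theorem Moderate.neg (hf : Moderate T k f) : Moderate T k (fun p => -f p) := by
  simpa using (Moderate.const (-1)).mul hf

@[fun_prop]
theorem Moderate.sub (hf : Moderate T k f) (hg : Moderate T k g) :
    Moderate T k (fun p => f p - g p) := by
  simpa [sub_eq_add_neg] using hf.add hg.neg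

@[fun_prop]
theorem Moderate.pow (hf : Moderate T k f) (n : ℕ) : Moderate T k (fun p => f p ^ n) := by
  induction n with
  | zero => simpa using Moderate.const 1
  | succ n ih => simpa [pow_succ] using ih.mul hf

@[fun_prop]
theorem Rapid.moderate (hf : Rapid T k f) : Moderate T k f := by
  obtain ⟨C, h⟩ := hf.bound 0
  exact ⟨hf.cont, C, 0, fun p hp => by simpa using h p hp⟩

/-- Polynomial growth of the second factor is paid for by invoking the decay of the first with a
larger exponent. Every integrand below is a power of `E` times something moderate, so convergence
always comes from here. -/
theorem Rapid.mul_moderate (hf : Rapid T k f) (hg : Moderate T k g) :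
    Rapid T k (fun p => f p * g p) := by
  refine ⟨hf.cont.mul hg.cont, fun N => ?_⟩
  obtain ⟨D, M, h'⟩ := hg.bound
  obtain ⟨C, h⟩ := hf.bound (M + N)
  refine ⟨C * |D|, fun p hp => ?_⟩
  have h1 := one_le_one_add_blow (k := k) hp
  have h2 : |g p| ≤ |D| * (1 + blow T k p.1) ^ M :=
    (h' p hp).trans (by gcongr; exact le_abs_self D)
  calc |f p * g p| * (1 + blow T k p.1) ^ N
      ≤ |f p| * (|D| * (1 + blow T k p.1) ^ M) * (1 + blow T k p.1) ^ N := by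
        rw [abs_mul]; gcongr
    _ = |f p| * (1 + blow T k p.1) ^ (M + N) * |D| := by ring
    _ ≤ C * |D| := by gcongr; exact h p hp

theorem Rapid.moderate_mul (hg : Moderate T k g) (hf : Rapid T k f) :
    Rapid T k (fun p => g p * f p) := by
  simpa [mul_comm] using hf.mul_moderate hg

theorem Rapid.const_mul (hf : Rapid T k f) (c : ℝ) : Rapid T k (fun p => c * f p) :=
  Rapid.moderate_mul (Moderate.const c) hf

theorem Rapid.add (hf : Rapid T k f) (hg : Rapid T k g) :
    Rapid T k (fun p => f p + g p) := by
  refine ⟨hf.cont.add hg.cont, fun N => ?_⟩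
  obtain ⟨C, h⟩ := hf.bound N
  obtain ⟨D, h'⟩ := hg.bound N
  refine ⟨C + D, fun p hp => ?_⟩
  have h1 := one_le_one_add_blow (k := k) hp
  calc |f p + g p| * (1 + blow T k p.1) ^ N
      ≤ (|f p| + |g p|) * (1 + blow T k p.1) ^ N := by gcongr; exact abs_add_le _ _
    _ ≤ _ := by linarith [h p hp, h' p hp]

theorem Rapid.bounded (hf : Rapid T k f) : ∃ C, ∀ p ∈ cyl T, |f p| ≤ C := by
  obtain ⟨C, h⟩ := hf.bound 0
  exact ⟨C, fun p hp => by simpa using h p hp⟩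

theorem volume_cyl_lt_top : volume (cyl T) < ⊤ := by
  rw [cyl, Measure.volume_eq_prod, Measure.prod_prod]
  exact ENNReal.mul_lt_top (by simp) (measure_lt_top _ _)

theorem integrableOn_of_bounded {s : Set (ℝ × Torus)} (hs : MeasurableSet s) (hsub : s ⊆ cyl T)
    (hc : ContinuousOn f s) {C : ℝ} (hC : ∀ p ∈ s, |f p| ≤ C) : IntegrableOn f s := by
  refine IntegrableOn.of_bound ((measure_mono hsub).trans_lt volume_cyl_lt_top)
    (hc.aestronglyMeasurable hs) C ?_
  · filter_upwards [ae_restrict_mem hs] with p hp using by simpa using hC p hp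

theorem Rapid.integrableOn (hf : Rapid T k f) : IntegrableOn f (cyl T) := by
  obtain ⟨C, h⟩ := hf.bounded
  exact integrableOn_of_bounded measurableSet_cyl subset_rfl hf.cont h

/-- `f'` is the space derivative of `f` in the cylinder. -/
def HasDX (T : ℝ) (f f' : ℝ × Torus → ℝ) : Prop :=
  ∀ t ∈ Ioo 0 T, ∀ x : ℝ, HasDerivAt (fun y : ℝ => f (t, (y : Torus))) (f' (t, (x : Torus))) x

/-- `f'` is the time derivative of `f` in the cylinder. -/
def HasDT (T : ℝ) (f f' : ℝ × Torus → ℝ) : Prop :=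
  ∀ t ∈ Ioo 0 T, ∀ x : ℝ, HasDerivAt (fun τ : ℝ => f (τ, (x : Torus))) (f' (t, (x : Torus))) t

theorem setIntegral_cyl (hf : IntegrableOn f (cyl T)) :
    ∫ p in cyl T, f p = ∫ t in Ioo 0 T, ∫ x in (0 : ℝ)..(2 * Real.pi), f (t, (x : Torus)) := by
  rw [cyl, Measure.volume_eq_prod, setIntegral_prod _ hf]
  refine setIntegral_congr_fun measurableSet_Ioo fun t _ => ?_
  have := AddCircle.intervalIntegral_preimage (2 * Real.pi) 0 (fun x => f (t, x))
  simp only [zero_add] at this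
  simp [this]

theorem setIntegral_cyl' (hf : IntegrableOn f (cyl T)) :
    ∫ p in cyl T, f p = ∫ x : Torus, ∫ t in Ioo 0 T, f (t, x) := by
  have h := hf
  rw [cyl, Measure.volume_eq_prod, IntegrableOn, ← Measure.prod_restrict] at h
  rw [cyl, Measure.volume_eq_prod, ← Measure.prod_restrict, integral_prod_symm _ h]
  simp

/-- Periodicity cancels the two endpoint values on each time slice. -/
theorem HasDX.integral_eq_zero (h : HasDX T f f') (hf' : Rapid T k f') :
    ∫ p in cyl T, f' p = 0 := by
  rw [setIntegral_cyl hf'.integrableOn]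
  refine setIntegral_eq_zero_of_forall_eq_zero fun t ht => ?_
  rw [intervalIntegral.integral_eq_sub_of_hasDerivAt (f := fun y : ℝ => f (t, (y : Torus)))
    (fun x _ => h t ht x)]
  · have : ((2 * Real.pi : ℝ) : Torus) = ((0 : ℝ) : Torus) := by
      simp
    simp only [this, sub_self]
  · refine Continuous.intervalIntegrable ?_ _ _
    refine hf'.cont.comp_continuous (by fun_prop) fun x => ⟨ht, mem_univ _⟩

theorem tendsto_blow (hk : 2 ≤ k) {t₀ : ℝ} {F : Filter ℝ} (hF : F ≤ 𝓝 t₀)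
    (h0 : ell T t₀ = 0) (hF' : ∀ᶠ t in F, t ∈ Ioo 0 T) : Tendsto (blow T k) F atTop := by
  refine Tendsto.inv_tendsto_nhdsGT_zero ?_
  rw [tendsto_nhdsWithin_iff]
  constructor
  · have hc : ContinuousAt (fun t => ell T t ^ (k / 2)) t₀ := by
      unfold ell
      exact ContinuousAt.rpow_const (by fun_prop) (Or.inr (by linarith))
    simpa [h0, Real.zero_rpow (show k / 2 ≠ 0 by linarith)] using hc.tendsto.mono_left hF
  · filter_upwards [hF'] with t ht
    exact Real.rpow_pos_of_pos (ell_pos ht) _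

theorem Rapid.tendsto_zero (hf : Rapid T k f) (hk : 2 ≤ k) {t₀ : ℝ} {F : Filter ℝ}
    (hF : F ≤ 𝓝 t₀) (h0 : ell T t₀ = 0) (hF' : ∀ᶠ t in F, t ∈ Ioo 0 T) (x : Torus) :
    Tendsto (fun t => f (t, x)) F (𝓝 0) := by
  obtain ⟨C, h⟩ := hf.bound 1
  have hb := tendsto_blow hk hF h0 hF'
  have h1 : Tendsto (fun t => C * (1 + blow T k t)⁻¹) F (𝓝 0) := by
    simpa using ((tendsto_atTop_add_const_left F 1 hb).inv_tendsto_atTop).const_mul C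
  refine squeeze_zero_norm' ?_ h1
  filter_upwards [hF'] with t ht
  have hp : (t, x) ∈ cyl T := ⟨ht, mem_univ _⟩
  have := one_le_one_add_blow (k := k) hp
  rw [← div_eq_mul_inv, le_div_iff₀ (by linarith)]
  simpa using h _ hp

/-- The endpoint values vanish because a rapid function tends to zero wherever `blow` tends to
infinity; no condition on η at t = 0 or t = T is needed. -/
theorem HasDT.integral_eq_zero (h : HasDT T f f') (hT : 0 < T) (hk : 2 ≤ k) (hf : Rapid T k f)
    (hf' : Rapid T k f') : ∫ p in cyl T, f' p = 0 := by
  rw [setIntegral_cyl' hf'.integrableOn]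
  refine integral_eq_zero_of_ae (.of_forall fun x => ?_)
  obtain ⟨x, rfl⟩ := QuotientAddGroup.mk_surjective x
  simp only [Pi.zero_apply]
  rw [← integral_Ioc_eq_integral_Ioo, ← intervalIntegral.integral_of_le hT.le]
  rw [intervalIntegral.integral_eq_sub_of_hasDerivAt_of_tendsto hT (fun t ht => h t ht x)
    (fa := 0) (fb := 0), sub_self]
  · rw [intervalIntegrable_iff_integrableOn_Ioo_of_le hT.le]
    obtain ⟨C, hC⟩ := hf'.bounded
    refine IntegrableOn.of_bound (by simp) ?_ C ?_
    · refine ContinuousOn.aestronglyMeasurable ?_ measurableSet_Ioo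
      exact hf'.cont.comp (by fun_prop) fun t ht => ⟨ht, mem_univ _⟩
    · filter_upwards [ae_restrict_mem measurableSet_Ioo] with t ht
      exact hC (t, _) ⟨ht, mem_univ _⟩
  · exact hf.tendsto_zero hk nhdsWithin_le_nhds (by simp [ell]) (Ioo_mem_nhdsGT hT) _
  · exact hf.tendsto_zero hk nhdsWithin_le_nhds (by simp [ell]) (Ioo_mem_nhdsLT hT) _

/-- `g` is integrable over the cylinder with vanishing integral. -/
def Null (T : ℝ) (g : ℝ × Torus → ℝ) : Prop := IntegrableOn g (cyl T) ∧ ∫ p in cyl T, g p = 0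

theorem HasDX.null (h : HasDX T f f') (hf' : Rapid T k f') : Null T f' :=
  ⟨hf'.integrableOn, h.integral_eq_zero hf'⟩

theorem HasDT.null (h : HasDT T f f') (hT : 0 < T) (hk : 2 ≤ k) (hf : Rapid T k f)
    (hf' : Rapid T k f') : Null T f' :=
  ⟨hf'.integrableOn, h.integral_eq_zero hT hk hf hf'⟩

theorem Null.add (hf : Null T f) (hg : Null T g) : Null T (fun p => f p + g p) :=
  ⟨hf.1.add hg.1, by rw [integral_add hf.1 hg.1, hf.2, hg.2, add_zero]⟩

theorem Null.const_mul (hf : Null T f) (c : ℝ) : Null T (fun p => c * f p) :=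
  ⟨hf.1.const_mul c, by rw [integral_const_mul, hf.2, mul_zero]⟩

/-- This is the common format of the integral estimates that follow: the integrations by parts are
collected in one null function, and what is left is a pointwise algebraic inequality. -/
theorem setIntegral_le_of_null {X Y : ℝ × Torus → ℝ} (hX : IntegrableOn X (cyl T))
    (hY : IntegrableOn Y (cyl T)) (hg : Null T g) (h : ∀ p ∈ cyl T, X p ≤ Y p + g p) :
    ∫ p in cyl T, X p ≤ ∫ p in cyl T, Y p := by
  calc ∫ p in cyl T, X p ≤ ∫ p in cyl T, (Y p + g p) :=
        setIntegral_mono_on hX (hY.add hg.1) measurableSet_cyl h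
    _ = _ := by rw [integral_add hY hg.1, hg.2, add_zero]

end BeamCarleman

end

/-! ### Abstract Carleman weights and the cross term of the conjugated operator. -/

noncomputable section

namespace BeamCarleman

section Calculus

variable {T k : ℝ} {f g h f' g' h' : ℝ × Torus → ℝ}

theorem HasDX.congr (hf : HasDX T f f') (h : ∀ p, f' p = g' p) : HasDX T f g' :=
  fun t ht x => h _ ▸ hf t ht x

theorem HasDT.congr (hf : HasDT T f f') (h : ∀ p, f' p = g' p) : HasDT T f g' :=
  fun t ht x => h _ ▸ hf t ht x

theorem HasDX.add (hf : HasDX T f f') (hg : HasDX T g g') :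
    HasDX T (fun p => f p + g p) (fun p => f' p + g' p) :=
  fun t ht x => (hf t ht x).add (hg t ht x)

theorem HasDX.sub (hf : HasDX T f f') (hg : HasDX T g g') :
    HasDX T (fun p => f p - g p) (fun p => f' p - g' p) :=
  fun t ht x => (hf t ht x).sub (hg t ht x)

theorem HasDX.mul (hf : HasDX T f f') (hg : HasDX T g g') :
    HasDX T (fun p => f p * g p) (fun p => f' p * g p + f p * g' p) :=
  fun t ht x => (hf t ht x).mul (hg t ht x)

theorem HasDX.const_mul (hf : HasDX T f f') (c : ℝ) :
    HasDX T (fun p => c * f p) (fun p => c * f' p) :=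
  fun t ht x => (hf t ht x).const_mul c

theorem HasDX.pow (hf : HasDX T f f') (n : ℕ) :
    HasDX T (fun p => f p ^ n) (fun p => n * f p ^ (n - 1) * f' p) :=
  fun t ht x => (hf t ht x).pow n

theorem HasDX.const (c : ℝ) : HasDX T (fun _ => c) (fun _ => 0) :=
  fun _ _ x => hasDerivAt_const x c

theorem HasDT.add (hf : HasDT T f f') (hg : HasDT T g g') :
    HasDT T (fun p => f p + g p) (fun p => f' p + g' p) :=
  fun t ht x => (hf t ht x).add (hg t ht x)

theorem HasDT.sub (hf : HasDT T f f') (hg : HasDT T g g') :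
    HasDT T (fun p => f p - g p) (fun p => f' p - g' p) :=
  fun t ht x => (hf t ht x).sub (hg t ht x)

theorem HasDT.mul (hf : HasDT T f f') (hg : HasDT T g g') :
    HasDT T (fun p => f p * g p) (fun p => f' p * g p + f p * g' p) :=
  fun t ht x => (hf t ht x).mul (hg t ht x)

theorem HasDT.const_mul (hf : HasDT T f f') (c : ℝ) :
    HasDT T (fun p => c * f p) (fun p => c * f' p) :=
  fun t ht x => (hf t ht x).const_mul c

theorem HasDT.pow (hf : HasDT T f f') (n : ℕ) :
    HasDT T (fun p => f p ^ n) (fun p => n * f p ^ (n - 1) * f' p) :=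
  fun t ht x => (hf t ht x).pow n

theorem HasDT.const (c : ℝ) : HasDT T (fun _ => c) (fun _ => 0) :=
  fun t _ _ => hasDerivAt_const t c

theorem HasDX.null_mul (hf : HasDX T f f') (hg : HasDX T g g') (hh : HasDX T h h')
    (mf : Moderate T k f) (mf' : Moderate T k f') (rg : Rapid T k g) (rg' : Rapid T k g')
    (mh : Moderate T k h) (mh' : Moderate T k h') :
    Null T (fun p => f' p * g p * h p + f p * g' p * h p + f p * g p * h' p) := by
  refine ((hf.mul hg).mul hh).congr (fun p => ?_) |>.null (k := k) ?_
  · ring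
  · exact (((rg.moderate_mul mf').mul_moderate mh).add ((rg'.moderate_mul mf).mul_moderate mh)).add
      ((rg.moderate_mul mf).mul_moderate mh')

theorem HasDT.null_mul (hT : 0 < T) (hk : 2 ≤ k)
    (hf : HasDT T f f') (hg : HasDT T g g') (hh : HasDT T h h')
    (mf : Moderate T k f) (mf' : Moderate T k f') (rg : Rapid T k g) (rg' : Rapid T k g')
    (mh : Moderate T k h) (mh' : Moderate T k h') :
    Null T (fun p => f' p * g p * h p + f p * g' p * h p + f p * g p * h' p) := by
  refine ((hf.mul hg).mul hh).congr (fun p => ?_) |>.null (k := k) hT hk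
    ((rg.moderate_mul mf).mul_moderate mh) ?_
  · ring
  · exact (((rg.moderate_mul mf').mul_moderate mh).add ((rg'.moderate_mul mf).mul_moderate mh)).add
      ((rg.moderate_mul mf).mul_moderate mh')

theorem Null.congr (hf : Null T f) (h : ∀ p, f p = g p) : Null T g := by
  rwa [← funext h]

end Calculus

/-- A Carleman weight on the cylinder: `θ` is the large weight, `E` the decaying exponential with
logarithmic derivatives `μ D₁ θ` and `b`, the functions `Dᵢ` are the derivatives of the space
profile, `g` is the logarithmic time derivative of `θ`, and `ζ` is a cutoff supported in `J`. -/
structure Weight (J : Set Torus) (T k μ α M δ ε : ℝ) where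
  θ : ℝ × Torus → ℝ
  E : ℝ × Torus → ℝ
  g : ℝ × Torus → ℝ
  b : ℝ × Torus → ℝ
  bt : ℝ × Torus → ℝ
  D1 : ℝ × Torus → ℝ
  D2 : ℝ × Torus → ℝ
  D3 : ℝ × Torus → ℝ
  D4 : ℝ × Torus → ℝ
  ζ : ℝ × Torus → ℝ
  dζ : ℝ × Torus → ℝ
  T_pos : 0 < T
  two_le : 2 ≤ k
  mθ : Moderate T k θ
  rE : Rapid T k E
  mg : Moderate T k g
  mb : Moderate T k b
  mbt : Moderate T k bt
  mD1 : Moderate T k D1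
  mD2 : Moderate T k D2
  mD3 : Moderate T k D3
  mD4 : Moderate T k D4
  mζ : Moderate T k ζ
  mdζ : Moderate T k dζ
  xθ : HasDX T θ (fun p => μ * D1 p * θ p)
  xE : HasDX T E (fun p => μ * D1 p * θ p * E p)
  xb : HasDX T b (fun p => g p * (μ * D1 p * θ p))
  xD1 : HasDX T D1 D2
  xD2 : HasDX T D2 D3
  xD3 : HasDX T D3 D4
  xζ : HasDX T ζ dζ
  tθ : HasDT T θ (fun p => g p * θ p)
  tE : HasDT T E (fun p => b p * E p)
  tb : HasDT T b bt
  tD1 : HasDT T D1 (fun _ => 0)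
  one_le_μ : 1 ≤ μ
  α_nonneg : 0 ≤ α
  one_le_M : 1 ≤ M
  ε_pos : 0 < ε
  -- These four bounds encode that s is large: each time derivative of the weight is small compared
  -- with the matching power of `θ`. The factor 1 + α in `g_le` and `b_le` is what the damped energy
  -- estimate `integral_mixed_le` needs for uniformity in α.
  one_le_θ : ∀ p ∈ cyl T, 1 + α ≤ ε * θ p
  g_le : ∀ p ∈ cyl T, (1 + α) * |g p| ≤ ε * θ p
  b_le : ∀ p ∈ cyl T, (1 + α) * |b p| ≤ ε * θ p ^ 2
  bt_le : ∀ p ∈ cyl T, |bt p| ≤ ε * θ p ^ 3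
  D1_le : ∀ p, |D1 p| ≤ M
  D2_le : ∀ p, |D2 p| ≤ M
  D3_le : ∀ p, |D3 p| ≤ M
  D4_le : ∀ p, |D4 p| ≤ M
  ζ_nonneg : ∀ p, 0 ≤ ζ p
  ζ_le : ∀ p, ζ p ≤ 1
  dζ_le : ∀ p, |dζ p| ≤ M
  ζ_off : ∀ p, p.2 ∉ J → ζ p = 0 ∧ dζ p = 0
  crit : ∀ p, ζ p = 1 ∨ δ ≤ D1 p ^ 2

/-- A function on the cylinder with the derivatives occurring in a second order equation. -/
structure SecondOrderJet (T k : ℝ) where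
  u : ℝ × Torus → ℝ
  ux : ℝ × Torus → ℝ
  uxx : ℝ × Torus → ℝ
  ut : ℝ × Torus → ℝ
  utx : ℝ × Torus → ℝ
  mu : Moderate T k u
  mux : Moderate T k ux
  muxx : Moderate T k uxx
  mdt : Moderate T k ut
  mdtx : Moderate T k utx
  xu : HasDX T u ux
  xux : HasDX T ux uxx
  xut : HasDX T ut utx
  tu : HasDT T u ut
  tux : HasDT T ux utx

/-- All derivatives of the jet are rapidly decaying. -/
structure SecondOrderJet.IsRapid {T k : ℝ} (z : SecondOrderJet T k) : Prop where
  ru : Rapid T k z.u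
  rux : Rapid T k z.ux
  ruxx : Rapid T k z.uxx
  rut : Rapid T k z.ut
  rutx : Rapid T k z.utx

attribute [fun_prop] Weight.mθ Weight.mg Weight.mb Weight.mbt Weight.mD1 Weight.mD2 Weight.mD3
  Weight.mD4 Weight.mζ Weight.mdζ SecondOrderJet.mu SecondOrderJet.mux SecondOrderJet.muxx
  SecondOrderJet.mdt SecondOrderJet.mdtx

namespace Weight

variable {J : Set Torus} {T k μ α M δ ε : ℝ} (W : Weight J T k μ α M δ ε)

@[fun_prop]
theorem mE : Moderate T k W.E := W.rE.moderate

/-- The logarithmic space derivative of `E`. -/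
def a (p : ℝ × Torus) : ℝ := μ * W.D1 p * W.θ p

/-- The first space derivative of `a`. -/
def ax (p : ℝ × Torus) : ℝ := (μ ^ 2 * W.D1 p ^ 2 + μ * W.D2 p) * W.θ p

/-- The second space derivative of `a`. -/
def axx (p : ℝ × Torus) : ℝ :=
  (μ ^ 3 * W.D1 p ^ 3 + 3 * μ ^ 2 * W.D1 p * W.D2 p + μ * W.D3 p) * W.θ p

/-- The third space derivative of `a`. -/
def axxx (p : ℝ × Torus) : ℝ :=
  (μ ^ 4 * W.D1 p ^ 4 + 6 * μ ^ 3 * W.D1 p ^ 2 * W.D2 p + 3 * μ ^ 2 * W.D2 p ^ 2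
    + 4 * μ ^ 2 * W.D1 p * W.D3 p + μ * W.D4 p) * W.θ p

@[fun_prop]
theorem ma : Moderate T k W.a := by unfold a; fun_prop

@[fun_prop]
theorem mda : Moderate T k W.ax := by unfold ax; fun_prop

@[fun_prop]
theorem mdda : Moderate T k W.axx := by unfold axx; fun_prop

@[fun_prop]
theorem mddda : Moderate T k W.axxx := by unfold axxx; fun_prop

/-- Because ∂ₓθ = μ D₁ θ, each differentiation of `a` costs at most a factor μ and never a further
power of `θ`. Hence `axxx` is of lower order than a² aₓ, which carries θ³. -/
theorem xa : HasDX T W.a W.ax :=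
  ((W.xD1.const_mul μ).mul W.xθ).congr fun p => by simp only [ax]; ring

theorem xax : HasDX T W.ax W.axx :=
  ((((W.xD1.pow 2).const_mul (μ ^ 2)).add (W.xD2.const_mul μ)).mul W.xθ).congr
    fun p => by simp only [axx]; push_cast; ring

theorem xaxx : HasDX T W.axx W.axxx :=
  (((((W.xD1.pow 3).const_mul (μ ^ 3)).add ((W.xD1.const_mul (3 * μ ^ 2)).mul W.xD2)).add
    (W.xD3.const_mul μ)).mul W.xθ).congr fun p => by simp only [axxx]; push_cast; ring

theorem ta : HasDT T W.a (fun p => W.g p * W.a p) :=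
  ((W.tD1.const_mul μ).mul W.tθ).congr fun p => by simp only [a]; ring

/-- Conjugation of a jet by the exponential weight. -/
def conj (U : SecondOrderJet T k) : SecondOrderJet T k where
  u p := W.E p * U.u p
  ux p := W.E p * (U.ux p + W.a p * U.u p)
  uxx p := W.E p * (U.uxx p + 2 * W.a p * U.ux p + (W.ax p + W.a p ^ 2) * U.u p)
  ut p := W.E p * (U.ut p + W.b p * U.u p)
  utx p := W.E p * (U.utx p + W.b p * U.ux p + W.a p * U.ut p
    + (W.g p * W.a p + W.a p * W.b p) * U.u p)
  mu := by fun_prop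
  mux := by fun_prop
  muxx := by fun_prop
  mdt := by fun_prop
  mdtx := by fun_prop
  xu := (W.xE.mul U.xu).congr fun p => by simp only [a]; ring
  xux := (W.xE.mul (U.xux.add (W.xa.mul U.xu))).congr fun p => by simp only [a]; ring
  xut := (W.xE.mul (U.xut.add (W.xb.mul U.xu))).congr fun p => by simp only [a]; ring
  tu := (W.tE.mul U.tu).congr fun p => by ring
  tux := (W.tE.mul (U.tux.add (W.ta.mul U.tu))).congr fun p => by ring

theorem conj_isRapid (U : SecondOrderJet T k) : (W.conj U).IsRapid where
  ru := W.rE.mul_moderate (by fun_prop)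
  rux := W.rE.mul_moderate (by fun_prop)
  ruxx := W.rE.mul_moderate (by fun_prop)
  rut := W.rE.mul_moderate (by fun_prop)
  rutx := W.rE.mul_moderate (by fun_prop)

/-- The cross term of the symmetric and skew-symmetric parts of the conjugated operator equals a
quadratic form in `z` and `∂ₓ z`, up to terms in divergence form. -/
theorem null_cross (c₁ c₂ : ℝ) (y z : SecondOrderJet T k) (hy : y.IsRapid) (hz : z.IsRapid) :
    Null T fun p =>
      2 * ((y.uxx p + (W.a p ^ 2 + c₁ * W.b p) * y.u p + c₂ * z.ut p) *
          (-2 * W.a p * y.ux p - W.ax p * y.u p - c₁ * y.ut p - c₂ * W.b p * z.u p)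
        + (z.uxx p + (W.a p ^ 2 + c₁ * W.b p) * z.u p - c₂ * y.ut p) *
          (-2 * W.a p * z.ux p - W.ax p * z.u p - c₁ * z.ut p + c₂ * W.b p * y.u p))
      - (4 * W.ax p * (y.ux p ^ 2 + z.ux p ^ 2)
        + (4 * W.a p ^ 2 * W.ax p - W.axxx p + 4 * c₁ * W.g p * W.a p ^ 2
            + (c₁ ^ 2 + c₂ ^ 2) * W.bt p) * (y.u p ^ 2 + z.u p ^ 2)
        - 4 * c₂ * (W.g p * W.a p) * (z.ux p * y.u p - y.ux p * z.u p)) := by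
  have hT := W.T_pos
  have hk := W.two_le
  -- For w = y + iz the factors are S = ∂ₓ² + a² + c₁b − i c₂∂ₜ, which is symmetric, and A = −2a∂ₓ −
  -- aₓ − c₁∂ₜ + i c₂ b, which is skew. `X` lists the space fluxes and `Y` the time fluxes needed to
  -- integrate the products in Re(S w · conj(A w)) by parts.
  have X (u v : SecondOrderJet T k) (hu : u.IsRapid) (hv : v.IsRapid) :=
    And.intro (HasDX.null_mul (k := k) W.xa u.xux v.xux W.ma W.mda hu.rux hu.ruxx v.mux v.muxx) <|
    And.intro (HasDX.null_mul (k := k) W.xax u.xu v.xux W.mda W.mdda hu.ru hu.rux v.mux v.muxx) <|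
    And.intro (HasDX.null_mul (k := k) W.xaxx u.xu v.xu W.mdda W.mddda hu.ru hu.rux v.mu v.mux) <|
    And.intro (HasDX.null_mul (k := k) (W.xa.pow 3) u.xu v.xu (by fun_prop) (by fun_prop)
      hu.ru hu.rux v.mu v.mux) <|
    And.intro (HasDX.null_mul (k := k) (HasDX.const 1) u.xux v.xut (by fun_prop) (by fun_prop)
      hu.rux hu.ruxx v.mdt v.mdtx) <|
    And.intro (HasDX.null_mul (k := k) (W.xa.mul W.xb) u.xu v.xu (by fun_prop) (by fun_prop)
      hu.ru hu.rux v.mu v.mux) <|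
    And.intro (HasDX.null_mul (k := k) W.xb u.xux v.xu W.mb (by fun_prop) hu.rux hu.ruxx v.mu v.mux)
      (HasDX.null_mul (k := k) W.xa u.xu v.xut W.ma W.mda hu.ru hu.rux v.mdt v.mdtx)
  have Y (u v : SecondOrderJet T k) (hu : u.IsRapid) (hv : v.IsRapid) :=
    And.intro (HasDT.null_mul hT hk (HasDT.const 1) u.tux v.tux (by fun_prop) (by fun_prop)
      hu.rux hu.rutx v.mux v.mdtx) <|
    And.intro (HasDT.null_mul hT hk (W.ta.pow 2) u.tu v.tu (by fun_prop) (by fun_prop)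
      hu.ru hu.rut v.mu v.mdt) <|
    And.intro (HasDT.null_mul hT hk W.tb u.tu v.tu W.mb W.mbt hu.ru hu.rut v.mu v.mdt)
      (HasDT.null_mul hT hk W.ta u.tu v.tux W.ma (by fun_prop) hu.ru hu.rut v.mux v.mdtx)
  obtain ⟨x1, x2, x3, x4, x5, x6, -, -⟩ := X y y hy hy
  obtain ⟨x1', x2', x3', x4', x5', x6', -, -⟩ := X z z hz hz
  obtain ⟨-, -, -, -, -, -, x7, x8⟩ := X z y hz hy
  obtain ⟨-, -, -, -, -, -, x7', x8'⟩ := X y z hy hz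
  obtain ⟨t1, t2, t3, -⟩ := Y y y hy hy
  obtain ⟨t1', t2', t3', -⟩ := Y z z hz hz
  obtain ⟨-, -, -, t4⟩ := Y z y hz hy
  obtain ⟨-, -, -, t4'⟩ := Y y z hy hz
  -- `N1` and `N3` treat products within one component. `N2` and `N4` treat the coupling through c₂,
  -- where only the antisymmetric combination of y and z occurs.
  have N1 := ((((((x1.add x1').const_mul (-2)).add ((x2.add x2').const_mul (-2))).add
    (x3.add x3')).add ((x4.add x4').const_mul (-2))).add ((x5.add x5').const_mul (-2 * c₁))).add
    ((x6.add x6').const_mul (-2 * c₁))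
  have N2 := ((x7.add (x7'.const_mul (-1))).add (x8.add (x8'.const_mul (-1)))).const_mul (2 * c₂)
  have N3 := (((t1.add t1').const_mul c₁).add ((t2.add t2').const_mul (-c₁))).add
    ((t3.add t3').const_mul (-(c₁ ^ 2 + c₂ ^ 2)))
  have N4 := (t4.add (t4'.const_mul (-1))).const_mul (-2 * c₂)
  refine ((N1.add N2).add (N3.add N4)).congr fun p => ?_
  have ha : μ * W.D1 p * W.θ p = W.a p := rfl
  simp only [ha]
  push_cast
  ring

end Weight

end BeamCarleman

end

/-! ### Carleman estimate for the complex second order operator. -/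

noncomputable section

namespace BeamCarleman

theorem two_mul_mul_le_add_sq (s t : ℝ) : 2 * (s * t) ≤ (s + t) ^ 2 := by
  linarith [sq_nonneg s, sq_nonneg t, add_sq s t]

/-- For each sign, the difference of the two sides is a sum of two squares, since zₓy and yₓz enter
with opposite signs. -/
theorem abs_cross_le {m t : ℝ} (hm : 0 < m) (ht : 0 < t) (y z yx zx : ℝ) :
    |zx * y - yx * z| * (2 * (m * t)) ≤ m ^ 2 * (yx ^ 2 + zx ^ 2) + t ^ 2 * (y ^ 2 + z ^ 2) := by
  rw [← abs_of_pos (show 0 < 2 * (m * t) by positivity), ← abs_mul]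
  refine abs_le.2 ⟨?_, ?_⟩
  · linarith [sq_nonneg (m * zx + t * y), sq_nonneg (m * yx - t * z)]
  · linarith [sq_nonneg (m * zx - t * y), sq_nonneg (m * yx + t * z)]

namespace Weight

variable {J : Set Torus} {T k μ α M δ ε : ℝ} (W : Weight J T k μ α M δ ε)
  {p : ℝ × Torus}

include W in
theorem M_pos : 0 < M := lt_of_lt_of_le one_pos W.one_le_M

include W in
theorem μ_pos : 0 < μ := lt_of_lt_of_le one_pos W.one_le_μ

theorem one_le_ε_mul_θ (hp : p ∈ cyl T) : 1 ≤ ε * W.θ p :=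
  le_trans (by linarith [W.α_nonneg]) (W.one_le_θ p hp)

theorem θ_pos (hp : p ∈ cyl T) : 0 < W.θ p :=
  pos_of_mul_pos_right (lt_of_lt_of_le one_pos (W.one_le_ε_mul_θ hp)) W.ε_pos.le

theorem abs_g_le (hp : p ∈ cyl T) : |W.g p| ≤ ε * W.θ p :=
  le_trans (le_mul_of_one_le_left (abs_nonneg _) (by linarith [W.α_nonneg])) (W.g_le p hp)

theorem D1_sq_le : W.D1 p ^ 2 ≤ M ^ 2 := sq_le_sq' (abs_le.1 (W.D1_le p)).1 (abs_le.1 (W.D1_le p)).2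

theorem a_sq_le : W.a p ^ 2 ≤ M ^ 2 * (μ ^ 2 * W.θ p ^ 2) := by
  have h := W.D1_sq_le (p := p)
  calc W.a p ^ 2 = W.D1 p ^ 2 * (μ ^ 2 * W.θ p ^ 2) := by unfold a; ring
    _ ≤ _ := by gcongr

theorem abs_a_le (hp : p ∈ cyl T) : |W.a p| ≤ M * (μ * W.θ p) := by
  have h1 := W.θ_pos hp
  have h2 := W.μ_pos
  rw [a, abs_mul, abs_mul, abs_of_pos h1, abs_of_pos h2]
  calc μ * |W.D1 p| * W.θ p ≤ μ * M * W.θ p := by gcongr; exact W.D1_le p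
    _ = _ := by ring

/-- The constant 15 is the sum 1 + 6 + 3 + 4 + 1 of the coefficients in `axxx`; each monomial is at
most M⁴μ⁴ because M ≥ 1 and μ ≥ 1. Only one power of `θ` appears, so this is a remainder against θ³.
-/
theorem abs_axxx_le (hp : p ∈ cyl T) : |W.axxx p| ≤ 15 * M ^ 4 * (μ ^ 4 * W.θ p) := by
  have h0 := W.θ_pos hp
  have h1 := W.μ_pos
  have hm := W.one_le_μ
  have hM := W.one_le_M
  have hM0 := W.M_pos
  have e1 : |μ ^ 4 * W.D1 p ^ 4| ≤ M ^ 4 * μ ^ 4 := by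
    rw [abs_mul, abs_pow, abs_pow, abs_of_pos h1]
    have := W.D1_le p
    rw [mul_comm]
    gcongr
  have e2 : |6 * μ ^ 3 * W.D1 p ^ 2 * W.D2 p| ≤ 6 * (M ^ 4 * μ ^ 4) := by
    simp only [abs_mul, abs_pow, abs_of_pos h1]
    rw [abs_of_pos (by norm_num : (0 : ℝ) < 6)]
    calc 6 * μ ^ 3 * |W.D1 p| ^ 2 * |W.D2 p| ≤ 6 * μ ^ 4 * M ^ 2 * M ^ 2 := by
          gcongr
          · norm_num
          · exact W.D1_le p
          · exact (W.D2_le p).trans (le_self_pow₀ hM (by norm_num))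
      _ = _ := by ring
  have e3 : |3 * μ ^ 2 * W.D2 p ^ 2| ≤ 3 * (M ^ 4 * μ ^ 4) := by
    simp only [abs_mul, abs_pow, abs_of_pos h1]
    rw [abs_of_pos (by norm_num : (0 : ℝ) < 3)]
    calc 3 * μ ^ 2 * |W.D2 p| ^ 2 ≤ 3 * μ ^ 4 * M ^ 4 := by
          gcongr
          · norm_num
          · exact (pow_le_pow_left₀ (abs_nonneg _) (W.D2_le p) 2).trans
              (pow_le_pow_right₀ hM (by norm_num))
      _ = _ := by ring
  have e4 : |4 * μ ^ 2 * W.D1 p * W.D3 p| ≤ 4 * (M ^ 4 * μ ^ 4) := by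
    simp only [abs_mul, abs_pow, abs_of_pos h1]
    rw [abs_of_pos (by norm_num : (0 : ℝ) < 4)]
    calc 4 * μ ^ 2 * |W.D1 p| * |W.D3 p| ≤ 4 * μ ^ 4 * M ^ 2 * M ^ 2 := by
          gcongr
          · norm_num
          · exact (W.D1_le p).trans (le_self_pow₀ hM (by norm_num))
          · exact (W.D3_le p).trans (le_self_pow₀ hM (by norm_num))
      _ = _ := by ring
  have e5 : |μ * W.D4 p| ≤ M ^ 4 * μ ^ 4 := by
    simp only [abs_mul, abs_of_pos h1]
    rw [mul_comm]
    gcongr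
    · exact (W.D4_le p).trans (le_self_pow₀ hM (by norm_num))
    · exact le_self_pow₀ hm (by norm_num)
  rw [axxx, abs_mul, abs_of_pos h0]
  have key : |μ ^ 4 * W.D1 p ^ 4 + 6 * μ ^ 3 * W.D1 p ^ 2 * W.D2 p + 3 * μ ^ 2 * W.D2 p ^ 2
    + 4 * μ ^ 2 * W.D1 p * W.D3 p + μ * W.D4 p| ≤ 15 * (M ^ 4 * μ ^ 4) := by
    refine (abs_add_le _ _).trans ?_
    refine (add_le_add ((abs_add_le _ _).trans (add_le_add ((abs_add_le _ _).trans
      (add_le_add (abs_add_le _ _) le_rfl)) le_rfl)) le_rfl).trans ?_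
    linarith
  calc _ ≤ 15 * (M ^ 4 * μ ^ 4) * W.θ p := by gcongr
    _ = _ := by ring

/-- Lower bound for the principal part of the quadratic form. -/
theorem principal_lower_bound (hδ : 0 < δ) (hδ1 : δ ≤ 1) (hμ : 2 * M ≤ δ * μ) (hp : p ∈ cyl T)
    {X Y : ℝ} (hX : 0 ≤ X) (hY : 0 ≤ Y) :
    2 * δ ^ 2 * (μ ^ 2 * W.θ p * X + μ ^ 4 * W.θ p ^ 3 * Y) ≤
      4 * W.ax p * X + 4 * W.a p ^ 2 * W.ax p * Y
        + (4 * M ^ 3 + 2) * W.ζ p ^ 4 * (μ ^ 2 * W.θ p * X + μ ^ 4 * W.θ p ^ 3 * Y) := by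
  have h0 := W.θ_pos hp
  have h1 := W.μ_pos
  have hm := W.one_le_μ
  have hM := W.one_le_M
  have hM0 := W.M_pos
  have hD2 := (abs_le.1 (W.D2_le p)).1
  -- Where ζ = 1 nothing is positive, but aₓ ≥ −M μ²θ, and the ζ⁴ term pays for it: 4M³ covers the
  -- negative part and 2 covers the left side, as δ ≤ 1. Elsewhere D₁² ≥ δ, and 2M ≤ δμ makes μ²D₁²
  -- dominate μD₂ in aₓ.
  rcases W.crit p with hz | hd
  · have hax : -(M * (μ ^ 2 * W.θ p)) ≤ W.ax p := by
      have : -(M * μ ^ 2) ≤ μ ^ 2 * W.D1 p ^ 2 + μ * W.D2 p := by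
        have e1 : 0 ≤ μ ^ 2 * W.D1 p ^ 2 := by positivity
        have e2 : μ * (-M) ≤ μ * W.D2 p := by gcongr
        have e3 : μ * M ≤ μ ^ 2 * M := by gcongr; exact le_self_pow₀ hm (by norm_num)
        linarith
      calc -(M * (μ ^ 2 * W.θ p)) = -(M * μ ^ 2) * W.θ p := by ring
        _ ≤ _ := by unfold ax; gcongr
    have hMM : M ≤ M ^ 3 := le_self_pow₀ hM (by norm_num)
    have b1 : -(4 * M ^ 3) * (μ ^ 2 * W.θ p * X) ≤ 4 * W.ax p * X := by
      have : -(M ^ 3 * (μ ^ 2 * W.θ p)) ≤ W.ax p :=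
        le_trans (neg_le_neg (by gcongr)) hax
      nlinarith [mul_le_mul_of_nonneg_right this hX]
    have b2 : -(4 * M ^ 3) * (μ ^ 4 * W.θ p ^ 3 * Y) ≤ 4 * W.a p ^ 2 * W.ax p * Y := by
      have e1 : W.a p ^ 2 * (M * (μ ^ 2 * W.θ p)) ≤
          (M ^ 2 * (μ ^ 2 * W.θ p ^ 2)) * (M * (μ ^ 2 * W.θ p)) := by
        gcongr
        exact W.a_sq_le
      have e2 := mul_le_mul_of_nonneg_left hax (sq_nonneg (W.a p))
      have e3 : -(M ^ 3 * (μ ^ 4 * W.θ p ^ 3)) ≤ W.a p ^ 2 * W.ax p := by nlinarith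
      nlinarith [mul_le_mul_of_nonneg_right e3 hY]
    have hR : 0 ≤ μ ^ 2 * W.θ p * X + μ ^ 4 * W.θ p ^ 3 * Y := by positivity
    have hδ2 : δ ^ 2 ≤ 1 := pow_le_one₀ hδ.le hδ1
    have b3 := mul_le_mul_of_nonneg_right hδ2 hR
    rw [hz]
    linarith
  · have hax : δ / 2 * (μ ^ 2 * W.θ p) ≤ W.ax p := by
      have : δ / 2 * μ ^ 2 ≤ μ ^ 2 * W.D1 p ^ 2 + μ * W.D2 p := by
        have e1 : μ ^ 2 * δ ≤ μ ^ 2 * W.D1 p ^ 2 := by gcongr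
        have e2 : μ * (-M) ≤ μ * W.D2 p := by gcongr
        have e3 : μ * (2 * M) ≤ μ * (δ * μ) := by gcongr
        nlinarith
      calc δ / 2 * (μ ^ 2 * W.θ p) = (δ / 2 * μ ^ 2) * W.θ p := by ring
        _ ≤ _ := by unfold ax; gcongr
    have ha : δ * (μ ^ 2 * W.θ p ^ 2) ≤ W.a p ^ 2 := by
      calc δ * (μ ^ 2 * W.θ p ^ 2) ≤ W.D1 p ^ 2 * (μ ^ 2 * W.θ p ^ 2) := by gcongr
        _ = _ := by unfold a; ring
    have b1 : 2 * δ ^ 2 * (μ ^ 2 * W.θ p * X) ≤ 4 * W.ax p * X := by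
      have : 2 * δ ^ 2 * (μ ^ 2 * W.θ p) ≤ 4 * W.ax p := by
        have : δ ^ 2 * (μ ^ 2 * W.θ p) ≤ δ * (μ ^ 2 * W.θ p) := by
          gcongr; exact pow_le_of_le_one hδ.le hδ1 (by norm_num)
        linarith
      nlinarith [mul_le_mul_of_nonneg_right this hX]
    have b2 : 2 * δ ^ 2 * (μ ^ 4 * W.θ p ^ 3 * Y) ≤ 4 * W.a p ^ 2 * W.ax p * Y := by
      have : δ * (μ ^ 2 * W.θ p ^ 2) * (δ / 2 * (μ ^ 2 * W.θ p)) ≤ W.a p ^ 2 * W.ax p := by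
        gcongr
      nlinarith [mul_le_mul_of_nonneg_right this hY]
    have b3 : 0 ≤ (4 * M ^ 3 + 2) * W.ζ p ^ 4 * (μ ^ 2 * W.θ p * X + μ ^ 4 * W.θ p ^ 3 * Y) := by
      positivity
    linarith

/-- Lower bound for the quadratic form of the cross term. -/
theorem cross_lower_bound (hδ : 0 < δ) (hδ1 : δ ≤ 1) (hμ : 2 * M ≤ δ * μ)
    (hε : 24 * M ^ 4 * ε ≤ δ ^ 2) {c₁ c₂ : ℝ} (hc : c₁ ^ 2 + c₂ ^ 2 ≤ 1) (hp : p ∈ cyl T)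
    (y z yx zx : ℝ) :
    δ ^ 2 * (μ ^ 2 * W.θ p * (yx ^ 2 + zx ^ 2) + μ ^ 4 * W.θ p ^ 3 * (y ^ 2 + z ^ 2)) ≤
      (4 * W.ax p * (yx ^ 2 + zx ^ 2)
        + (4 * W.a p ^ 2 * W.ax p - W.axxx p + 4 * c₁ * W.g p * W.a p ^ 2
            + (c₁ ^ 2 + c₂ ^ 2) * W.bt p) * (y ^ 2 + z ^ 2)
        - 4 * c₂ * (W.g p * W.a p) * (zx * y - yx * z))
      + (4 * M ^ 3 + 2) * W.ζ p ^ 4 *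
        (μ ^ 2 * W.θ p * (yx ^ 2 + zx ^ 2) + μ ^ 4 * W.θ p ^ 3 * (y ^ 2 + z ^ 2)) := by
  have h0 := W.θ_pos hp
  have h1 := W.μ_pos
  have hm := W.one_le_μ
  have hM := W.one_le_M
  have hM0 := W.M_pos
  have hε0 := W.ε_pos
  have hεθ := W.one_le_ε_mul_θ hp
  have hM2 : 1 ≤ M ^ 2 := one_le_pow₀ hM
  have hM4 : 1 ≤ M ^ 4 := one_le_pow₀ hM
  have hM24 : M ^ 2 ≤ M ^ 4 := pow_le_pow_right₀ hM (by norm_num)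
  have hM14 : M ≤ M ^ 4 := le_self_pow₀ hM (by norm_num)
  have hm24 : μ ^ 2 ≤ μ ^ 4 := pow_le_pow_right₀ hm (by norm_num)
  have hm4 : 1 ≤ μ ^ 4 := one_le_pow₀ hm
  have hm2 : 1 ≤ μ ^ 2 := one_le_pow₀ hm
  have hε1 : ε ≤ 1 := by
    have : δ ^ 2 ≤ 1 := pow_le_one₀ hδ.le hδ1
    nlinarith
  have hc1 : |c₁| ≤ 1 := abs_le_one_iff_mul_self_le_one.2 (by nlinarith)
  have hc2 : |c₂| ≤ 1 := abs_le_one_iff_mul_self_le_one.2 (by nlinarith)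
  set X := yx ^ 2 + zx ^ 2 with hX
  set Y := y ^ 2 + z ^ 2 with hY
  have hX0 : 0 ≤ X := by positivity
  have hY0 : 0 ≤ Y := by positivity
  -- The four remainders `e1` to `e4` cost 15, 4, 1 and 2 multiples of G. Since 24 G ≤ δ², together
  -- they use at most half of the coefficient 2δ² supplied by the principal part.
  set G := M ^ 4 * ε with hG
  have hG0 : 0 ≤ G := by positivity
  set Θ := μ ^ 4 * W.θ p ^ 3 with hΘ
  have hΘ0 : 0 ≤ Θ := by positivity
  have main := W.principal_lower_bound hδ hδ1 hμ hp hX0 hY0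
  have e1 : |W.axxx p| ≤ 15 * G * Θ := by
    refine (W.abs_axxx_le hp).trans ?_
    have : W.θ p ≤ ε * W.θ p ^ 3 := by
      have e : 1 ≤ ε * W.θ p ^ 2 := by
        -- With ε ≤ 1 this gives ε θ² ≥ ε² θ² ≥ 1, which trades two powers of `θ` for a small factor
        -- ε.
        have : 1 ≤ (ε * W.θ p) ^ 2 := one_le_pow₀ hεθ
        nlinarith [sq_nonneg (W.θ p)]
      nlinarith
    calc 15 * M ^ 4 * (μ ^ 4 * W.θ p) ≤ 15 * M ^ 4 * (μ ^ 4 * (ε * W.θ p ^ 3)) := by gcongr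
      _ = _ := by rw [hG, hΘ]; ring
  have e2 : |4 * c₁ * W.g p * W.a p ^ 2| ≤ 4 * G * Θ := by
    rw [abs_mul, abs_mul, abs_mul, abs_of_pos (by norm_num : (0 : ℝ) < 4), abs_sq]
    calc 4 * |c₁| * |W.g p| * W.a p ^ 2
        ≤ 4 * 1 * (ε * W.θ p) * (M ^ 2 * (μ ^ 2 * W.θ p ^ 2)) := by
          gcongr
          · exact W.abs_g_le hp
          · exact W.a_sq_le
      _ = 4 * ε * W.θ p ^ 3 * (M ^ 2 * μ ^ 2) := by ring
      _ ≤ 4 * ε * W.θ p ^ 3 * (M ^ 4 * μ ^ 4) := by gcongr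
      _ = _ := by rw [hG, hΘ]; ring
  have e3 : |(c₁ ^ 2 + c₂ ^ 2) * W.bt p| ≤ G * Θ := by
    rw [abs_mul, abs_of_nonneg (by positivity)]
    calc (c₁ ^ 2 + c₂ ^ 2) * |W.bt p| ≤ 1 * (ε * W.θ p ^ 3) := by
          gcongr
          exact W.bt_le p hp
      _ = 1 * 1 * (ε * W.θ p ^ 3) := by ring
      _ ≤ M ^ 4 * μ ^ 4 * (ε * W.θ p ^ 3) := by gcongr
      _ = _ := by rw [hG, hΘ]; ring
  have e4 : |4 * c₂ * (W.g p * W.a p) * (zx * y - yx * z)| ≤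
      2 * G * (μ ^ 2 * W.θ p * X + Θ * Y) := by
    have s1 : |zx * y - yx * z| * (2 * (μ * W.θ p)) ≤ μ ^ 2 * X + W.θ p ^ 2 * Y :=
      abs_cross_le h1 h0 y z yx zx
    have s2 : μ ^ 2 * X + W.θ p ^ 2 * Y ≤ μ ^ 2 * X + μ ^ 4 * W.θ p ^ 2 * Y := by
      have : 1 * (W.θ p ^ 2 * Y) ≤ μ ^ 4 * (W.θ p ^ 2 * Y) := by gcongr
      linarith
    rw [abs_mul, abs_mul, abs_mul, abs_mul, abs_of_pos (by norm_num : (0 : ℝ) < 4)]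
    calc 4 * |c₂| * (|W.g p| * |W.a p|) * |zx * y - yx * z|
        ≤ 4 * 1 * ((ε * W.θ p) * (M * (μ * W.θ p))) * |zx * y - yx * z| := by
          gcongr
          · exact W.abs_g_le hp
          · exact W.abs_a_le hp
      _ = 2 * M * ε * W.θ p * (|zx * y - yx * z| * (2 * (μ * W.θ p))) := by ring
      _ ≤ 2 * M ^ 4 * ε * W.θ p * (μ ^ 2 * X + μ ^ 4 * W.θ p ^ 2 * Y) := by
          gcongr
          exact s1.trans s2
      _ = _ := by rw [hG, hΘ]; ring
  have f1 := mul_le_mul_of_nonneg_right (abs_le.1 e1).2 hY0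
  have f2 := mul_le_mul_of_nonneg_right (abs_le.1 e2).1 hY0
  have f3 := mul_le_mul_of_nonneg_right (abs_le.1 e3).1 hY0
  have f4 := (abs_le.1 e4).2
  have hR : 0 ≤ μ ^ 2 * W.θ p * X + Θ * Y := by positivity
  have f5 : 24 * G * (μ ^ 2 * W.θ p * X + Θ * Y) ≤ δ ^ 2 * (μ ^ 2 * W.θ p * X + Θ * Y) := by
    gcongr
    linarith
  have f6 : 0 ≤ G * (μ ^ 2 * W.θ p * X) := by positivity
  have f7 : 0 ≤ G * (Θ * Y) := by positivity
  linarith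

/-- The weighted first order energy density of `y` with space derivative `yx`. -/
def density (y yx : ℝ × Torus → ℝ) (p : ℝ × Torus) : ℝ :=
  W.E p ^ 2 * (μ ^ 4 * W.θ p ^ 3 * y p ^ 2 + μ ^ 2 * W.θ p * yx p ^ 2)

theorem rapid_E_sq_mul {f : ℝ × Torus → ℝ} (hf : Moderate T k f) :
    Rapid T k (fun p => W.E p ^ 2 * f p) := by
  have h : Rapid T k (fun p => W.E p * (W.E p * f p)) := W.rE.mul_moderate (by fun_prop)
  convert h using 2
  ring

theorem rapid_density {y yx : ℝ × Torus → ℝ} (hy : Moderate T k y) (hyx : Moderate T k yx) :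
    Rapid T k (W.density y yx) :=
  W.rapid_E_sq_mul (by fun_prop)

theorem density_nonneg (y yx : ℝ × Torus → ℝ) (hp : p ∈ cyl T) : 0 ≤ W.density y yx p := by
  have h0 := W.θ_pos hp
  unfold density
  positivity

/-- Two first order energies with comparable derivatives are comparable. -/
theorem energy_comparison (hp : p ∈ cyl T) {y yx zx : ℝ} (h : (zx - yx) ^ 2 ≤ W.a p ^ 2 * y ^ 2) :
    μ ^ 4 * W.θ p ^ 3 * y ^ 2 + μ ^ 2 * W.θ p * zx ^ 2 ≤
      3 * M ^ 2 * (μ ^ 4 * W.θ p ^ 3 * y ^ 2 + μ ^ 2 * W.θ p * yx ^ 2) := by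
  have h0 := W.θ_pos hp
  have h1 := W.μ_pos
  have hM2 : 1 ≤ M ^ 2 := one_le_pow₀ W.one_le_M
  have e1 : zx ^ 2 ≤ 2 * yx ^ 2 + 2 * (M ^ 2 * (μ ^ 2 * W.θ p ^ 2)) * y ^ 2 := by
    have := mul_le_mul_of_nonneg_right (W.a_sq_le (p := p)) (sq_nonneg y)
    nlinarith [sq_nonneg (zx - 2 * yx)]
  have e2 : μ ^ 2 * W.θ p * zx ^ 2 ≤
      μ ^ 2 * W.θ p * (2 * yx ^ 2 + 2 * (M ^ 2 * (μ ^ 2 * W.θ p ^ 2)) * y ^ 2) := by gcongr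
  have e3 : 1 * (μ ^ 4 * W.θ p ^ 3 * y ^ 2) ≤ M ^ 2 * (μ ^ 4 * W.θ p ^ 3 * y ^ 2) := by gcongr
  have e4 : 1 * (μ ^ 2 * W.θ p * yx ^ 2) ≤ M ^ 2 * (μ ^ 2 * W.θ p * yx ^ 2) := by gcongr
  have e5 : 0 ≤ μ ^ 2 * W.θ p * yx ^ 2 := by positivity
  nlinarith

/-- Carleman estimate for the complex second order operator `∂ₓ² - c ∂ₜ` with `|c| ≤ 1`. -/
theorem carleman_second_order (hδ : 0 < δ) (hδ1 : δ ≤ 1) (hμ : 2 * M ≤ δ * μ)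
    (hε : 24 * M ^ 4 * ε ≤ δ ^ 2) {c₁ c₂ : ℝ} (hc : c₁ ^ 2 + c₂ ^ 2 ≤ 1)
    (y z : SecondOrderJet T k) :
    δ ^ 2 * ∫ p in cyl T, (W.density y.u y.ux p + W.density z.u z.ux p) ≤
      3 * M ^ 2 * (∫ p in cyl T, W.E p ^ 2 * ((y.uxx p - c₁ * y.ut p + c₂ * z.ut p) ^ 2
          + (z.uxx p - c₁ * z.ut p - c₂ * y.ut p) ^ 2))
      + 3 * M ^ 2 * ((4 * M ^ 3 + 2) * (3 * M ^ 2)) *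
        ∫ p in cyl T, W.ζ p ^ 4 * (W.density y.u y.ux p + W.density z.u z.ux p) := by
  have hden : Rapid T k (fun p => W.density y.u y.ux p + W.density z.u z.ux p) :=
    (W.rapid_density y.mu y.mux).add (W.rapid_density z.mu z.mux)
  have hsrc : Rapid T k (fun p => W.E p ^ 2 * ((y.uxx p - c₁ * y.ut p + c₂ * z.ut p) ^ 2
          + (z.uxx p - c₁ * z.ut p - c₂ * y.ut p) ^ 2)) := W.rapid_E_sq_mul (by fun_prop)
  have hloc : Rapid T k
      (fun p => W.ζ p ^ 4 * (W.density y.u y.ux p + W.density z.u z.ux p)) :=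
    Rapid.moderate_mul (by fun_prop) hden
  have hnull := (W.null_cross c₁ c₂ (W.conj y) (W.conj z) (W.conj_isRapid y)
    (W.conj_isRapid z)).const_mul (-(3 * M ^ 2))
  rw [← integral_const_mul, ← integral_const_mul, ← integral_const_mul,
    ← integral_add (hsrc.const_mul _).integrableOn (hloc.const_mul _).integrableOn]
  refine setIntegral_le_of_null (hden.const_mul _).integrableOn
    ((hsrc.const_mul _).add (hloc.const_mul _)).integrableOn hnull fun p hp => ?_
  have hM2 : 1 ≤ M ^ 2 := one_le_pow₀ W.one_le_M
  have hM0 := W.M_pos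
  have h0 := W.θ_pos hp
  have key := W.cross_lower_bound hδ hδ1 hμ hε hc hp ((W.conj y).u p) ((W.conj z).u p)
    ((W.conj y).ux p) ((W.conj z).ux p)
  set Q := μ ^ 2 * W.θ p * ((W.conj y).ux p ^ 2 + (W.conj z).ux p ^ 2)
    + μ ^ 4 * W.θ p ^ 3 * ((W.conj y).u p ^ 2 + (W.conj z).u p ^ 2) with hQ
  have d (u : SecondOrderJet T k) : W.density u.u u.ux p =
      μ ^ 4 * W.θ p ^ 3 * (W.conj u).u p ^ 2 + μ ^ 2 * W.θ p * (W.E p * u.ux p) ^ 2 := by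
    simp only [density, conj]
    ring
  -- The conjugated derivative differs from E uₓ by a E u, so the two energies agree up to the
  -- factor 3M². One direction is used for the left side, the other for the localised term.
  have d1 (u : SecondOrderJet T k) : W.density u.u u.ux p ≤ 3 * M ^ 2 *
      (μ ^ 4 * W.θ p ^ 3 * (W.conj u).u p ^ 2 + μ ^ 2 * W.θ p * (W.conj u).ux p ^ 2) := by
    rw [d]
    exact W.energy_comparison hp (le_of_eq (by simp only [conj]; ring))
  have d2 (u : SecondOrderJet T k) :
      μ ^ 4 * W.θ p ^ 3 * (W.conj u).u p ^ 2 + μ ^ 2 * W.θ p * (W.conj u).ux p ^ 2 ≤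
        3 * M ^ 2 * W.density u.u u.ux p := by
    rw [d]
    exact W.energy_comparison hp (le_of_eq (by simp only [conj]; ring))
  have c1 : W.density y.u y.ux p + W.density z.u z.ux p ≤ 3 * M ^ 2 * Q :=
    (add_le_add (d1 y) (d1 z)).trans_eq (by rw [hQ]; ring)
  have c2 : Q ≤ 3 * M ^ 2 * (W.density y.u y.ux p + W.density z.u z.ux p) := by
    rw [mul_add]
    exact (le_of_eq (by rw [hQ]; ring)).trans (add_le_add (d2 y) (d2 z))
  have c3 : (4 * M ^ 3 + 2) * W.ζ p ^ 4 * Q ≤ (4 * M ^ 3 + 2) * W.ζ p ^ 4 *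
      (3 * M ^ 2 * (W.density y.u y.ux p + W.density z.u z.ux p)) := by gcongr
  have c4 : δ ^ 2 * (W.density y.u y.ux p + W.density z.u z.ux p) ≤ 3 * M ^ 2 * (δ ^ 2 * Q) := by
    calc _ ≤ δ ^ 2 * (3 * M ^ 2 * Q) := by gcongr
      _ = _ := by ring
  refine c4.trans ?_
  set S₁ := (W.conj y).uxx p + (W.a p ^ 2 + c₁ * W.b p) * (W.conj y).u p
    + c₂ * (W.conj z).ut p with hS₁
  set A₁ := -2 * W.a p * (W.conj y).ux p - W.ax p * (W.conj y).u p - c₁ * (W.conj y).ut p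
    - c₂ * W.b p * (W.conj z).u p with hA₁
  set S₂ := (W.conj z).uxx p + (W.a p ^ 2 + c₁ * W.b p) * (W.conj z).u p
    - c₂ * (W.conj y).ut p with hS₂
  set A₂ := -2 * W.a p * (W.conj z).ux p - W.ax p * (W.conj z).u p - c₁ * (W.conj z).ut p
    + c₂ * W.b p * (W.conj y).u p with hA₂
  -- This is the conjugation identity E(∂ₓ² − c∂ₜ)u = (S + A)(E u), separated into real and
  -- imaginary parts.
  have c5 : W.E p ^ 2 * ((y.uxx p - c₁ * y.ut p + c₂ * z.ut p) ^ 2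
      + (z.uxx p - c₁ * z.ut p - c₂ * y.ut p) ^ 2) = (S₁ + A₁) ^ 2 + (S₂ + A₂) ^ 2 := by
    simp only [hS₁, hA₁, hS₂, hA₂, conj]
    ring
  rw [c5]
  -- The squares of S and A are discarded: only u and its first space derivative have to be
  -- estimated.
  have c6 : 2 * (S₁ * A₁ + S₂ * A₂) ≤ (S₁ + A₁) ^ 2 + (S₂ + A₂) ^ 2 := by
    rw [mul_add]
    exact add_le_add (two_mul_mul_le_add_sq _ _) (two_mul_mul_le_add_sq _ _)
  have c7 := mul_le_mul_of_nonneg_left (key.trans (add_le_add le_rfl c3))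
    (show 0 ≤ 3 * M ^ 2 by positivity)
  have c8 := mul_le_mul_of_nonneg_left c6 (show 0 ≤ 3 * M ^ 2 by positivity)
  linarith

end Weight

end BeamCarleman

end

/-! ### Weighted Hardy, interpolation and energy inequalities. -/

noncomputable section

namespace BeamCarleman

/-- A function on the cylinder together with the derivatives occurring in the beam equation: `hⱼ`,
`vⱼ`, `wⱼ` are the `j`-th space derivatives of the function, its velocity and its acceleration. -/
structure BeamJet (T k : ℝ) where
  h0 : ℝ × Torus → ℝ
  h1 : ℝ × Torus → ℝ
  h2 : ℝ × Torus → ℝ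
  h3 : ℝ × Torus → ℝ
  h4 : ℝ × Torus → ℝ
  v0 : ℝ × Torus → ℝ
  v1 : ℝ × Torus → ℝ
  v2 : ℝ × Torus → ℝ
  v3 : ℝ × Torus → ℝ
  w0 : ℝ × Torus → ℝ
  w1 : ℝ × Torus → ℝ
  mh0 : Moderate T k h0
  mh1 : Moderate T k h1
  mh2 : Moderate T k h2
  mh3 : Moderate T k h3
  mh4 : Moderate T k h4
  mv0 : Moderate T k v0
  mv1 : Moderate T k v1
  mv2 : Moderate T k v2
  mv3 : Moderate T k v3
  mw0 : Moderate T k w0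
  mw1 : Moderate T k w1
  xh0 : HasDX T h0 h1
  xh1 : HasDX T h1 h2
  xh2 : HasDX T h2 h3
  xh3 : HasDX T h3 h4
  xv0 : HasDX T v0 v1
  xv1 : HasDX T v1 v2
  xv2 : HasDX T v2 v3
  xw0 : HasDX T w0 w1
  th0 : HasDT T h0 v0
  th1 : HasDT T h1 v1
  th2 : HasDT T h2 v2
  th3 : HasDT T h3 v3
  tv0 : HasDT T v0 w0
  tv1 : HasDT T v1 w1

attribute [fun_prop] BeamJet.mh0 BeamJet.mh1 BeamJet.mh2 BeamJet.mh3 BeamJet.mh4 BeamJet.mv0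
  BeamJet.mv1 BeamJet.mv2 BeamJet.mv3 BeamJet.mw0 BeamJet.mw1

theorem quadratic_nonneg {A B C : ℝ} (hA : 0 ≤ A) (hC : 0 ≤ C) (h : B ^ 2 ≤ 4 * A * C) (x y : ℝ) :
    0 ≤ A * x ^ 2 + B * (x * y) + C * y ^ 2 := by
  rcases hA.eq_or_lt with rfl | hA
  · have : B = 0 := by nlinarith
    subst this
    simpa using mul_nonneg hC (sq_nonneg y)
  · have : 0 ≤ A * (A * x ^ 2 + B * (x * y) + C * y ^ 2) := by
      nlinarith [sq_nonneg (2 * A * x + B * y), mul_nonneg (sub_nonneg.2 h) (sq_nonneg y)]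
    exact nonneg_of_mul_nonneg_right this hA

namespace Weight

variable {J : Set Torus} {T k μ α M δ ε : ℝ} (W : Weight J T k μ α M δ ε)
  {p : ℝ × Torus}

section Null

variable {c c' y y' z z' : ℝ × Torus → ℝ}

/-- One factor `E` is attached to y and the other to z. This gives the decay required by
`HasDX.null_mul`, and the term 2a comes from the logarithmic derivative of E². -/
theorem null_x (hc : HasDX T c c') (hy : HasDX T y y') (hz : HasDX T z z')
    (mc : Moderate T k c) (mc' : Moderate T k c') (my : Moderate T k y) (my' : Moderate T k y')
    (mz : Moderate T k z) (mz' : Moderate T k z') :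
    Null T fun p => W.E p ^ 2 * (c' p * (y p * z p)
      + c p * (y' p * z p + y p * z' p + 2 * W.a p * (y p * z p))) := by
  refine (HasDX.null_mul (k := k) hc (W.xE.mul hy) (W.xE.mul hz) mc mc'
    (W.rE.mul_moderate my) ?_ (by fun_prop) ?_).congr fun p => ?_
  · have : Rapid T k (fun p => W.E p * (W.a p * y p + y' p)) := W.rE.mul_moderate (by fun_prop)
    convert this using 2
    simp only [a]
    ring
  · have := W.mE
    fun_prop
  · simp only [a]
    ring

theorem null_t (hc : HasDT T c c') (hy : HasDT T y y') (hz : HasDT T z z')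
    (mc : Moderate T k c) (mc' : Moderate T k c') (my : Moderate T k y) (my' : Moderate T k y')
    (mz : Moderate T k z) (mz' : Moderate T k z') :
    Null T fun p => W.E p ^ 2 * (c' p * (y p * z p)
      + c p * (y' p * z p + y p * z' p + 2 * W.b p * (y p * z p))) := by
  refine (HasDT.null_mul W.T_pos W.two_le hc (W.tE.mul hy) (W.tE.mul hz) mc mc'
    (W.rE.mul_moderate my) ?_ (by fun_prop) (by fun_prop)).congr fun p => ?_
  · have : Rapid T k (fun p => W.E p * (W.b p * y p + y' p)) := W.rE.mul_moderate (by fun_prop)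
    convert this using 2
    ring
  · ring

end Null

/-- The weighted square `E² μⁱ θʲ y²`. -/
def term (i j : ℕ) (y : ℝ × Torus → ℝ) (p : ℝ × Torus) : ℝ :=
  W.E p ^ 2 * (μ ^ i * W.θ p ^ j * y p ^ 2)

theorem rapid_term (i j : ℕ) {y : ℝ × Torus → ℝ} (hy : Moderate T k y) :
    Rapid T k (W.term i j y) := W.rapid_E_sq_mul (by fun_prop)

theorem term_nonneg (i j : ℕ) (y : ℝ × Torus → ℝ) (hp : p ∈ cyl T) : 0 ≤ W.term i j y p := by
  have h0 := W.θ_pos hp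
  have h1 := W.μ_pos
  unfold term
  positivity

/-- A weighted Hardy-type inequality on the torus, localised near the critical points. -/
theorem integral_term_le_deriv (hδ : 0 < δ) (hε : 2 * M * ε ≤ δ) (l m : ℕ)
    {y y' : ℝ × Torus → ℝ} (hy : HasDX T y y') (my : Moderate T k y) (my' : Moderate T k y') :
    δ / 2 * ∫ p in cyl T, W.term (l + 2) (m + 2) y p ≤
      (∫ p in cyl T, W.term l m y' p)
        + δ * ∫ p in cyl T, W.ζ p ^ 2 * W.term (l + 2) (m + 2) y p := by
  have r1 := W.rapid_term (l + 2) (m + 2) my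
  have r2 := W.rapid_term l m my'
  have r3 : Rapid T k (fun p => W.ζ p ^ 2 * W.term (l + 2) (m + 2) y p) :=
    Rapid.moderate_mul (by fun_prop) r1
  -- The flux E² μ^(l+1) D₁ θ^(m+1) y² is chosen so that differentiating E² produces 2 a² y² with
  -- the required powers of μ and θ.
  have hnull := W.null_x (((W.xD1.const_mul (μ ^ (l + 1))).mul (W.xθ.pow (m + 1)))) hy hy
    (by fun_prop) (by fun_prop) my my' my my'
  rw [← integral_const_mul, ← integral_const_mul,
    ← integral_add r2.integrableOn (r3.const_mul _).integrableOn]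
  refine setIntegral_le_of_null (r1.const_mul _).integrableOn
    (r2.add (r3.const_mul _)).integrableOn hnull fun p hp => ?_
  have h0 := W.θ_pos hp
  have h1 := W.μ_pos
  have hm := W.one_le_μ
  have hM0 := W.M_pos
  have hεθ := W.one_le_ε_mul_θ hp
  have e1 : δ ≤ δ * W.ζ p ^ 2 + W.D1 p ^ 2 := by
    rcases W.crit p with h | h
    · rw [h]; nlinarith [sq_nonneg (W.D1 p)]
    · nlinarith [mul_nonneg hδ.le (sq_nonneg (W.ζ p))]
  have e2 : -(δ / 2 * (μ ^ 2 * W.θ p ^ 2)) ≤ μ * W.D2 p * W.θ p := by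
    have a1 : μ * (-M) * W.θ p ≤ μ * W.D2 p * W.θ p := by
      gcongr
      exact (abs_le.1 (W.D2_le p)).1
    have a2 : M ≤ δ / 2 * (μ * W.θ p) := by
      have : M * 1 ≤ M * (ε * W.θ p) := by gcongr
      have b1 : 2 * M * ε * W.θ p ≤ δ * W.θ p := by gcongr
      have b2 : δ * W.θ p * 1 ≤ δ * W.θ p * μ := by gcongr
      linarith
    have a3 := mul_le_mul_of_nonneg_left a2 (show 0 ≤ μ * W.θ p by positivity)
    linarith
  -- Completing this square absorbs the term 2a y y' and leaves one copy of a² y², which is bounded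
  -- below away from the critical points. The D₂ term of the flux is absorbed through εθ ≥ 1.
  have e3 : 0 ≤ (y' p + μ * W.D1 p * W.θ p * y p) ^ 2 := sq_nonneg _
  have e4 : 0 ≤ ((m : ℝ) + 1) * μ ^ 2 * W.D1 p ^ 2 * W.θ p * y p ^ 2 := by positivity
  have e5 := mul_le_mul_of_nonneg_right e1 (show 0 ≤ μ ^ 2 * W.θ p ^ 2 * y p ^ 2 by positivity)
  have e6 := mul_le_mul_of_nonneg_right e2 (sq_nonneg (y p))
  have key : δ / 2 * (μ ^ 2 * W.θ p ^ 2 * y p ^ 2) ≤ y' p ^ 2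
      + δ * (W.ζ p ^ 2 * (μ ^ 2 * W.θ p ^ 2 * y p ^ 2))
      + (((m : ℝ) + 1) * μ ^ 2 * W.D1 p ^ 2 * W.θ p * y p ^ 2 + μ * W.D2 p * W.θ p * y p ^ 2
        + 2 * (μ * W.D1 p * W.θ p) * y p * y' p + 2 * (μ * W.D1 p * W.θ p) ^ 2 * y p ^ 2) := by
    linarith
  have := mul_le_mul_of_nonneg_left key
    (show 0 ≤ W.E p ^ 2 * (μ ^ l * W.θ p ^ m) by positivity)
  simp only [term, a]
  push_cast
  refine le_trans (le_of_eq (by ring)) (this.trans (le_of_eq (by ring)))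

/-- Local interpolation: a localised first derivative is controlled by the function and the second
derivative. -/
theorem integral_local_deriv_le (hε : ε ≤ 1) (l m : ℕ) {τ : ℝ} (hτ : 0 < τ)
    {ρ ρ' σ y y' y'' : ℝ × Torus → ℝ} (hρ : HasDX T ρ ρ') (mρ : Moderate T k ρ)
    (mρ' : Moderate T k ρ') (hy : HasDX T y y') (hy' : HasDX T y' y'') (my : Moderate T k y)
    (my' : Moderate T k y') (my'' : Moderate T k y'')
    (hσ : IntegrableOn (fun p => σ p * W.term (l + 4) (m + 4) y p) (cyl T))
    (ρ_nonneg : ∀ p, 0 ≤ ρ p) (ρ_le : ∀ p, ρ p ≤ σ p)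
    (hρσ : ∀ p, ρ' p ^ 2 ≤ 16 * M ^ 2 * ρ p * σ p) :
    1 / 2 * ∫ p in cyl T, ρ p * W.term (l + 2) (m + 2) y' p ≤
      τ * (∫ p in cyl T, ρ p * W.term l m y'' p)
        + (τ⁻¹ + (16 + ((m : ℝ) + 4) ^ 2) * M ^ 2) *
          ∫ p in cyl T, σ p * W.term (l + 4) (m + 4) y p := by
  have r1 : Rapid T k (fun p => ρ p * W.term (l + 2) (m + 2) y' p) :=
    Rapid.moderate_mul mρ (W.rapid_term (l + 2) (m + 2) my')
  have r2 : Rapid T k (fun p => ρ p * W.term l m y'' p) :=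
    Rapid.moderate_mul mρ (W.rapid_term l m my'')
  -- The flux contains ρ y y', whose derivative supplies ρ y'² and ρ y y''.
  have hnull := W.null_x ((hρ.const_mul (μ ^ (l + 2))).mul (W.xθ.pow (m + 2))) hy hy'
    (by fun_prop) (by fun_prop) my my' my' my''
  rw [← integral_const_mul, ← integral_const_mul, ← integral_const_mul,
    ← integral_add (r2.const_mul _).integrableOn (hσ.const_mul _)]
  refine setIntegral_le_of_null (r1.const_mul _).integrableOn
    ((r2.const_mul _).integrableOn.add (hσ.const_mul _)) hnull fun p hp => ?_
  have h0 := W.θ_pos hp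
  have h1 := W.μ_pos
  have hm := W.one_le_μ
  have hM0 := W.M_pos
  have hεθ := W.one_le_ε_mul_θ hp
  have hθ : 1 ≤ W.θ p := hεθ.trans (mul_le_of_le_one_left h0.le hε)
  have hρ0 := ρ_nonneg p
  have hσ0 := hρ0.trans (ρ_le p)
  have hP : 1 ≤ μ * W.θ p := one_le_mul_of_one_le_of_one_le hm hθ
  set P := μ * W.θ p with hPdef
  have hP0 : 0 < P := by positivity
  set s := ((m : ℝ) + 2) * μ * W.D1 p + 2 * (μ * W.D1 p * W.θ p) with hs
  have hsq : s ^ 2 ≤ ((m : ℝ) + 4) ^ 2 * M ^ 2 * P ^ 2 := by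
    have : |s| ≤ ((m : ℝ) + 4) * M * P := by
      have e1 : s = (((m : ℝ) + 2) * μ + 2 * P) * W.D1 p := by rw [hs, hPdef]; ring
      have e2 : μ ≤ P := le_mul_of_one_le_right h1.le hθ
      rw [e1, abs_mul, abs_of_nonneg (by positivity)]
      calc (((m : ℝ) + 2) * μ + 2 * P) * |W.D1 p| ≤ (((m : ℝ) + 2) * P + 2 * P) * M := by
            gcongr
            exact W.D1_le p
        _ = _ := by ring
    calc s ^ 2 = |s| ^ 2 := (sq_abs s).symm
      _ ≤ (((m : ℝ) + 4) * M * P) ^ 2 := by gcongr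
      _ = _ := by ring
  -- A quarter of ρ y'² absorbs the derivative of the cutoff, through ρ'² ≤ 16M²ρσ. Another quarter,
  -- in `q2`, absorbs the derivative of the weight, and half remains. In `q3` the free parameter τ
  -- splits the product y y''.
  have q1 := quadratic_nonneg (A := ρ p / 4) (B := ρ' p) (C := 16 * M ^ 2 * σ p)
    (by positivity) (by positivity) ((hρσ p).trans (le_of_eq (by ring))) (y' p) (y p)
  have q2 : 0 ≤ ρ p * (y' p / 2 + s * y p) ^ 2 := by positivity
  have q3 : 0 ≤ ρ p * τ⁻¹ * (τ * y'' p + P ^ 2 * y p / 2) ^ 2 := by positivity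
  have q3' : ρ p * τ⁻¹ * (τ * y'' p + P ^ 2 * y p / 2) ^ 2 =
      τ * ρ p * y'' p ^ 2 + ρ p * P ^ 2 * (y p * y'' p) + τ⁻¹ * ρ p * P ^ 4 * y p ^ 2 / 4 := by
    field_simp
    ring
  have q4 : s ^ 2 * (ρ p * y p ^ 2) ≤ ((m : ℝ) + 4) ^ 2 * M ^ 2 * P ^ 2 * (σ p * y p ^ 2) := by
    gcongr
    exact ρ_le p
  have q5 : τ⁻¹ * ρ p * P ^ 4 * y p ^ 2 ≤ τ⁻¹ * σ p * P ^ 4 * y p ^ 2 := by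
    gcongr
    exact ρ_le p
  have q6 : 16 * M ^ 2 * σ p * y p ^ 2 * P ^ 2 ≤ 16 * M ^ 2 * σ p * y p ^ 2 * P ^ 4 := by
    gcongr 16 * M ^ 2 * σ p * y p ^ 2 * ?_
    exact pow_le_pow_right₀ hP (by norm_num)
  have q7 : 0 ≤ τ⁻¹ * σ p * P ^ 4 * y p ^ 2 := by positivity
  have key : 1 / 2 * (ρ p * P ^ 2 * y' p ^ 2) ≤ τ * (ρ p * y'' p ^ 2)
      + (τ⁻¹ + (16 + ((m : ℝ) + 4) ^ 2) * M ^ 2) * (σ p * P ^ 4 * y p ^ 2)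
      + P ^ 2 * (ρ p * y' p ^ 2 + ρ p * (y p * y'' p) + (ρ' p + ρ p * s) * (y p * y' p)) := by
    have t1 := mul_le_mul_of_nonneg_left q1 (sq_nonneg P)
    have t2 := mul_le_mul_of_nonneg_left q2 (sq_nonneg P)
    have t4 := mul_le_mul_of_nonneg_left q4 (sq_nonneg P)
    rw [q3'] at q3
    linarith
  have := mul_le_mul_of_nonneg_left key
    (show 0 ≤ W.E p ^ 2 * (μ ^ l * W.θ p ^ m) by positivity)
  simp only [term, a]
  simp only [hs, hPdef] at this
  push_cast
  refine le_trans (le_of_eq (by ring)) (this.trans (le_of_eq (by ring)))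

/-- Energy estimate for the mixed derivative in the presence of strong damping. -/
theorem integral_mixed_le (hα : 1 ≤ α) (hε : ε ≤ 1) (H : BeamJet T k) :
    α ^ 2 * ∫ p in cyl T, W.term 2 1 H.v1 p ≤
      2 * (∫ p in cyl T, W.E p ^ 2 * (H.w0 p - α * H.v2 p + H.h4 p) ^ 2)
        + 90 * M ^ 2 * (α ^ 2 * (∫ p in cyl T, W.term 4 3 H.v0 p)
          + ∫ p in cyl T, W.term 4 3 H.h2 p) := by
  have r1 := (W.rapid_term 2 1 H.mv1).const_mul (α ^ 2)
  have r2 : Rapid T k (fun p => W.E p ^ 2 * (H.w0 p - α * H.v2 p + H.h4 p) ^ 2) :=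
    W.rapid_E_sq_mul (by fun_prop)
  have r3 := (W.rapid_term 4 3 H.mv0).const_mul (α ^ 2)
  have r4 := W.rapid_term 4 3 H.mh2
  have xn : HasDX T (fun p => μ * W.D1 p * W.θ p * (1 + 2 * W.θ p)) (fun p =>
      W.ax p * (1 + 2 * W.θ p) + 2 * (μ * W.D1 p * W.θ p) ^ 2) :=
    ((W.xa.mul ((HasDX.const 1).add (W.xθ.const_mul 2)))).congr fun p => by simp only [a]; ring
  -- These identities amount to testing the equation with θE²∂ₜη. `N1` and `N2` are the time
  -- derivatives of the kinetic and bending energies, `N3` extracts α|∂ₓ∂ₜη|² from the damping, and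
  -- `N4` to `N6` move two space derivatives off ∂ₓ⁴η.
  have N1 := W.null_t W.tθ H.tv0 H.tv0 (by fun_prop) (by fun_prop) H.mv0 H.mw0 H.mv0 H.mw0
  have N2 := W.null_t W.tθ H.th2 H.th2 (by fun_prop) (by fun_prop) H.mh2 H.mv2 H.mh2 H.mv2
  have N3 := W.null_x W.xθ H.xv1 H.xv0 (by fun_prop) (by fun_prop) H.mv1 H.mv2 H.mv0 H.mv1
  have N4 := W.null_x W.xθ H.xh3 H.xv0 (by fun_prop) (by fun_prop) H.mh3 H.mh4 H.mv0 H.mv1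
  have N5 := W.null_x W.xθ H.xh2 H.xv1 (by fun_prop) (by fun_prop) H.mh2 H.mh3 H.mv1 H.mv2
  have N6 := W.null_x xn H.xh2 H.xv0 (by fun_prop) (by fun_prop) H.mh2 H.mh3 H.mv0 H.mv1
  have hnull := (((((N1.add N2).const_mul (1 / 2)).add (N3.const_mul (-α))).add N4).add
    ((N5.add N6).const_mul (-1))).const_mul (-2 * α * μ ^ 2)
  rw [← integral_const_mul, ← integral_const_mul, ← integral_const_mul,
    ← integral_add r3.integrableOn r4.integrableOn, ← integral_const_mul,
    ← integral_add (r2.const_mul _).integrableOn ((r3.add r4).const_mul _).integrableOn]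
  refine setIntegral_le_of_null r1.integrableOn
    ((r2.const_mul _).add ((r3.add r4).const_mul _)).integrableOn hnull fun p hp => ?_
  have h0 := W.θ_pos hp
  have h1 := W.μ_pos
  have hm := W.one_le_μ
  have hM := W.one_le_M
  have hM0 := W.M_pos
  have hM2 : 1 ≤ M ^ 2 := one_le_pow₀ hM
  have hm2 : 1 ≤ μ ^ 2 := one_le_pow₀ hm
  have hεθ := W.one_le_ε_mul_θ hp
  have hθ : 1 ≤ W.θ p := hεθ.trans (mul_le_of_le_one_left h0.le hε)
  set θ := W.θ p with hθdef
  -- The functions n₁, n₂ and β are (θE²)ₓ, (θE²)ₓₓ and (θE²)ₜ, each divided by E².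
  set n₁ := μ * W.D1 p * θ * (1 + 2 * θ) with hn₁
  set n₂ := W.ax p * (1 + 2 * θ) + 2 * (μ * W.D1 p * θ) ^ 2 + 2 * (μ * W.D1 p * θ) * n₁ with hn₂
  set β := (W.g p + 2 * W.b p) * θ with hβ
  set f := H.w0 p - α * H.v2 p + H.h4 p with hf
  have hα0 : 0 < α := by linarith
  have bn₁ : |n₁| ≤ 3 * M * (μ * θ ^ 2) := by
    rw [hn₁, abs_mul, abs_of_pos (show 0 < 1 + 2 * θ by positivity)]
    calc |μ * W.D1 p * θ| * (1 + 2 * θ) ≤ (M * (μ * θ)) * (θ + 2 * θ) := by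
          gcongr
          exact W.abs_a_le hp
      _ = _ := by ring
  have bn₂ : |n₂| ≤ 14 * M ^ 2 * (μ ^ 2 * θ ^ 3) := by
    have e0 : |W.ax p| ≤ 2 * M ^ 2 * μ ^ 2 * θ := by
      rw [ax, abs_mul, abs_of_pos h0]
      have a1 : |μ ^ 2 * W.D1 p ^ 2 + μ * W.D2 p| ≤ μ ^ 2 * M ^ 2 + μ ^ 2 * M ^ 2 := by
        refine (abs_add_le _ _).trans (add_le_add ?_ ?_)
        · rw [abs_of_nonneg (by positivity)]
          exact mul_le_mul_of_nonneg_left W.D1_sq_le (by positivity)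
        · rw [abs_mul, abs_of_pos h1]
          gcongr
          · exact le_self_pow₀ hm (by norm_num)
          · exact (W.D2_le p).trans (le_self_pow₀ hM (by norm_num))
      calc _ ≤ (μ ^ 2 * M ^ 2 + μ ^ 2 * M ^ 2) * W.θ p := by gcongr
        _ = _ := by ring
    have e1 : |W.ax p * (1 + 2 * θ)| ≤ 6 * M ^ 2 * (μ ^ 2 * θ ^ 2) := by
      rw [abs_mul, abs_of_pos (show 0 < 1 + 2 * θ by positivity)]
      calc |W.ax p| * (1 + 2 * θ) ≤ (2 * M ^ 2 * μ ^ 2 * θ) * (θ + 2 * θ) := by gcongr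
        _ = _ := by ring
    have e2 : |2 * (μ * W.D1 p * θ) ^ 2| ≤ 2 * (M ^ 2 * (μ ^ 2 * θ ^ 2)) := by
      rw [abs_of_nonneg (by positivity)]
      gcongr
      exact W.a_sq_le
    have e3 : |2 * (μ * W.D1 p * θ) * n₁| ≤ 6 * M ^ 2 * (μ ^ 2 * θ ^ 3) := by
      rw [abs_mul, abs_mul, abs_of_pos (by norm_num : (0 : ℝ) < 2)]
      calc 2 * |μ * W.D1 p * θ| * |n₁| ≤ 2 * (M * (μ * θ)) * (3 * M * (μ * θ ^ 2)) := by
            gcongr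
            exact W.abs_a_le hp
        _ = _ := by ring
    have e4 : 8 * M ^ 2 * (μ ^ 2 * θ ^ 2) ≤ 8 * M ^ 2 * (μ ^ 2 * θ ^ 3) := by
      gcongr 8 * M ^ 2 * (μ ^ 2 * ?_)
      exact pow_le_pow_right₀ hθ (by norm_num)
    refine (abs_add_le _ _).trans ((add_le_add (abs_add_le _ _) le_rfl).trans ?_)
    linarith
  -- Here the factor 1 + α in `g_le` and `b_le` is spent: the time derivative of the weight is
  -- multiplied by α, yet must be bounded independently of α.
  have bβ : α * |β| ≤ 3 * θ ^ 3 := by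
    have hα1 : α ≤ 1 + α := by linarith
    have e1 : α * |W.g p| ≤ θ ^ 2 := by
      calc α * |W.g p| ≤ (1 + α) * |W.g p| := by gcongr
        _ ≤ ε * θ := W.g_le p hp
        _ ≤ 1 * θ ^ 2 := by gcongr; exact le_self_pow₀ hθ (by norm_num)
        _ = θ ^ 2 := one_mul _
    have e2 : α * |W.b p| ≤ θ ^ 2 := by
      calc α * |W.b p| ≤ (1 + α) * |W.b p| := by gcongr
        _ ≤ ε * θ ^ 2 := W.b_le p hp
        _ ≤ 1 * θ ^ 2 := by gcongr
        _ = θ ^ 2 := one_mul _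
    rw [hβ, abs_mul, abs_of_pos h0]
    have e3 : |W.g p + 2 * W.b p| ≤ |W.g p| + 2 * |W.b p| := by
      refine (abs_add_le _ _).trans (le_of_eq ?_)
      rw [abs_mul, abs_of_pos (by norm_num : (0 : ℝ) < 2)]
    calc α * (|W.g p + 2 * W.b p| * θ) ≤ α * ((|W.g p| + 2 * |W.b p|) * θ) := by gcongr
      _ = (α * |W.g p| + 2 * (α * |W.b p|)) * θ := by ring
      _ ≤ (θ ^ 2 + 2 * θ ^ 2) * θ := by gcongr
      _ = _ := by ring
  set V := H.v0 p
  set V₁ := H.v1 p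
  set K := H.h2 p
  set Θ := μ ^ 4 * θ ^ 3 with hΘ
  have hΘ0 : 0 < Θ := by positivity
  have sn₁ : n₁ ^ 2 * μ ^ 2 ≤ 9 * M ^ 2 * Θ * θ := by
    calc n₁ ^ 2 * μ ^ 2 = |n₁| ^ 2 * μ ^ 2 := by rw [sq_abs]
      _ ≤ (3 * M * (μ * θ ^ 2)) ^ 2 * μ ^ 2 := by gcongr
      _ = _ := by rw [hΘ]; ring
  -- the five error terms
  have t1 : 2 * α * μ ^ 2 * θ * (V * f) ≤ f ^ 2 + α ^ 2 * M ^ 2 * Θ * V ^ 2 := by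
    have a1 : (α * μ ^ 2 * θ * V) ^ 2 ≤ α ^ 2 * M ^ 2 * Θ * V ^ 2 := by
      calc (α * μ ^ 2 * θ * V) ^ 2 = α ^ 2 * 1 * (μ ^ 4 * θ ^ 2) * V ^ 2 := by ring
        _ ≤ α ^ 2 * M ^ 2 * (μ ^ 4 * θ ^ 3) * V ^ 2 := by
          have := pow_le_pow_right₀ hθ (show 2 ≤ 3 by norm_num)
          gcongr
        _ = _ := by rw [hΘ]
    nlinarith [sq_nonneg (f - α * μ ^ 2 * θ * V)]
  have t2 : α * μ ^ 2 * (β * (V ^ 2 + K ^ 2)) ≤ 3 * M ^ 2 * Θ * (α ^ 2 * V ^ 2 + K ^ 2) := by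
    calc α * μ ^ 2 * (β * (V ^ 2 + K ^ 2)) ≤ μ ^ 2 * (α * |β|) * (V ^ 2 + K ^ 2) := by
          have : β ≤ |β| := le_abs_self β
          calc _ = μ ^ 2 * (α * β) * (V ^ 2 + K ^ 2) := by ring
            _ ≤ _ := by gcongr
      _ ≤ μ ^ 4 * (3 * θ ^ 3) * (α ^ 2 * V ^ 2 + K ^ 2) := by
          have e1 := pow_le_pow_right₀ hm (show 2 ≤ 4 by norm_num)
          have e2 := le_mul_of_one_le_left (sq_nonneg V) (one_le_pow₀ hα (n := 2))
          gcongr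
      _ = 3 * 1 * Θ * (α ^ 2 * V ^ 2 + K ^ 2) := by rw [hΘ]; ring
      _ ≤ _ := by gcongr
  -- The identity yields 2α²μ²θV₁². The errors `t3` and `t4` take half a unit of α²μ²θV₁² each,
  -- leaving the single unit on the left of `key`.
  have t3 : -(2 * α ^ 2 * μ ^ 2 * (n₁ * (V₁ * V))) ≤
      1 / 2 * α ^ 2 * μ ^ 2 * θ * V₁ ^ 2 + 18 * M ^ 2 * Θ * α ^ 2 * V ^ 2 := by
    have := quadratic_nonneg (A := 1 / 2 * α ^ 2 * μ ^ 2 * θ) (B := 2 * α ^ 2 * μ ^ 2 * n₁)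
      (C := 18 * M ^ 2 * Θ * α ^ 2) (by positivity) (by positivity) (by
        have := mul_le_mul_of_nonneg_left sn₁ (show 0 ≤ 4 * α ^ 4 * μ ^ 2 by positivity)
        linarith) V₁ V
    linarith
  have t4 : -(4 * α * μ ^ 2 * (n₁ * (K * V₁))) ≤
      1 / 2 * α ^ 2 * μ ^ 2 * θ * V₁ ^ 2 + 72 * M ^ 2 * Θ * K ^ 2 := by
    have := quadratic_nonneg (A := 1 / 2 * α ^ 2 * μ ^ 2 * θ) (B := 4 * α * μ ^ 2 * n₁)
      (C := 72 * M ^ 2 * Θ) (by positivity) (by positivity) (by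
        have := mul_le_mul_of_nonneg_left sn₁ (show 0 ≤ 16 * α ^ 2 * μ ^ 2 by positivity)
        linarith) V₁ K
    linarith
  have t5 : -(2 * α * μ ^ 2 * (n₂ * (K * V))) ≤ 14 * M ^ 2 * Θ * (α ^ 2 * V ^ 2 + K ^ 2) := by
    have := quadratic_nonneg (A := 14 * M ^ 2 * Θ * α ^ 2) (B := 2 * α * μ ^ 2 * n₂)
      (C := 14 * M ^ 2 * Θ) (by positivity) (by positivity) (by
        have e : n₂ ^ 2 ≤ (14 * M ^ 2 * (μ ^ 2 * θ ^ 3)) ^ 2 := by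
          rw [← sq_abs n₂]
          gcongr
        have := mul_le_mul_of_nonneg_left e (show 0 ≤ 4 * α ^ 2 * μ ^ 4 by positivity)
        refine (le_of_eq (by ring)).trans (this.trans (le_of_eq ?_))
        rw [hΘ]
        ring) V K
    linarith
  have q1 : 0 ≤ M ^ 2 * Θ * α ^ 2 * V ^ 2 := by positivity
  have q2 : 0 ≤ M ^ 2 * Θ * K ^ 2 := by positivity
  have q3 : 0 ≤ f ^ 2 := sq_nonneg f
  have key : α ^ 2 * (μ ^ 2 * θ * V₁ ^ 2) ≤
      2 * f ^ 2 + 90 * M ^ 2 * (α ^ 2 * (Θ * V ^ 2) + Θ * K ^ 2)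
      + (-2 * α * μ ^ 2) * (θ * (V * f) + 1 / 2 * (β * (V ^ 2 + K ^ 2)) - α * (n₁ * (V₁ * V))
        - α * θ * V₁ ^ 2 - 2 * (n₁ * (K * V₁)) - n₂ * (K * V)) := by
    linarith
  have := mul_le_mul_of_nonneg_left key (sq_nonneg (W.E p))
  refine le_trans (le_of_eq ?_) (this.trans (le_of_eq ?_))
  · simp only [term]
    ring
  · simp only [term, a, hn₂, hn₁, hβ, hf, hΘ]
    ring

end Weight

end BeamCarleman

end

/-! ### Factorisation of the beam operator and absorption. -/

noncomputable section

namespace BeamCarleman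

/-- The root of smaller modulus of `c² - α c + 1`, through its real and imaginary parts. -/
theorem exists_characteristic_root {α : ℝ} (hα : 0 ≤ α) : ∃ c₁ c₂ : ℝ,
    c₁ ^ 2 - c₂ ^ 2 - α * c₁ + 1 = 0 ∧ 2 * c₁ * c₂ = α * c₂ ∧ c₁ ^ 2 + c₂ ^ 2 ≤ 1 ∧
      1 ≤ (c₁ ^ 2 + c₂ ^ 2) * (1 + α) ^ 2 ∧ (α ≤ 1 → c₁ = α / 2 ∧ c₁ ^ 2 + c₂ ^ 2 = 1) := by
  rcases le_total α 2 with h | h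
  · have hs : Real.sqrt (4 - α ^ 2) ^ 2 = 4 - α ^ 2 := Real.sq_sqrt (by nlinarith)
    have h1 : (α / 2) ^ 2 + (Real.sqrt (4 - α ^ 2) / 2) ^ 2 = 1 := by
      rw [div_pow, div_pow, hs]; ring
    refine ⟨α / 2, Real.sqrt (4 - α ^ 2) / 2, ?_, by ring, h1.le, ?_, fun _ => ⟨rfl, h1⟩⟩
    · rw [div_pow, div_pow, hs]; ring
    · rw [h1]; nlinarith
  · have hs : Real.sqrt (α ^ 2 - 4) ^ 2 = α ^ 2 - 4 := Real.sq_sqrt (by nlinarith)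
    have hle : Real.sqrt (α ^ 2 - 4) ≤ α := Real.sqrt_le_iff.2 ⟨hα, by linarith⟩
    set r := Real.sqrt (α ^ 2 - 4)
    have hr : 0 ≤ r := Real.sqrt_nonneg _
    have hge : α - 2 ≤ r := by
      refine Real.le_sqrt_of_sq_le ?_
      nlinarith
    -- For α ≥ 2 the roots are real with product 1. The larger one is at most α, so the smaller one
    -- is at least 1/(1 + α).
    have hprod : (α - r) / 2 * ((α + r) / 2) = 1 := by linarith
    refine ⟨(α - r) / 2, 0, ?_, by ring, ?_, ?_, fun h1 => by linarith⟩
    · linarith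
    · have : (α - r) / 2 ≤ 1 := by linarith
      have h0 : 0 ≤ (α - r) / 2 := by linarith
      nlinarith
    · have h0 : 0 ≤ (α - r) / 2 := by linarith
      have h1 : 1 ≤ (α - r) / 2 * (1 + α) := by
        calc 1 = (α - r) / 2 * ((α + r) / 2) := hprod.symm
          _ ≤ _ := by gcongr; linarith
      have := one_le_pow₀ h1 (n := 2)
      linarith

/-- The absorption argument combining the individual weighted estimates. -/
theorem absorption {M δ : ℝ} (hM : 1 ≤ M) (hδ : 0 < δ) : ∃ C τ : ℝ, 0 < C ∧ 0 < τ ∧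
    ∀ α i0 i1 i2 i3 v0 v1 F l0 l1 l2 l3 m0 m1 D Dl γ : ℝ, 0 ≤ α →
      0 ≤ i0 → 0 ≤ i1 → 0 ≤ i2 → 0 ≤ i3 → 0 ≤ v0 → 0 ≤ v1 → 0 ≤ F → 0 ≤ l0 → 0 ≤ l1 → 0 ≤ l2 →
      0 ≤ l3 → 0 ≤ m0 → 0 ≤ m1 → 0 ≤ D → γ ≤ 1 → 1 ≤ γ * (1 + α) ^ 2 →
      δ / 2 * i1 ≤ i2 + δ * l1 → δ / 2 * i0 ≤ i1 + δ * l0 →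
      1 / 2 * l2 ≤ l3 + 42 * M ^ 2 * l1 → 1 / 2 * l1 ≤ τ * i2 + (τ⁻¹ + 65 * M ^ 2) * l0 →
      δ ^ 2 * D ≤ 3 * M ^ 2 * (γ * F) + 3 * M ^ 2 * ((4 * M ^ 3 + 2) * (3 * M ^ 2)) * Dl →
      Dl ≤ 2 * (m0 + m1) + 2 * γ * (l2 + l3) →
      (α ≤ 1 → v0 + i2 + v1 + i3 ≤ 2 * D) →
      γ * i2 ≤ 2 * D + 2 * v0 → γ * i3 ≤ 2 * D + 2 * v1 →
      (1 ≤ α → α ^ 2 * v1 ≤ 2 * F + 90 * M ^ 2 * (α ^ 2 * v0 + i2)) →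
      i0 + i1 + i2 + (1 + α ^ 2) * v0 + i3 + (1 + α ^ 2) * v1 ≤
        C * (l0 + (1 + α ^ 2) * m0 + l3 + (1 + α ^ 2) * m1 + α ^ 2 * v0 + F) := by
  have hM0 : 0 < M := by linarith
  obtain ⟨K, hK⟩ : ∃ K, K = 3 * M ^ 2 * ((4 * M ^ 3 + 2) * (3 * M ^ 2)) := ⟨_, rfl⟩
  have hK0 : 0 < K := by rw [hK]; positivity
  rw [← hK]
  -- P and Q multiply the right side R and the local first derivative l1 in the bound for δ² D'. In
  -- P, 14 K is 8 K from the localised velocities, after division by γ, plus 6 K from l3; in Q, 168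
  -- is 2 · 84.
  obtain ⟨P, hP⟩ : ∃ P, P = 3 * M ^ 2 + 14 * K := ⟨_, rfl⟩
  obtain ⟨Q, hQ⟩ : ∃ Q, Q = 168 * K * M ^ 2 := ⟨_, rfl⟩
  have hP0 : 0 < P := by rw [hP]; positivity
  have hQ0 : 0 < Q := by rw [hQ]; positivity
  -- After l1 is interpolated, i2 returns on the right of its own estimate with coefficient 4Qτ;
  -- this τ makes it half of δ².
  obtain ⟨τ, hτ⟩ : ∃ τ, τ = δ ^ 2 / (8 * Q) := ⟨_, rfl⟩
  have hτ0 : 0 < τ := by rw [hτ]; positivity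
  have hτQ : 4 * Q * τ = δ ^ 2 / 2 := by rw [hτ]; field_simp; ring
  obtain ⟨N, hN⟩ : ∃ N, N = 2 * (τ⁻¹ + 65 * M ^ 2) := ⟨_, rfl⟩
  have hN0 : 0 < N := by rw [hN]; positivity
  obtain ⟨C2, hC2⟩ : ∃ C, C = 2 * (2 * P + 2 * Q * N + 8 * δ ^ 2) / δ ^ 2 := ⟨_, rfl⟩
  have hC20 : 0 < C2 := by rw [hC2]; positivity
  have hC2' : δ ^ 2 * C2 = 2 * (2 * P + 2 * Q * N + 8 * δ ^ 2) := by rw [hC2]; field_simp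
  obtain ⟨C1, hC1⟩ : ∃ C, C = 2 * τ * C2 + N := ⟨_, rfl⟩
  have hC10 : 0 < C1 := by rw [hC1]; positivity
  obtain ⟨C3, hC3⟩ : ∃ C, C = (P + Q * C1) / δ ^ 2 := ⟨_, rfl⟩
  have hC30 : 0 < C3 := by rw [hC3]; positivity
  have hC3' : δ ^ 2 * C3 = P + Q * C1 := by rw [hC3]; field_simp
  obtain ⟨C4, hC4⟩ : ∃ C, C = 2 / δ * (C2 + δ * C1) := ⟨_, rfl⟩
  have hC40 : 0 < C4 := by rw [hC4]; positivity
  have hC4' : δ / 2 * C4 = C2 + δ * C1 := by rw [hC4]; field_simp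
  obtain ⟨C5, hC5⟩ : ∃ C, C = 2 / δ * (C4 + δ) := ⟨_, rfl⟩
  have hC50 : 0 < C5 := by rw [hC5]; positivity
  have hC5' : δ / 2 * C5 = C4 + δ := by rw [hC5]; field_simp
  obtain ⟨C6, hC6⟩ : ∃ C, C = 2 + 90 * M ^ 2 * (1 + C2) := ⟨_, rfl⟩
  have hC60 : 0 < C6 := by rw [hC6]; positivity
  refine ⟨C5 + C4 + C2 + 4 * C3 + 10 * C6 + 2, τ, by positivity, hτ0, ?_⟩
  -- Here iⱼ and vⱼ stand for the global weighted squares of ∂ₓʲη and ∂ₓʲ∂ₜη. The localised ones are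
  -- lⱼ and mⱼ, with cutoff 1_J except for ζ² in l1 and ζ⁴ in l2. F is the source, D and Dl are the
  -- energy of u = ∂ₜη − c∂ₓ²η and its localisation, and γ = |c|².
  intro α i0 i1 i2 i3 v0 v1 F l0 l1 l2 l3 m0 m1 D Dl γ hα pi0 pi1 pi2 pi3 pv0 pv1 pF pl0 pl1 pl2
    pl3 pm0 pm1 pD hγ1 hγ hA hB hC hD hE hDl hlow hg2 hg3 hmix
  obtain ⟨R, hR⟩ : ∃ R, R = l0 + (1 + α ^ 2) * m0 + l3 + (1 + α ^ 2) * m1 + α ^ 2 * v0 + F :=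
    ⟨_, rfl⟩
  rw [← hR]
  have a1 : 0 ≤ α ^ 2 * m0 := by positivity
  have a2 : 0 ≤ α ^ 2 * m1 := by positivity
  have a3 : 0 ≤ α ^ 2 * v0 := by positivity
  have hR0 : 0 ≤ R := by rw [hR]; positivity
  have Rm : m0 + m1 + (α ^ 2 * m0 + α ^ 2 * m1) ≤ R := by linarith
  have Rl0 : l0 ≤ R := by linarith
  have Rl3 : l3 ≤ R := by linarith
  have Rv : α ^ 2 * v0 ≤ R := by linarith
  have RF : F ≤ R := by linarith
  have RFv : α ^ 2 * v0 + F ≤ R := by linarith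
  have hγ0 : 0 < γ := pos_of_mul_pos_left (lt_of_lt_of_le one_pos hγ) (sq_nonneg _)
  have hl2 : l2 ≤ 2 * l3 + 84 * M ^ 2 * l1 := by linarith
  have hl1 : l1 ≤ 2 * τ * i2 + N * R := by
    have : N * l0 ≤ N * R := by gcongr
    rw [hN] at this ⊢
    linarith
  -- the second derivative and the parabolic energy
  obtain ⟨D', hD'0, hD', hi2, hi3⟩ : ∃ D', 0 ≤ D' ∧ δ ^ 2 * D' ≤ P * R + Q * l1 ∧
      i2 ≤ 2 * D' + 8 * R ∧ (α ≤ 1 ∧ v0 + i2 + v1 + i3 ≤ 2 * D' ∨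
        1 ≤ α ∧ i3 ≤ 2 * D' + 8 * (α ^ 2 * v1)) := by
    have kF : M ^ 2 * F ≤ M ^ 2 * R := by gcongr
    have kl : K * l2 ≤ K * (2 * l3 + 84 * M ^ 2 * l1) := by gcongr
    have kl3 : K * l3 ≤ K * R := by gcongr
    have km : K * (m0 + m1 + (α ^ 2 * m0 + α ^ 2 * m1)) ≤ K * R := by gcongr
    have kDl := mul_le_mul_of_nonneg_left hDl hK0.le
    have km0 : 0 ≤ K * (m0 + m1) := by positivity
    have km1 : 0 ≤ K * (α ^ 2 * m0 + α ^ 2 * m1) := by positivity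
    have kR : 0 ≤ K * R := by positivity
    -- For α ≤ 1 the energy D already dominates, and D' = D. For α ≥ 1 the estimate is divided by γ,
    -- cancelling the γ in front of the source; γ⁻¹ ≤ 4α² then turns v0, m0 and m1 into terms
    -- carrying α².
    rcases le_total α 1 with h | h
    · refine ⟨D, pD, ?_, by linarith [hlow h], Or.inl ⟨h, hlow h⟩⟩
      have e1 : M ^ 2 * (γ * F) ≤ M ^ 2 * (1 * F) := by gcongr
      have e2 : K * (γ * (l2 + l3)) ≤ K * (1 * (l2 + l3)) := by gcongr
      rw [hP, hQ]
      linarith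
    · have h4 : γ⁻¹ ≤ 4 * α ^ 2 := by
        rw [inv_le_iff_one_le_mul₀ hγ0]
        have : (1 + α) ^ 2 ≤ (2 * α) ^ 2 := pow_le_pow_left₀ (by linarith) (by linarith) 2
        calc 1 ≤ γ * (1 + α) ^ 2 := hγ
          _ ≤ γ * (2 * α) ^ 2 := mul_le_mul_of_nonneg_left this hγ0.le
          _ = 4 * α ^ 2 * γ := by ring
      refine ⟨γ⁻¹ * D, by positivity, ?_, ?_, Or.inr ⟨h, ?_⟩⟩
      · have e1 := mul_le_mul_of_nonneg_left (hE.trans (add_le_add le_rfl kDl))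
          (inv_pos.2 hγ0).le
        have e2 : γ⁻¹ * (3 * M ^ 2 * (γ * F) + K * (2 * (m0 + m1) + 2 * γ * (l2 + l3))) =
            3 * (M ^ 2 * F) + 2 * (γ⁻¹ * (K * (m0 + m1))) + 2 * (K * l2) + 2 * (K * l3) := by
          field_simp
          ring
        have e3 : γ⁻¹ * (K * (m0 + m1)) ≤ 4 * α ^ 2 * (K * (m0 + m1)) := by gcongr
        rw [e2] at e1
        rw [hP, hQ]
        linarith
      · have e1 := mul_le_mul_of_nonneg_left hg2 (inv_pos.2 hγ0).le
        rw [inv_mul_cancel_left₀ hγ0.ne'] at e1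
        have e3 : γ⁻¹ * v0 ≤ 4 * α ^ 2 * v0 := by gcongr
        linarith
      · have e1 := mul_le_mul_of_nonneg_left hg3 (inv_pos.2 hγ0).le
        rw [inv_mul_cancel_left₀ hγ0.ne'] at e1
        have e3 : γ⁻¹ * v1 ≤ 4 * α ^ 2 * v1 := by gcongr
        linarith
  have bi2 : i2 ≤ C2 * R := by
    have e1 : Q * l1 ≤ Q * (2 * τ * i2 + N * R) := by gcongr
    have e2 : δ ^ 2 * i2 ≤ δ ^ 2 * (2 * D' + 8 * R) := by gcongr
    have e3 : 4 * Q * τ * i2 = δ ^ 2 / 2 * i2 := by rw [hτQ]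
    have e4 : δ ^ 2 * i2 ≤ δ ^ 2 * (C2 * R) := by
      rw [← mul_assoc, hC2']
      linarith
    exact le_of_mul_le_mul_left e4 (by positivity)
  have bl1 : l1 ≤ C1 * R := by
    have : 2 * τ * i2 ≤ 2 * τ * (C2 * R) := by gcongr
    rw [hC1]
    linarith
  have bD : D' ≤ C3 * R := by
    have e1 : Q * l1 ≤ Q * (C1 * R) := by gcongr
    have e4 : δ ^ 2 * D' ≤ δ ^ 2 * (C3 * R) := by
      rw [← mul_assoc, hC3']
      linarith
    exact le_of_mul_le_mul_left e4 (by positivity)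
  have bi1 : i1 ≤ C4 * R := by
    have e1 : δ * l1 ≤ δ * (C1 * R) := by gcongr
    have e4 : δ / 2 * i1 ≤ δ / 2 * (C4 * R) := by
      rw [← mul_assoc, hC4']
      linarith
    exact le_of_mul_le_mul_left e4 (by positivity)
  have bi0 : i0 ≤ C5 * R := by
    have e1 : δ * l0 ≤ δ * R := by gcongr
    have e4 : δ / 2 * i0 ≤ δ / 2 * (C5 * R) := by
      rw [← mul_assoc, hC5']
      linarith
    exact le_of_mul_le_mul_left e4 (by positivity)
  have n3 : 0 ≤ C3 * R := by positivity
  have n6 : 0 ≤ C6 * R := by positivity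
  rcases hi3 with ⟨h, h'⟩ | ⟨h, h'⟩
  · have hα2 : α ^ 2 ≤ 1 := pow_le_one₀ hα h
    have e1 : α ^ 2 * v0 ≤ 1 * v0 := by gcongr
    have e2 : α ^ 2 * v1 ≤ 1 * v1 := by gcongr
    linarith
  · have hα2 : 1 ≤ α ^ 2 := one_le_pow₀ h
    have e1 : 1 * v0 ≤ α ^ 2 * v0 := by gcongr
    have e2 : 1 * v1 ≤ α ^ 2 * v1 := by gcongr
    have e3 : α ^ 2 * v1 ≤ C6 * R := by
      have : 90 * M ^ 2 * (α ^ 2 * v0 + i2) ≤ 90 * M ^ 2 * (R + C2 * R) := by gcongr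
      rw [hC6]
      linarith [hmix h]
    linarith

/-- The indicator function of `J` on the cylinder. -/
def indic (J : Set Torus) (p : ℝ × Torus) : ℝ := J.indicator 1 p.2

theorem indic_nonneg (J : Set Torus) (p : ℝ × Torus) : 0 ≤ indic J p :=
  indicator_nonneg (fun _ _ => zero_le_one) _

theorem indic_mul_eq (J : Set Torus) (f : ℝ × Torus → ℝ) :
    (fun p => indic J p * f p) = (univ ×ˢ J : Set (ℝ × Torus)).indicator f := by
  funext p
  by_cases h : p.2 ∈ J <;> simp [indic, indicator, h]

theorem integrableOn_indic_mul {J : Set Torus} (hJ : IsOpen J) {T : ℝ} {f : ℝ × Torus → ℝ}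
    (hf : IntegrableOn f (cyl T)) : IntegrableOn (fun p => indic J p * f p) (cyl T) := by
  rw [indic_mul_eq]
  exact hf.indicator (isOpen_univ.prod hJ).measurableSet

theorem setIntegral_indic_mul {J : Set Torus} (hJ : IsOpen J) {T : ℝ} (f : ℝ × Torus → ℝ) :
    ∫ p in cyl T, indic J p * f p = ∫ p in Ioo 0 T ×ˢ J, f p := by
  rw [indic_mul_eq, setIntegral_indicator (isOpen_univ.prod hJ).measurableSet, cyl, prod_inter_prod,
    inter_univ, univ_inter]

/-! ### Assembly of the beam estimate for an abstract weight. -/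

namespace Weight

variable {J : Set Torus} {T k μ α M δ ε : ℝ} (W : Weight J T k μ α M δ ε)

theorem ζ_pow_le (n : ℕ) (hn : n ≠ 0) (p : ℝ × Torus) : W.ζ p ^ n ≤ indic J p := by
  by_cases h : p.2 ∈ J
  · simpa [indic, h] using pow_le_one₀ (W.ζ_nonneg p) (W.ζ_le p)
  · simp [indic, h, (W.ζ_off p h).1, hn]

theorem dζ_sq_le (p : ℝ × Torus) : W.dζ p ^ 2 ≤ M ^ 2 * indic J p := by
  by_cases h : p.2 ∈ J
  · simpa [indic, h] using sq_le_sq' (abs_le.1 (W.dζ_le p)).1 (abs_le.1 (W.dζ_le p)).2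
  · simp [indic, h, (W.ζ_off p h).2]

end Weight

/-- Carleman estimate for the beam operator with an abstract weight. -/
theorem exists_carleman_constant {M δ : ℝ} (hM : 1 ≤ M) (hδ : 0 < δ) (hδ1 : δ ≤ 1) :
    ∃ C : ℝ, 0 < C ∧ ∀ (J : Set Torus) (T k μ α ε : ℝ) (W : Weight J T k μ α M δ ε)
      (H : BeamJet T k), IsOpen J → 2 * M ≤ δ * μ → 24 * M ^ 4 * ε ≤ δ ^ 2 →
      (∫ p in cyl T, W.term 8 7 H.h0 p) + (∫ p in cyl T, W.term 6 5 H.h1 p)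
        + (∫ p in cyl T, W.term 4 3 H.h2 p) + (1 + α ^ 2) * (∫ p in cyl T, W.term 4 3 H.v0 p)
        + (∫ p in cyl T, W.term 2 1 H.h3 p) + (1 + α ^ 2) * (∫ p in cyl T, W.term 2 1 H.v1 p)
      ≤ C * ((∫ p in Ioo 0 T ×ˢ J, W.term 8 7 H.h0 p)
        + (1 + α ^ 2) * (∫ p in Ioo 0 T ×ˢ J, W.term 4 3 H.v0 p)
        + (∫ p in Ioo 0 T ×ˢ J, W.term 2 1 H.h3 p)
        + (1 + α ^ 2) * (∫ p in Ioo 0 T ×ˢ J, W.term 2 1 H.v1 p)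
        + α ^ 2 * (∫ p in cyl T, W.term 4 3 H.v0 p)
        + ∫ p in cyl T, W.E p ^ 2 * (H.w0 p - α * H.v2 p + H.h4 p) ^ 2) := by
  obtain ⟨C, τ, hC, hτ, key⟩ := absorption hM hδ
  refine ⟨C, hC, fun J T k μ α ε W H hJ hμ hε => ?_⟩
  have hM0 := W.M_pos
  have hM2 : 1 ≤ M ^ 2 := one_le_pow₀ hM
  have hε0 := W.ε_pos
  have hε1 : 2 * M * ε ≤ δ := by
    have e1 : 2 * M * ε ≤ 24 * M ^ 4 * ε := by
      have : M ≤ M ^ 4 := le_self_pow₀ hM (by norm_num)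
      gcongr
      norm_num
    exact e1.trans (hε.trans (pow_le_of_le_one hδ.le hδ1 (by norm_num)))
  have hε2 : ε ≤ 1 := by nlinarith
  obtain ⟨c₁, c₂, hc1, hc2, hc3, hc4, hc5⟩ := exists_characteristic_root W.α_nonneg
  -- the factorisation of the beam operator
  let y : SecondOrderJet T k :=
    { u := fun p => H.v0 p - c₁ * H.h2 p
      ux := fun p => H.v1 p - c₁ * H.h3 p
      uxx := fun p => H.v2 p - c₁ * H.h4 p
      ut := fun p => H.w0 p - c₁ * H.v2 p
      utx := fun p => H.w1 p - c₁ * H.v3 p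
      mu := by fun_prop
      mux := by fun_prop
      muxx := by fun_prop
      mdt := by fun_prop
      mdtx := by fun_prop
      xu := H.xv0.sub (H.xh2.const_mul c₁)
      xux := H.xv1.sub (H.xh3.const_mul c₁)
      xut := H.xw0.sub (H.xv2.const_mul c₁)
      tu := H.tv0.sub (H.th2.const_mul c₁)
      tux := H.tv1.sub (H.th3.const_mul c₁) }
  let z : SecondOrderJet T k :=
    { u := fun p => -c₂ * H.h2 p
      ux := fun p => -c₂ * H.h3 p
      uxx := fun p => -c₂ * H.h4 p
      ut := fun p => -c₂ * H.v2 p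
      utx := fun p => -c₂ * H.v3 p
      mu := by fun_prop
      mux := by fun_prop
      muxx := by fun_prop
      mdt := by fun_prop
      mdtx := by fun_prop
      xu := H.xh2.const_mul _
      xux := H.xh3.const_mul _
      xut := H.xv2.const_mul _
      tu := H.th2.const_mul _
      tux := H.th3.const_mul _ }
  have hcar := W.carleman_second_order hδ hδ1 hμ hε hc3 y z
  -- The characteristic equation in the form 1 + c² = αc collapses (∂ₓ² − c∂ₜ)u to −c times the beam
  -- operator, whence the factor |c|².
  have hsource : (fun p => W.E p ^ 2 * ((y.uxx p - c₁ * y.ut p + c₂ * z.ut p) ^ 2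
      + (z.uxx p - c₁ * z.ut p - c₂ * y.ut p) ^ 2)) =
      fun p => (c₁ ^ 2 + c₂ ^ 2) * (W.E p ^ 2 * (H.w0 p - α * H.v2 p + H.h4 p) ^ 2) := by
    funext p
    have e1 : y.uxx p - c₁ * y.ut p + c₂ * z.ut p =
        -c₁ * (H.w0 p - α * H.v2 p + H.h4 p) := by
      simp only [y, z]
      linear_combination H.v2 p * hc1
    have e2 : z.uxx p - c₁ * z.ut p - c₂ * y.ut p =
        -c₂ * (H.w0 p - α * H.v2 p + H.h4 p) := by
      simp only [y, z]
      linear_combination H.v2 p * hc2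
    rw [e1, e2]
    ring
  rw [hsource, integral_const_mul] at hcar
  set γ := c₁ ^ 2 + c₂ ^ 2 with hγ
  have hγ0 : 0 ≤ γ := by positivity
  -- integrability
  have I {i j : ℕ} {f : ℝ × Torus → ℝ} (hf : Moderate T k f) := (W.rapid_term i j hf).integrableOn
  have Z (n : ℕ) {i j : ℕ} {f : ℝ × Torus → ℝ} (hf : Moderate T k f) :
      IntegrableOn (fun p => W.ζ p ^ n * W.term i j f p) (cyl T) :=
    (Rapid.moderate_mul (by fun_prop) (W.rapid_term i j hf)).integrableOn
  have L {i j : ℕ} {f : ℝ × Torus → ℝ} (hf : Moderate T k f) :=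
    integrableOn_indic_mul hJ (I (i := i) (j := j) hf)
  have P0 {i j : ℕ} (f : ℝ × Torus → ℝ) : 0 ≤ ∫ p in cyl T, W.term i j f p :=
    setIntegral_nonneg measurableSet_cyl fun p hp => W.term_nonneg i j f hp
  have PZ {i j : ℕ} (n : ℕ) (f : ℝ × Torus → ℝ) : 0 ≤ ∫ p in cyl T, W.ζ p ^ n * W.term i j f p :=
    setIntegral_nonneg measurableSet_cyl fun p hp =>
      mul_nonneg (pow_nonneg (W.ζ_nonneg p) n) (W.term_nonneg i j f hp)
  have PL {i j : ℕ} (f : ℝ × Torus → ℝ) : 0 ≤ ∫ p in cyl T, indic J p * W.term i j f p :=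
    setIntegral_nonneg measurableSet_cyl fun p hp =>
      mul_nonneg (indic_nonneg J p) (W.term_nonneg i j f hp)
  have ZL {i j : ℕ} (n : ℕ) (hn : n ≠ 0) {f : ℝ × Torus → ℝ} (hf : Moderate T k f) :
      ∫ p in cyl T, W.ζ p ^ n * W.term i j f p ≤ ∫ p in cyl T, indic J p * W.term i j f p :=
    setIntegral_mono_on (Z n hf) (L hf) measurableSet_cyl fun p hp =>
      mul_le_mul_of_nonneg_right (W.ζ_pow_le n hn p) (W.term_nonneg i j f hp)
  have ZI {i j : ℕ} (n : ℕ) {f : ℝ × Torus → ℝ} (hf : Moderate T k f) :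
      ∫ p in cyl T, W.ζ p ^ n * W.term i j f p ≤ ∫ p in cyl T, W.term i j f p :=
    setIntegral_mono_on (Z n hf) (I hf) measurableSet_cyl fun p hp =>
      mul_le_of_le_one_left (W.term_nonneg i j f hp) (pow_le_one₀ (W.ζ_nonneg p) (W.ζ_le p))
  have hden : Rapid T k (fun p => W.density y.u y.ux p + W.density z.u z.ux p) :=
    (W.rapid_density y.mu y.mux).add (W.rapid_density z.mu z.mux)
  have hdenζ : Rapid T k (fun p => W.ζ p ^ 4 * (W.density y.u y.ux p + W.density z.u z.ux p)) :=
    Rapid.moderate_mul (by fun_prop) hden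
  have hdeneq (p : ℝ × Torus) : W.density y.u y.ux p + W.density z.u z.ux p =
      W.E p ^ 2 * (μ ^ 4 * W.θ p ^ 3 * (((H.v0 p - c₁ * H.h2 p) ^ 2 + (c₂ * H.h2 p) ^ 2))
        + μ ^ 2 * W.θ p ^ 1 * ((H.v1 p - c₁ * H.h3 p) ^ 2 + (c₂ * H.h3 p) ^ 2)) := by
    simp only [Weight.density, y, z]
    ring
  -- pointwise comparisons
  have up (a b : ℝ) : (a - c₁ * b) ^ 2 + (c₂ * b) ^ 2 ≤ 2 * a ^ 2 + 2 * γ * b ^ 2 := by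
    rw [hγ]
    nlinarith [sq_nonneg (a + c₁ * b), sq_nonneg (c₂ * b)]
  have low (a b : ℝ) : γ * b ^ 2 ≤ 2 * ((a - c₁ * b) ^ 2 + (c₂ * b) ^ 2) + 2 * a ^ 2 := by
    rw [hγ]
    nlinarith [sq_nonneg (2 * a - c₁ * b), sq_nonneg (c₂ * b)]
  -- With |c| = 1 and 0 ≤ c₁ ≤ 1/2, the form |a − cb|² = a² − 2c₁ab + b² is at least half of a² +
  -- b².
  have low' (h : α ≤ 1) (a b : ℝ) : a ^ 2 + b ^ 2 ≤ 2 * ((a - c₁ * b) ^ 2 + (c₂ * b) ^ 2) := by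
    obtain ⟨h1, h2⟩ := hc5 h
    have h3 : 0 ≤ c₁ := by rw [h1]; linarith [W.α_nonneg]
    have h4 : 0 ≤ 1 - 2 * c₁ := by rw [h1]; linarith
    have h5 : (a - c₁ * b) ^ 2 + (c₂ * b) ^ 2 = a ^ 2 - 2 * c₁ * (a * b) + b ^ 2 := by
      linear_combination b ^ 2 * h2
    rw [h5]
    nlinarith [mul_nonneg h3 (sq_nonneg (a - b)), mul_nonneg h4 (sq_nonneg a),
      mul_nonneg h4 (sq_nonneg b)]
  have dpos (a b : ℝ) : 0 ≤ (a - c₁ * b) ^ 2 + (c₂ * b) ^ 2 := by positivity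
  have wpos (p : ℝ × Torus) (hp : p ∈ cyl T) :
      0 ≤ W.E p ^ 2 * (μ ^ 4 * W.θ p ^ 3) ∧ 0 ≤ W.E p ^ 2 * (μ ^ 2 * W.θ p ^ 1) := by
    have h0 := W.θ_pos hp
    have h1 := W.μ_pos
    constructor <;> positivity
  have hDl : ∫ p in cyl T, W.ζ p ^ 4 * (W.density y.u y.ux p + W.density z.u z.ux p) ≤
      2 * ((∫ p in cyl T, W.ζ p ^ 4 * W.term 4 3 H.v0 p)
        + ∫ p in cyl T, W.ζ p ^ 4 * W.term 2 1 H.v1 p)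
      + 2 * γ * ((∫ p in cyl T, W.ζ p ^ 4 * W.term 4 3 H.h2 p)
        + ∫ p in cyl T, W.ζ p ^ 4 * W.term 2 1 H.h3 p) := by
    have i1 : IntegrableOn (fun p => W.ζ p ^ 4 * W.term 4 3 H.v0 p
      + W.ζ p ^ 4 * W.term 2 1 H.v1 p) (cyl T) := (Z 4 H.mv0).add (Z 4 H.mv1)
    have i2 : IntegrableOn (fun p => W.ζ p ^ 4 * W.term 4 3 H.h2 p
      + W.ζ p ^ 4 * W.term 2 1 H.h3 p) (cyl T) := (Z 4 H.mh2).add (Z 4 H.mh3)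
    rw [← integral_add (Z 4 H.mv0) (Z 4 H.mv1), ← integral_add (Z 4 H.mh2) (Z 4 H.mh3),
      ← integral_const_mul, ← integral_const_mul,
      ← integral_add (i1.const_mul _) (i2.const_mul _)]
    refine setIntegral_mono_on hdenζ.integrableOn ((i1.const_mul _).add (i2.const_mul _))
      measurableSet_cyl fun p hp => ?_
    obtain ⟨w1, w2⟩ := wpos p hp
    have e1 := mul_le_mul_of_nonneg_left (up (H.v0 p) (H.h2 p)) w1
    have e2 := mul_le_mul_of_nonneg_left (up (H.v1 p) (H.h3 p)) w2
    have e3 := mul_le_mul_of_nonneg_left (add_le_add e1 e2) (pow_nonneg (W.ζ_nonneg p) 4)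
    rw [hdeneq]
    simp only [Weight.term]
    linarith
  have hlow2 : γ * (∫ p in cyl T, W.term 4 3 H.h2 p) ≤
      2 * (∫ p in cyl T, (W.density y.u y.ux p + W.density z.u z.ux p))
        + 2 * ∫ p in cyl T, W.term 4 3 H.v0 p := by
    rw [← integral_const_mul, ← integral_const_mul, ← integral_const_mul,
      ← integral_add (hden.integrableOn.const_mul _) ((I H.mv0).const_mul _)]
    refine setIntegral_mono_on ((I H.mh2).const_mul _)
      ((hden.integrableOn.const_mul _).add ((I H.mv0).const_mul _)) measurableSet_cyl
      fun p hp => ?_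
    obtain ⟨w1, w2⟩ := wpos p hp
    have e1 := mul_le_mul_of_nonneg_left (low (H.v0 p) (H.h2 p)) w1
    have e2 := mul_nonneg w2 (dpos (H.v1 p) (H.h3 p))
    rw [hdeneq]
    simp only [Weight.term]
    linarith
  have hlow3 : γ * (∫ p in cyl T, W.term 2 1 H.h3 p) ≤
      2 * (∫ p in cyl T, (W.density y.u y.ux p + W.density z.u z.ux p))
        + 2 * ∫ p in cyl T, W.term 2 1 H.v1 p := by
    rw [← integral_const_mul, ← integral_const_mul, ← integral_const_mul,
      ← integral_add (hden.integrableOn.const_mul _) ((I H.mv1).const_mul _)]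
    refine setIntegral_mono_on ((I H.mh3).const_mul _)
      ((hden.integrableOn.const_mul _).add ((I H.mv1).const_mul _)) measurableSet_cyl
      fun p hp => ?_
    obtain ⟨w1, w2⟩ := wpos p hp
    have e1 := mul_le_mul_of_nonneg_left (low (H.v1 p) (H.h3 p)) w2
    have e2 := mul_nonneg w1 (dpos (H.v0 p) (H.h2 p))
    rw [hdeneq]
    simp only [Weight.term]
    linarith
  have hlow (h : α ≤ 1) : (∫ p in cyl T, W.term 4 3 H.v0 p) + (∫ p in cyl T, W.term 4 3 H.h2 p)
      + (∫ p in cyl T, W.term 2 1 H.v1 p) + (∫ p in cyl T, W.term 2 1 H.h3 p) ≤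
      2 * (∫ p in cyl T, (W.density y.u y.ux p + W.density z.u z.ux p)) := by
    have i1 : IntegrableOn (fun p => W.term 4 3 H.v0 p + W.term 4 3 H.h2 p) (cyl T) :=
      (I H.mv0).add (I H.mh2)
    have i2 : IntegrableOn (fun p => W.term 4 3 H.v0 p + W.term 4 3 H.h2 p
      + W.term 2 1 H.v1 p) (cyl T) := i1.add (I H.mv1)
    rw [← integral_add (I H.mv0) (I H.mh2), ← integral_add i1 (I H.mv1),
      ← integral_add i2 (I H.mh3), ← integral_const_mul]
    refine setIntegral_mono_on (i2.add (I H.mh3)) (hden.integrableOn.const_mul _)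
      measurableSet_cyl fun p hp => ?_
    obtain ⟨w1, w2⟩ := wpos p hp
    have e1 := mul_le_mul_of_nonneg_left (low' h (H.v0 p) (H.h2 p)) w1
    have e2 := mul_le_mul_of_nonneg_left (low' h (H.v1 p) (H.h3 p)) w2
    rw [hdeneq]
    simp only [Weight.term]
    linarith
  -- lower order derivatives and localisation
  have hA := W.integral_term_le_deriv hδ hε1 4 3 H.xh1 H.mh1 H.mh2
  have hB := W.integral_term_le_deriv hδ hε1 6 5 H.xh0 H.mh0 H.mh1
  -- The cutoffs descend through ζ⁴, ζ² and 1_J, because each interpolation needs the squared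
  -- derivative of one cutoff to be bounded by its product with the next. The first uses τ = 1,
  -- since l3 is observed; the second uses the small τ, since ∂ₓ²η must be absorbed globally.
  have hC' := W.integral_local_deriv_le hε2 2 1 one_pos (W.xζ.pow 4) (by fun_prop) (by fun_prop)
    H.xh1 H.xh2 H.mh1 H.mh2 H.mh3 (σ := fun p => W.ζ p ^ 2) (Z 2 H.mh1)
    (fun p => pow_nonneg (W.ζ_nonneg p) 4)
    (fun p => pow_le_pow_of_le_one (W.ζ_nonneg p) (W.ζ_le p) (by norm_num))
    (fun p => by
      have h1 : W.dζ p ^ 2 ≤ M ^ 2 := sq_le_sq' (abs_le.1 (W.dζ_le p)).1 (abs_le.1 (W.dζ_le p)).2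
      have := mul_le_mul_of_nonneg_left h1 (show 0 ≤ 16 * W.ζ p ^ 6 by
        have := W.ζ_nonneg p
        positivity)
      push_cast
      linarith)
  have hD := W.integral_local_deriv_le hε2 4 3 hτ (W.xζ.pow 2) (by fun_prop) (by fun_prop)
    H.xh0 H.xh1 H.mh0 H.mh1 H.mh2 (σ := indic J) (L H.mh0)
    (fun p => pow_nonneg (W.ζ_nonneg p) 2)
    (fun p => W.ζ_pow_le 2 (by norm_num) p)
    (fun p => by
      have := mul_le_mul_of_nonneg_left (W.dζ_sq_le p) (show 0 ≤ 4 * W.ζ p ^ 2 by positivity)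
      have h2 : 0 ≤ M ^ 2 * W.ζ p ^ 2 * indic J p := by
        have := indic_nonneg J p
        positivity
      push_cast
      linarith)
  simp only [← setIntegral_indic_mul hJ]
  refine key α _ _ _ _ _ _ _ _ _ _ _ _ _ _ _ γ W.α_nonneg (P0 _) (P0 _) (P0 _) (P0 _) (P0 _)
    (P0 _) (setIntegral_nonneg measurableSet_cyl fun p _ => by positivity) (PL _)
    (PZ (i := 6) (j := 5) 2 H.h1) (PZ (i := 4) (j := 3) 4 H.h2) (PL _) (PL _) (PL _)
    (setIntegral_nonneg measurableSet_cyl fun p hp =>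
      add_nonneg (W.density_nonneg _ _ hp) (W.density_nonneg _ _ hp))
    hc3 hc4 hA ?_ ?_ ?_ hcar ?_ hlow hlow2 hlow3 (fun h => W.integral_mixed_le h hε2 H)
  · have := ZL (i := 8) (j := 7) 2 (by norm_num) H.mh0
    refine hB.trans ?_
    gcongr
  · have h1 := ZL (i := 2) (j := 1) 4 (by norm_num) H.mh3
    have h2 := PZ (i := 6) (j := 5) 2 H.h1
    have h3 := mul_le_mul_of_nonneg_right hM2 h2
    norm_num at hC'
    linarith
  · have h1 := mul_le_mul_of_nonneg_left (ZI (i := 4) (j := 3) 2 H.mh2) hτ.le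
    norm_num at hD
    linarith
  · have h1 := ZL (i := 4) (j := 3) 4 (by norm_num) H.mv0
    have h2 := ZL (i := 2) (j := 1) 4 (by norm_num) H.mv1
    have h3 := ZL (i := 2) (j := 1) 4 (by norm_num) H.mh3
    have h4 := mul_le_mul_of_nonneg_left h3 hγ0
    linarith

end BeamCarleman

end

/-! ### Cutoffs on the torus and the concrete weights. -/

noncomputable section

namespace BeamCarleman

open Filter Topology

section Torus

variable {f f' : Torus → ℝ} {n : WithTop ℕ∞}

theorem TorusContDiff.continuous (hf : TorusContDiff n f) : Continuous f := by
  have h : Continuous fun x : ℝ => f (x : Torus) := ContDiff.continuous hf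
  exact continuous_coinduced_dom.2 h

theorem TorusContDiff.hasDerivAt (hf : TorusContDiff n f) (hn : n ≠ 0) (x : ℝ) :
    HasDerivAt (fun y : ℝ => f (y : Torus)) (dx f (x : Torus)) x := by
  rw [dx_coe]
  exact ((ContDiff.differentiable hf hn) x).hasDerivAt

theorem TorusContDiff.dx (hf : TorusContDiff ∞ f) : TorusContDiff ∞ (dx f) := by
  have h : ContDiff ℝ ∞ (deriv fun x : ℝ => f (x : Torus)) :=
    (contDiff_infty_iff_deriv.1 hf).2
  unfold TorusContDiff
  simp only [dx_coe]
  exact h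

theorem dx_eq_of_hasDerivAt {x : ℝ} {c : ℝ} (h : HasDerivAt (fun y : ℝ => f (y : Torus)) c x) :
    dx f (x : Torus) = c := by
  rw [dx_coe, h.deriv]

theorem exists_bound_of_continuous (hf : Continuous f) : ∃ C, ∀ x, |f x| ≤ C := by
  obtain ⟨C, hC⟩ := isCompact_univ.exists_bound_of_continuousOn (f := f) hf.continuousOn
  exact ⟨C, fun x => hC x (mem_univ x)⟩

/-- A smooth cutoff function between a set and an open neighbourhood of its closure. -/
theorem exists_torus_cutoff {J J₀ : Set Torus} (hJ : IsOpen J) (h : closure J₀ ⊆ J) :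
    ∃ ζ : Torus → ℝ, TorusContDiff ∞ ζ ∧ (∀ x, 0 ≤ ζ x) ∧ (∀ x, ζ x ≤ 1) ∧
      (∀ x ∈ J₀, ζ x = 1) ∧ ∀ x ∉ J, ζ x = 0 ∧ dx ζ x = 0 := by
  -- Embedding the torus as the unit circle reduces the construction to a smooth separation of two
  -- disjoint closed sets in the plane.
  let e : Torus → ℂ := fun x => (AddCircle.toCircle x : ℂ)
  have he : Continuous e := continuous_subtype_val.comp AddCircle.continuous_toCircle
  have hinj : Function.Injective e :=
    Subtype.val_injective.comp (AddCircle.injective_toCircle Real.two_pi_pos.ne')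
  have hs : IsClosed (e '' Jᶜ) := (hJ.isClosed_compl.isCompact.image he).isClosed
  have ht : IsClosed (e '' closure J₀) := (isClosed_closure.isCompact.image he).isClosed
  have hd : Disjoint (e '' Jᶜ) (e '' closure J₀) :=
    (disjoint_image_iff hinj).2 (disjoint_compl_left_iff_subset.2 h)
  obtain ⟨F, h0, h1, hF⟩ := exists_contMDiffMap_zero_one_of_isClosed (modelWithCornersSelf ℝ ℂ)
    (n := ⊤) hs ht hd
  have hFc : ContDiff ℝ ∞ F := F.contMDiff.contDiff
  have hsmooth : TorusContDiff ∞ (fun x => F (e x)) := by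
    refine hFc.comp (f := fun x : ℝ => e (x : Torus)) ?_
    have : (fun x : ℝ => e (x : Torus)) = fun x : ℝ => Complex.exp (x * Complex.I) := by
      funext x
      simp only [e, AddCircle.toCircle_apply_mk, Circle.coe_exp]
      rw [div_self Real.two_pi_pos.ne', one_mul]
    rw [this]
    exact ((Complex.ofRealCLM.contDiff).mul contDiff_const).cexp
  refine ⟨fun x => F (e x), hsmooth, fun x => (hF _).1, fun x => (hF _).2,
    fun x hx => h1 (mem_image_of_mem e (subset_closure hx)), fun x hx => ?_⟩
  have hz : F (e x) = 0 := h0 (mem_image_of_mem e hx)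
  refine ⟨hz, ?_⟩
  obtain ⟨x, rfl⟩ := QuotientAddGroup.mk_surjective x
  -- The cutoff is nonnegative, so every zero is a minimum; its derivative thus vanishes on the
  -- whole complement of J, boundary included.
  have hmin : IsLocalMin (fun y : ℝ => F (e (y : Torus))) x :=
    Eventually.of_forall fun y =>
      show F (e (x : Torus)) ≤ F (e (y : Torus)) from (le_of_eq hz).trans (hF _).1
  exact (dx_coe _ x).trans hmin.deriv_eq_zero

end Torus

/-- A space profile for Carleman weights, with bounds on its derivatives and a cutoff `ζ` which
equals `1` where the derivative of the profile is small. -/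
structure Profile (J : Set Torus) (ψ : Torus → ℝ) (M δ : ℝ) where
  ζ : Torus → ℝ
  smooth : TorusContDiff ∞ ψ
  pos : ∀ x, 0 < ψ x
  smooth_ζ : TorusContDiff ∞ ζ
  one_le_M : 1 ≤ M
  D1_le : ∀ x, |dx ψ x| ≤ M
  D2_le : ∀ x, |dx (dx ψ) x| ≤ M
  D3_le : ∀ x, |dx (dx (dx ψ)) x| ≤ M
  D4_le : ∀ x, |dx (dx (dx (dx ψ))) x| ≤ M
  ζ_nonneg : ∀ x, 0 ≤ ζ x
  ζ_le : ∀ x, ζ x ≤ 1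
  dζ_le : ∀ x, |dx ζ x| ≤ M
  ζ_off : ∀ x, x ∉ J → ζ x = 0 ∧ dx ζ x = 0
  crit : ∀ x, ζ x = 1 ∨ δ ≤ dx ψ x ^ 2

theorem IsTorusWeight.exists_profile {J : Set Torus} {ψ : Torus → ℝ} (hJ : IsOpen J)
    (hψ : IsTorusWeight J ψ) : ∃ M δ : ℝ, 1 ≤ M ∧ 0 < δ ∧ δ ≤ 1 ∧ Nonempty (Profile J ψ M δ) := by
  obtain ⟨hs, hpos, J₀, hJ₀, -, hsub, hcrit⟩ := hψ
  obtain ⟨ζ, hζs, hζ0, hζ1, hζ, hζoff⟩ := exists_torus_cutoff hJ hsub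
  obtain ⟨C1, h1⟩ := exists_bound_of_continuous hs.dx.continuous
  obtain ⟨C2, h2⟩ := exists_bound_of_continuous hs.dx.dx.continuous
  obtain ⟨C3, h3⟩ := exists_bound_of_continuous hs.dx.dx.dx.continuous
  obtain ⟨C4, h4⟩ := exists_bound_of_continuous hs.dx.dx.dx.dx.continuous
  obtain ⟨C5, h5⟩ := exists_bound_of_continuous hζs.dx.continuous
  -- By compactness of the complement of J₀ the derivative is bounded away from zero there; if that
  -- complement is empty, any positive value serves.
  obtain ⟨δ, hδ, hδ'⟩ : ∃ δ : ℝ, 0 < δ ∧ ∀ x ∉ J₀, δ ≤ dx ψ x ^ 2 := by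
    rcases (J₀ᶜ).eq_empty_or_nonempty with h | h
    · exact ⟨1, one_pos, fun x hx => by simpa [h] using (show x ∈ J₀ᶜ from hx)⟩
    · obtain ⟨x₀, hx₀, hmin⟩ := hJ₀.isClosed_compl.isCompact.exists_isMinOn h
        (hs.dx.continuous.pow 2).continuousOn
      refine ⟨dx ψ x₀ ^ 2, ?_, fun x hx => hmin hx⟩
      have : dx ψ x₀ ≠ 0 := fun h0 => hx₀ (hcrit x₀ h0)
      positivity
  set M := max 1 (max C1 (max C2 (max C3 (max C4 C5))))
  refine ⟨M, min 1 δ, le_max_left _ _, lt_min one_pos hδ, min_le_left _ _, ⟨{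
    ζ := ζ, smooth := hs, pos := hpos, smooth_ζ := hζs, one_le_M := le_max_left _ _
    D1_le := fun x => (h1 x).trans (by simp [M])
    D2_le := fun x => (h2 x).trans (by simp [M])
    D3_le := fun x => (h3 x).trans (by simp [M])
    D4_le := fun x => (h4 x).trans (by simp [M])
    ζ_nonneg := hζ0, ζ_le := hζ1
    dζ_le := fun x => (h5 x).trans (by simp [M])
    ζ_off := hζoff
    crit := fun x => ?_ }⟩⟩
  by_cases hx : x ∈ J₀
  · exact Or.inl (hζ x hx)
  · exact Or.inr ((min_le_right _ _).trans (hδ' x hx))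

section Time

variable {T k t : ℝ}

/-- The logarithmic derivative of `blow`. -/
def logRate (T k t : ℝ) : ℝ := -(k / 2) * (T - 2 * t) / ell T t

/-- The derivative of `logRate`. -/
def logRateDeriv (T k t : ℝ) : ℝ := k / 2 * (2 * ell T t + (T - 2 * t) ^ 2) / ell T t ^ 2

theorem hasDerivAt_ell (T t : ℝ) : HasDerivAt (ell T) (T - 2 * t) t := by
  have := (hasDerivAt_id t).mul ((hasDerivAt_id t).const_sub T)
  refine this.congr_deriv ?_
  simp only [id]
  ring

theorem hasDerivAt_blow (ht : t ∈ Ioo 0 T) :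
    HasDerivAt (blow T k) (logRate T k t * blow T k t) t := by
  have hl := ell_pos ht
  have h := ((hasDerivAt_ell T t).rpow_const (p := k / 2) (Or.inl hl.ne')).inv
    (Real.rpow_pos_of_pos hl _).ne'
  refine h.congr_deriv ?_
  have hp := Real.rpow_pos_of_pos hl (k / 2)
  rw [logRate, blow, Real.rpow_sub_one hl.ne']
  field_simp

theorem hasDerivAt_logRate (ht : t ∈ Ioo 0 T) :
    HasDerivAt (logRate T k) (logRateDeriv T k t) t := by
  have hl := ell_pos ht
  have h := ((((hasDerivAt_id t).const_mul 2).const_sub T).const_mul (-(k / 2))).div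
    (hasDerivAt_ell T t) hl.ne'
  refine h.congr_deriv ?_
  rw [logRateDeriv]
  congr 1
  simp only [id]
  ring

theorem ell_le_sq (T t : ℝ) : 4 * ell T t ≤ T ^ 2 := by
  unfold ell
  nlinarith [sq_nonneg (T - 2 * t)]

/-- Since ℓ ≤ T² and k ≥ 2, ℓ^(k/2 − 1) ≤ T^(k − 2). This is the origin of T^(k−1) in the lower
bound on s: a logarithmic time derivative of the weight has size T/ℓ. -/
theorem div_ell_le (hk : 2 ≤ k) (hT : 0 < T) (ht : t ∈ Ioo 0 T) :
    T / ell T t ≤ T ^ (k - 1) * blow T k t := by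
  have hl := ell_pos ht
  have hl2 : ell T t ≤ T ^ 2 := by linarith [ell_le_sq T t]
  have h1 : ell T t ^ (k / 2 - 1) ≤ T ^ (k - 2) := by
    calc ell T t ^ (k / 2 - 1) ≤ (T ^ 2) ^ (k / 2 - 1) :=
          Real.rpow_le_rpow hl.le hl2 (by linarith)
      _ = T ^ (k - 2) := by
          rw [← Real.rpow_natCast, ← Real.rpow_mul hT.le]
          congr 1
          push_cast
          ring
  have hp := Real.rpow_pos_of_pos hl (k / 2)
  rw [Real.rpow_sub_one hl.ne', div_le_iff₀ hl] at h1
  have h2 : T ^ (k - 1) = T ^ (k - 2) * T := by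
    have : T ^ (k - 1 - 1) = T ^ (k - 1) / T := Real.rpow_sub_one hT.ne' _
    rw [show k - 2 = k - 1 - 1 by ring, this, div_mul_cancel₀ _ hT.ne']
  rw [blow, h2, div_le_iff₀ hl, mul_assoc, mul_assoc]
  have h3 : 1 ≤ T ^ (k - 2) * ell T t * (ell T t ^ (k / 2))⁻¹ := by
    rw [← div_eq_mul_inv, le_div_iff₀ hp]
    linarith
  nlinarith

/-- From ℓ ≤ T² again. This is the origin of T^k in the lower bound on s, which makes `θ` itself
large. -/
theorem one_le_rpow_mul_blow (hk : 2 ≤ k) (hT : 0 < T) (ht : t ∈ Ioo 0 T) :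
    1 ≤ T ^ k * blow T k t := by
  have hl := ell_pos ht
  have hl2 : ell T t ≤ T ^ 2 := by linarith [ell_le_sq T t]
  have h1 : ell T t ^ (k / 2) ≤ T ^ k := by
    calc ell T t ^ (k / 2) ≤ (T ^ 2) ^ (k / 2) := Real.rpow_le_rpow hl.le hl2 (by linarith)
      _ = T ^ k := by
          rw [← Real.rpow_natCast, ← Real.rpow_mul hT.le]
          congr 1
          push_cast
          ring
  rw [blow, ← div_eq_mul_inv, le_div_iff₀ (Real.rpow_pos_of_pos hl _), one_mul]
  exact h1

theorem abs_sub_two_mul_le (ht : t ∈ Ioo 0 T) : |T - 2 * t| ≤ T :=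
  abs_le.2 ⟨by linarith [ht.2], by linarith [ht.1]⟩

theorem abs_logRate_le (hk : 2 ≤ k) (ht : t ∈ Ioo 0 T) :
    |logRate T k t| ≤ k / 2 * (T / ell T t) := by
  have hl := ell_pos ht
  rw [logRate, abs_div, abs_mul, abs_neg, abs_of_pos hl, abs_of_pos (by linarith : 0 < k / 2),
    mul_div_assoc]
  gcongr
  exact abs_sub_two_mul_le ht

theorem abs_logRateDeriv_le (hk : 2 ≤ k) (ht : t ∈ Ioo 0 T) :
    |logRateDeriv T k t| ≤ k * (T / ell T t) ^ 2 := by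
  have hl := ell_pos ht
  have h1 : (T - 2 * t) ^ 2 ≤ T ^ 2 := sq_le_sq' (by linarith [ht.2]) (by linarith [ht.1])
  have h2 := ell_le_sq T t
  have h3 : k / 2 * (2 * ell T t + (T - 2 * t) ^ 2) ≤ k / 2 * (2 * T ^ 2) :=
    mul_le_mul_of_nonneg_left (by linarith [sq_nonneg T]) (by linarith)
  rw [logRateDeriv, abs_of_nonneg (by positivity), div_pow, ← mul_div_assoc]
  exact div_le_div_of_nonneg_right (h3.trans_eq (by ring)) (sq_nonneg _)

end Time

section Moderate

variable {T k : ℝ}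

@[fun_prop]
theorem moderate_blow : Moderate T k (fun p => blow T k p.1) := by
  refine ⟨?_, 1, 1, fun p hp => ?_⟩
  · intro p hp
    have h : ContinuousAt (blow T k) p.1 := (hasDerivAt_blow hp.1).continuousAt
    exact (h.comp continuousAt_fst).continuousWithinAt
  · have := blow_pos (k := k) hp.1
    rw [abs_of_pos this]
    linarith

theorem moderate_of_continuous {f : Torus → ℝ} (hf : Continuous f) :
    Moderate T k (fun p => f p.2) := by
  obtain ⟨C, hC⟩ := exists_bound_of_continuous hf
  exact ⟨(hf.comp continuous_snd).continuousOn, C, 0, fun p _ => by simpa using hC p.2⟩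

theorem Moderate.of_le {f g : ℝ × Torus → ℝ} (hg : Moderate T k g)
    (hf : ∀ t ∈ Ioo 0 T, ∀ x, ContinuousAt f (t, x)) (h : ∀ p ∈ cyl T, |f p| ≤ g p) :
    Moderate T k f := by
  obtain ⟨C, N, hC⟩ := hg.bound
  exact ⟨fun p hp => (hf p.1 hp.1 p.2).continuousWithinAt, C, N,
    fun p hp => (h p hp).trans ((le_abs_self _).trans (hC p hp))⟩

theorem moderate_logRate (hk : 2 ≤ k) (hT : 0 < T) : Moderate T k (fun p => logRate T k p.1) := by
  have hb : Moderate T k (fun p => k / 2 * (T ^ (k - 1) * blow T k p.1)) := by fun_prop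
  refine hb.of_le (fun t ht x => ?_) fun p hp => ?_
  · have : ContinuousAt (logRate T k) t := (hasDerivAt_logRate ht).continuousAt
    exact this.comp (x := (t, x)) continuousAt_fst
  · refine (abs_logRate_le hk hp.1).trans ?_
    gcongr
    exact div_ell_le hk hT hp.1

theorem moderate_logRateDeriv (hk : 2 ≤ k) (hT : 0 < T) :
    Moderate T k (fun p => logRateDeriv T k p.1) := by
  have hb : Moderate T k (fun p => k * (T ^ (k - 1) * blow T k p.1) ^ 2) := by fun_prop
  refine hb.of_le (fun t ht x => ?_) fun p hp => ?_
  · have hl := ell_pos ht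
    have : ContinuousAt (logRateDeriv T k) t := by
      unfold logRateDeriv
      have := (hasDerivAt_ell T t).continuousAt
      exact ContinuousAt.div (by fun_prop) (by fun_prop) (by positivity)
    exact this.comp (x := (t, x)) continuousAt_fst
  · have hl := ell_pos hp.1
    refine (abs_logRateDeriv_le hk hp.1).trans ?_
    gcongr
    exact div_ell_le hk hT hp.1

/-- A single term of the exponential series of c(1 + r) dominates the polynomial; the shift by c
costs only a constant. -/
theorem exists_pow_mul_exp_neg_le {c : ℝ} (hc : 0 < c) (N : ℕ) :
    ∃ C : ℝ, ∀ r : ℝ, 0 ≤ r → Real.exp (-(c * r)) * (1 + r) ^ N ≤ C := by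
  refine ⟨N.factorial * Real.exp c / c ^ N, fun r hr => ?_⟩
  have h := Real.pow_div_factorial_le_exp (c * (1 + r)) (by positivity) N
  rw [div_le_iff₀ (by positivity)] at h
  rw [le_div_iff₀ (by positivity)]
  calc Real.exp (-(c * r)) * (1 + r) ^ N * c ^ N = Real.exp (-(c * r)) * (c * (1 + r)) ^ N := by
        rw [mul_pow]; ring
    _ ≤ Real.exp (-(c * r)) * (Real.exp (c * (1 + r)) * N.factorial) := by gcongr
    _ = (Real.exp (-(c * r)) * Real.exp (c * (1 + r))) * N.factorial := by ring
    _ = N.factorial * Real.exp c := by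
        rw [← Real.exp_add, show -(c * r) + c * (1 + r) = c by ring, mul_comm]

end Moderate

/-- The concrete weights of the Carleman estimate form an abstract Carleman weight. -/
theorem Profile.exists_weight {J : Set Torus} {ψ : Torus → ℝ} {M δ : ℝ} (P : Profile J ψ M δ)
    {k ε : ℝ} (hk : 2 ≤ k) (hε : 0 < ε) (hε1 : ε ≤ 1) {μ lam α T s Ψ : ℝ} (hμ : 1 ≤ μ)
    (hlam : μ ≤ lam) (hα : 0 ≤ α) (hT : 0 < T)
    (hs : k ^ 2 / ε * (1 + α) * (T ^ k + T ^ (k - 1)) ≤ s) (hΨ : ∀ x, ψ x ≤ Ψ) :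
    ∃ W : Weight J T k μ α M δ ε, (∀ p, W.θ p = s * xi0 ψ Ψ k lam μ T p.1 p.2) ∧
      ∀ p, W.E p = Real.exp (s * phi0 ψ Ψ k lam μ T p.1 p.2) := by
  have hμ0 : 0 < μ := by linarith
  have hk0 : 0 < k := by linarith
  have hΨ0 : 0 < Ψ := (P.pos 0).trans_le (hΨ 0)
  have hlamΨ : 0 < lam * Ψ := mul_pos (by linarith) hΨ0
  have hTk : 0 < T ^ k := Real.rpow_pos_of_pos hT _
  have hTk1 : 0 < T ^ (k - 1) := Real.rpow_pos_of_pos hT _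
  -- The factor k² covers the constants k/2 and k in the first two logarithmic time derivatives of
  -- the weight, and 1/ε creates the smallness.
  set s₀ := k ^ 2 / ε with hs₀
  have hs₀ε : ε * s₀ = k ^ 2 := by rw [hs₀]; field_simp
  have hs₀k : k ^ 2 ≤ s₀ := by rw [hs₀, le_div_iff₀ hε]; exact mul_le_of_le_one_right (sq_nonneg k) hε1
  have hs₀1 : 1 ≤ s₀ := le_trans (by nlinarith) hs₀k
  have hs₀0 : 0 < s₀ := by linarith
  have hs0 : 0 < s := lt_of_lt_of_le (by positivity) hs
  set X : Torus → ℝ := fun x => Real.exp (μ * ψ x + 8 * lam * Ψ) with hX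
  set Y := Real.exp (10 * lam * Ψ) with hY
  have hX0 (x : Torus) : 0 < X x := Real.exp_pos _
  have hμψ (x : Torus) : μ * ψ x ≤ lam * Ψ :=
    mul_le_mul hlam (hΨ x) (P.pos x).le (by linarith)
  have hX1 (x : Torus) : 1 ≤ X x := Real.one_le_exp (by
    have := P.pos x
    have : 0 < μ * ψ x := by positivity
    linarith)
  -- The exponents 8 and 10 act here. As μψ ≤ λΨ, X ≤ e^(9λΨ) < Y, so φ₀ is negative with a uniform
  -- gap, which makes `E` rapid. As 16 ≥ 10, also Y ≤ X², so |φ₀| is bounded by X² times `blow`;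
  -- this is what places b below θ² and its time derivative below θ³.
  have hXle (x : Torus) : X x ≤ Real.exp (9 * lam * Ψ) := Real.exp_le_exp.2 (by linarith [hμψ x])
  have hgap : 0 < Y - Real.exp (9 * lam * Ψ) :=
    sub_pos.2 (Real.exp_lt_exp.2 (by linarith))
  have hYX (x : Torus) : Y ≤ X x ^ 2 := by
    rw [hX, ← Real.exp_nat_mul]
    refine Real.exp_le_exp.2 ?_
    have := P.pos x
    have : 0 < μ * ψ x := by positivity
    push_cast
    linarith
  have hXcont : Continuous X :=
    Real.continuous_exp.comp ((P.smooth.continuous.const_mul μ).add continuous_const)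
  have hXd (x : ℝ) : HasDerivAt (fun y : ℝ => X (y : Torus)) (μ * dx ψ x * X x) x := by
    have := (((P.smooth.hasDerivAt (by simp) x).const_mul μ).add_const (8 * lam * Ψ)).exp
    exact this.congr_deriv (by ring)
  have hθ (p : ℝ × Torus) : s * xi0 ψ Ψ k lam μ T p.1 p.2 = s * (X p.2 * blow T k p.1) := by
    rw [xi0, blow, div_eq_mul_inv]
  have hφ (p : ℝ × Torus) :
      s * phi0 ψ Ψ k lam μ T p.1 p.2 = s * ((X p.2 - Y) * blow T k p.1) := by
    rw [phi0, blow, div_eq_mul_inv]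
  have mX : Moderate T k (fun p => X p.2) := moderate_of_continuous hXcont
  have mθ : Moderate T k (fun p => s * (X p.2 * blow T k p.1)) :=
    (Moderate.const s).mul (mX.mul moderate_blow)
  have mφ : Moderate T k (fun p => s * ((X p.2 - Y) * blow T k p.1)) :=
    (Moderate.const s).mul ((mX.sub (Moderate.const Y)).mul moderate_blow)
  have mg := moderate_logRate hk hT
  have mg' := moderate_logRateDeriv hk hT
  -- bounds on the time derivatives
  have hsr (p : ℝ × Torus) (hp : p ∈ cyl T) : 0 < s * blow T k p.1 :=
    mul_pos hs0 (blow_pos hp.1)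
  have hsrθ (p : ℝ × Torus) (hp : p ∈ cyl T) : s * blow T k p.1 ≤ s * (X p.2 * blow T k p.1) := by
    have := hsr p hp
    calc s * blow T k p.1 = 1 * (s * blow T k p.1) := (one_mul _).symm
      _ ≤ X p.2 * (s * blow T k p.1) := by gcongr; exact hX1 _
      _ = _ := by ring
  have hs1 : s₀ * (1 + α) * T ^ (k - 1) ≤ s := le_trans (by gcongr; linarith) hs
  have hs2 : s₀ * (1 + α) * T ^ k ≤ s := le_trans (by gcongr; linarith) hs
  have hTl (p : ℝ × Torus) (hp : p ∈ cyl T) :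
      s₀ * (1 + α) * (T / ell T p.1) ≤ s * blow T k p.1 := by
    have := blow_pos (k := k) hp.1
    calc s₀ * (1 + α) * (T / ell T p.1) ≤ s₀ * (1 + α) * (T ^ (k - 1) * blow T k p.1) := by
          gcongr
          exact div_ell_le hk hT hp.1
      _ = s₀ * (1 + α) * T ^ (k - 1) * blow T k p.1 := by ring
      _ ≤ _ := by gcongr
  have hg (p : ℝ × Torus) (hp : p ∈ cyl T) :
      (1 + α) * |logRate T k p.1| ≤ ε * (s * blow T k p.1) := by
    have hl := ell_pos hp.1
    have h1 : s₀ * ((1 + α) * |logRate T k p.1|) ≤ s₀ * (ε * (s * blow T k p.1)) := by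
      calc s₀ * ((1 + α) * |logRate T k p.1|)
          ≤ s₀ * ((1 + α) * (k / 2 * (T / ell T p.1))) := by
            gcongr; exact abs_logRate_le hk hp.1
        _ = k / 2 * (s₀ * (1 + α) * (T / ell T p.1)) := by ring
        _ ≤ k ^ 2 * (s * blow T k p.1) := by
            have := hTl p hp
            gcongr
            nlinarith
        _ = s₀ * (ε * (s * blow T k p.1)) := by rw [← hs₀ε]; ring
    exact le_of_mul_le_mul_left h1 hs₀0
  have hφabs (p : ℝ × Torus) (hp : p ∈ cyl T) :
      |s * ((X p.2 - Y) * blow T k p.1)| ≤ s * blow T k p.1 * X p.2 ^ 2 := by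
    have := blow_pos (k := k) hp.1
    have h1 : |X p.2 - Y| ≤ X p.2 ^ 2 := by
      rw [abs_of_nonpos (by linarith [hXle p.2])]
      linarith [hYX p.2, hX0 p.2]
    rw [abs_mul, abs_mul, abs_of_pos hs0, abs_of_pos this]
    calc s * (|X p.2 - Y| * blow T k p.1) ≤ s * (X p.2 ^ 2 * blow T k p.1) := by gcongr
      _ = _ := by ring
  refine ⟨{
    θ := fun p => s * (X p.2 * blow T k p.1)
    E := fun p => Real.exp (s * ((X p.2 - Y) * blow T k p.1))
    g := fun p => logRate T k p.1
    b := fun p => logRate T k p.1 * (s * ((X p.2 - Y) * blow T k p.1))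
    bt := fun p => (logRateDeriv T k p.1 + logRate T k p.1 ^ 2) *
      (s * ((X p.2 - Y) * blow T k p.1))
    D1 := fun p => dx ψ p.2
    D2 := fun p => dx (dx ψ) p.2
    D3 := fun p => dx (dx (dx ψ)) p.2
    D4 := fun p => dx (dx (dx (dx ψ))) p.2
    ζ := fun p => P.ζ p.2
    dζ := fun p => dx P.ζ p.2
    T_pos := hT
    two_le := hk
    mθ := mθ
    rE := ?_
    mg := mg
    mb := mg.mul mφ
    mbt := (mg'.add (mg.pow 2)).mul mφ
    mD1 := moderate_of_continuous P.smooth.dx.continuous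
    mD2 := moderate_of_continuous P.smooth.dx.dx.continuous
    mD3 := moderate_of_continuous P.smooth.dx.dx.dx.continuous
    mD4 := moderate_of_continuous P.smooth.dx.dx.dx.dx.continuous
    mζ := moderate_of_continuous P.smooth_ζ.continuous
    mdζ := moderate_of_continuous P.smooth_ζ.dx.continuous
    xθ := fun t _ x => (((hXd x).mul_const (blow T k t)).const_mul s).congr_deriv (by ring)
    xE := fun t _ x => ((((hXd x).sub_const Y).mul_const (blow T k t)).const_mul s).exp.congr_deriv
      (by ring)
    xb := fun t _ x => (((((hXd x).sub_const Y).mul_const (blow T k t)).const_mul s).const_mul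
      (logRate T k t)).congr_deriv (by ring)
    xD1 := fun _ _ x => P.smooth.dx.hasDerivAt (by simp) x
    xD2 := fun _ _ x => P.smooth.dx.dx.hasDerivAt (by simp) x
    xD3 := fun _ _ x => P.smooth.dx.dx.dx.hasDerivAt (by simp) x
    xζ := fun _ _ x => P.smooth_ζ.hasDerivAt (by simp) x
    tθ := fun t ht x => (((hasDerivAt_blow ht).const_mul (X x)).const_mul s).congr_deriv (by ring)
    tE := fun t ht x => (((hasDerivAt_blow ht).const_mul (X x - Y)).const_mul s).exp.congr_deriv
      (by ring)
    tb := fun t ht x => ((hasDerivAt_logRate ht).mul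
      (((hasDerivAt_blow ht).const_mul (X x - Y)).const_mul s)).congr_deriv (by ring)
    tD1 := fun t _ x => hasDerivAt_const t (dx ψ x)
    one_le_μ := hμ
    α_nonneg := hα
    one_le_M := P.one_le_M
    ε_pos := hε
    one_le_θ := ?_
    g_le := fun p hp => (hg p hp).trans (mul_le_mul_of_nonneg_left (hsrθ p hp) hε.le)
    b_le := ?_
    bt_le := ?_
    D1_le := fun p => P.D1_le p.2
    D2_le := fun p => P.D2_le p.2
    D3_le := fun p => P.D3_le p.2
    D4_le := fun p => P.D4_le p.2
    ζ_nonneg := fun p => P.ζ_nonneg p.2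
    ζ_le := fun p => P.ζ_le p.2
    dζ_le := fun p => P.dζ_le p.2
    ζ_off := fun p => P.ζ_off p.2
    crit := fun p => P.crit p.2 }, fun p => (hθ p).symm, fun p => by rw [hφ]⟩
  -- The gap between X and Y bounds `E` by exp(−c · blow) with c > 0, which beats every power of
  -- `blow`.
  · refine ⟨Real.continuous_exp.comp_continuousOn mφ.cont, fun N => ?_⟩
    obtain ⟨C, hC⟩ := exists_pow_mul_exp_neg_le
      (mul_pos hs0 hgap) N
    refine ⟨C, fun p hp => ?_⟩
    have hb := blow_pos (k := k) hp.1
    refine le_trans ?_ (hC (blow T k p.1) hb.le)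
    rw [Real.abs_exp]
    gcongr
    have : X p.2 - Y ≤ -(Y - Real.exp (9 * lam * Ψ)) := by linarith [hXle p.2]
    calc s * ((X p.2 - Y) * blow T k p.1)
        ≤ s * (-(Y - Real.exp (9 * lam * Ψ)) * blow T k p.1) := by gcongr
      _ = _ := by ring
  · intro p hp
    have hb := blow_pos (k := k) hp.1
    have h1 : s₀ * (1 + α) ≤ s * blow T k p.1 := by
      calc s₀ * (1 + α) = s₀ * (1 + α) * 1 := (mul_one _).symm
        _ ≤ s₀ * (1 + α) * (T ^ k * blow T k p.1) := by
          gcongr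
          exact one_le_rpow_mul_blow hk hT hp.1
        _ = s₀ * (1 + α) * T ^ k * blow T k p.1 := by ring
        _ ≤ _ := by gcongr
    calc 1 + α = 1 * (1 + α) := (one_mul _).symm
      _ ≤ (ε * s₀) * (1 + α) := by
        gcongr
        rw [hs₀ε]
        nlinarith
      _ = ε * (s₀ * (1 + α)) := by ring
      _ ≤ ε * (s * (X p.2 * blow T k p.1)) := by
        exact mul_le_mul_of_nonneg_left (h1.trans (hsrθ p hp)) hε.le
  · intro p hp
    have h0 := hsr p hp
    rw [abs_mul, ← mul_assoc]
    calc (1 + α) * |logRate T k p.1| * |s * ((X p.2 - Y) * blow T k p.1)|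
        ≤ (ε * (s * blow T k p.1)) * (s * blow T k p.1 * X p.2 ^ 2) :=
          mul_le_mul (hg p hp) (hφabs p hp) (abs_nonneg _) (by positivity)
      _ = _ := by ring
  · intro p hp
    have h0 := hsr p hp
    have hl := ell_pos hp.1
    have hq : 0 ≤ T / ell T p.1 := by positivity
    have h1 : s₀ * (T / ell T p.1) ≤ s * blow T k p.1 := by
      refine le_trans ?_ (hTl p hp)
      gcongr
      exact le_mul_of_one_le_right hs₀0.le (by linarith)
    have h2 : |logRateDeriv T k p.1 + logRate T k p.1 ^ 2| ≤ k ^ 2 * (T / ell T p.1) ^ 2 := by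
      have e1 := abs_logRateDeriv_le hk hp.1
      have e2 : logRate T k p.1 ^ 2 ≤ (k / 2 * (T / ell T p.1)) ^ 2 := by
        rw [← sq_abs]
        gcongr
        exact abs_logRate_le hk hp.1
      have e3 : k * (T / ell T p.1) ^ 2 ≤ k ^ 2 / 2 * (T / ell T p.1) ^ 2 := by
        gcongr
        nlinarith
      refine (abs_add_le _ _).trans ?_
      rw [abs_sq]
      have e4 : 0 ≤ k ^ 2 * (T / ell T p.1) ^ 2 := by positivity
      linarith
    have h3 : |logRateDeriv T k p.1 + logRate T k p.1 ^ 2| ≤ ε * (s * blow T k p.1) ^ 2 := by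
      refine h2.trans ?_
      have e1 : s₀ * (T / ell T p.1) ^ 2 ≤ (s * blow T k p.1) ^ 2 := by
        calc s₀ * (T / ell T p.1) ^ 2 ≤ s₀ ^ 2 * (T / ell T p.1) ^ 2 := by
              gcongr
              exact le_self_pow₀ hs₀1 (by norm_num)
          _ = (s₀ * (T / ell T p.1)) ^ 2 := by ring
          _ ≤ _ := by gcongr
      calc k ^ 2 * (T / ell T p.1) ^ 2 = ε * (s₀ * (T / ell T p.1) ^ 2) := by rw [← hs₀ε]; ring
        _ ≤ _ := by gcongr
    rw [abs_mul]
    calc |logRateDeriv T k p.1 + logRate T k p.1 ^ 2| * |s * ((X p.2 - Y) * blow T k p.1)|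
        ≤ (ε * (s * blow T k p.1) ^ 2) * (s * blow T k p.1 * X p.2 ^ 2) :=
          mul_le_mul h3 (hφabs p hp) (abs_nonneg _) (by positivity)
      _ = ε * (s * blow T k p.1) ^ 3 * X p.2 ^ 2 := by ring
      _ ≤ ε * (s * blow T k p.1) ^ 3 * X p.2 ^ 3 := by
        gcongr ε * (s * blow T k p.1) ^ 3 * ?_
        exact pow_le_pow_right₀ (hX1 _) (by norm_num)
      _ = _ := by ring

end BeamCarleman

end

/-! ### Regularity of η and the Carleman estimate for the beam. -/

noncomputable section

namespace BeamCarleman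

open Filter Topology

theorem TorusContDiff.dx_of_succ {f : Torus → ℝ} {n : ℕ} (hf : TorusContDiff (n + 1 : ℕ) f) :
    TorusContDiff n (BeamCarleman.dx f) := by
  have h : ContDiff ℝ n (deriv fun x : ℝ => f (x : Torus)) := by
    have h' : ContDiff ℝ ((n : WithTop ℕ∞) + 1) fun x : ℝ => f (x : Torus) := by
      simpa [TorusContDiff] using hf
    exact (contDiff_succ_iff_deriv.1 h').2.2
  unfold TorusContDiff
  simp only [dx_coe]
  exact h

theorem TorusContDiff.iterate_dx {f : Torus → ℝ} (m : ℕ) : ∀ j : ℕ, TorusContDiff (m + j : ℕ) f →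
    TorusContDiff m (BeamCarleman.dx^[j] f)
  | 0, hf => hf
  | j + 1, hf => by
    rw [Function.iterate_succ_apply']
    exact (TorusContDiff.iterate_dx (m + 1) j (by rwa [show m + 1 + j = m + (j + 1) by ring])).dx_of_succ

/-- Integration over an initial segment, as a functional on continuous functions on the torus. -/
def primitiveCLM (x : ℝ) : C(Torus, ℝ) →L[ℝ] ℝ :=
  LinearMap.mkContinuous
    { toFun := fun f => ∫ y in (0 : ℝ)..x, f (y : Torus)
      map_add' := fun f g => by
        have h (f : C(Torus, ℝ)) : IntervalIntegrable (fun y : ℝ => f (y : Torus)) volume 0 x :=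
          (f.continuous.comp (AddCircle.continuous_mk' _)).intervalIntegrable _ _
        exact intervalIntegral.integral_add (h f) (h g)
      map_smul' := fun c f => by simp }
    |x| fun f => by
      have := intervalIntegral.norm_integral_le_of_norm_le_const (a := 0) (b := x)
        (f := fun y : ℝ => f (y : Torus)) (C := ‖f‖) fun y _ => f.norm_coe_le_norm y
      simpa [mul_comm] using this

theorem hasDerivAt_primitive (f : C(Torus, ℝ)) (x : ℝ) :
    HasDerivAt (fun y : ℝ => primitiveCLM y f) (f (x : Torus)) x := by
  have h : Continuous fun y : ℝ => f (y : Torus) :=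
    f.continuous.comp (AddCircle.continuous_mk' _)
  exact (h.integral_hasStrictDerivAt 0 x).hasDerivAt

/-- Differentiation in time preserves the relation between a function and its space derivative. -/
theorem hasDerivAt_of_hasDerivAt_time {A B : ℝ → C(Torus, ℝ)} {A' B' : C(Torus, ℝ)} {t : ℝ}
    (hA : HasDerivAt A A' t) (hB : HasDerivAt B B' t)
    (h : ∀ᶠ τ in 𝓝 t, ∀ x : ℝ, HasDerivAt (fun y : ℝ => A τ (y : Torus)) (B τ (x : Torus)) x)
    (x : ℝ) : HasDerivAt (fun y : ℝ => A' (y : Torus)) (B' (x : Torus)) x := by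
  -- The relation ∂ₓA = B is rewritten in integral form. Evaluation and integration are continuous
  -- linear functionals on C(Torus), so that form can be differentiated in time; differentiating
  -- back in space gives ∂ₓA' = B'.
  have key (y : ℝ) : A' (y : Torus) = A' ((0 : ℝ) : Torus) + primitiveCLM y B' := by
    have e1 : HasDerivAt (fun τ => A τ (y : Torus) - A τ ((0 : ℝ) : Torus))
        (A' (y : Torus) - A' ((0 : ℝ) : Torus)) t :=
      ((ContinuousMap.evalCLM ℝ (y : Torus)).hasFDerivAt.comp_hasDerivAt t hA).sub
        ((ContinuousMap.evalCLM ℝ ((0 : ℝ) : Torus)).hasFDerivAt.comp_hasDerivAt t hA)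
    have e2 : HasDerivAt (fun τ => primitiveCLM y (B τ)) (primitiveCLM y B') t :=
      (primitiveCLM y).hasFDerivAt.comp_hasDerivAt t hB
    have e3 : (fun τ => primitiveCLM y (B τ)) =ᶠ[𝓝 t]
        fun τ => A τ (y : Torus) - A τ ((0 : ℝ) : Torus) := by
      filter_upwards [h] with τ hτ
      refine intervalIntegral.integral_eq_sub_of_hasDerivAt (fun z _ => hτ z) ?_
      exact ((B τ).continuous.comp (AddCircle.continuous_mk' _)).intervalIntegrable _ _
    have := (e2.congr_of_eventuallyEq e3.symm).unique e1
    rw [this]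
    ring
  rw [show (fun y : ℝ => A' (y : Torus)) = _ from funext key]
  exact (hasDerivAt_primitive B' x).const_add _

section Slices

variable {T k : ℝ} {F F' G G' : ℝ → C(Torus, ℝ)}

theorem moderate_of_continuousOn (hF : ContinuousOn F (Icc 0 T)) :
    Moderate T k (fun p => F p.1 p.2) := by
  obtain ⟨C, hC⟩ := isCompact_Icc.exists_bound_of_continuousOn hF
  refine ⟨?_, C, 0, fun p hp => ?_⟩
  · have h1 : ContinuousOn (fun p : ℝ × Torus => F p.1) (cyl T) :=
      hF.comp continuousOn_fst fun p hp => Ioo_subset_Icc_self hp.1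
    exact h1.eval continuousOn_snd
  · simpa using ((F p.1).norm_coe_le_norm p.2).trans (hC p.1 (Ioo_subset_Icc_self hp.1))

theorem hasDT_of_hasDerivAt (h : ∀ t ∈ Ioo 0 T, HasDerivAt F (F' t) t) :
    HasDT T (fun p => F p.1 p.2) (fun p => F' p.1 p.2) := by
  intro t ht x
  have := (ContinuousMap.evalCLM (M := ℝ) ℝ (x : Torus)).hasFDerivAt.comp_hasDerivAt t (h t ht)
  exact this

theorem hasDX_time_deriv (hF : ∀ t ∈ Ioo 0 T, HasDerivAt F (F' t) t)
    (hG : ∀ t ∈ Ioo 0 T, HasDerivAt G (G' t) t)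
    (h : HasDX T (fun p => F p.1 p.2) (fun p => G p.1 p.2)) :
    HasDX T (fun p => F' p.1 p.2) (fun p => G' p.1 p.2) := fun t ht x =>
  hasDerivAt_of_hasDerivAt_time (hF t ht) (hG t ht)
    (by filter_upwards [Ioo_mem_nhds ht.1 ht.2] with τ hτ using h τ hτ) x

end Slices

/-- A function of class `C²([0, T]; C⁴)` provides a jet for the beam equation. -/
theorem IsC2C4On.exists_beamJet {T : ℝ} (k : ℝ) (hT : 0 < T) {η : ℝ → Torus → ℝ}
    (hη : IsC2C4On (Icc 0 T) η) : ∃ H : BeamJet T k, ∀ p ∈ cyl T,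
      H.h0 p = η p.1 p.2 ∧ H.h1 p = dx (η p.1) p.2 ∧ H.h2 p = dx^[2] (η p.1) p.2 ∧
      H.h3 p = dx^[3] (η p.1) p.2 ∧ H.h4 p = dx^[4] (η p.1) p.2 ∧ H.v0 p = dt η p.1 p.2 ∧
      H.v1 p = dt (fun τ => dx (η τ)) p.1 p.2 ∧ H.v2 p = dx^[2] (dt η p.1) p.2 ∧
      H.w0 p = dt (dt η) p.1 p.2 := by
  obtain ⟨hs, hF⟩ := hη
  -- Making the condition j ≤ 4 part of the conclusion allows one choice for all j; the value 0
  -- beyond 4 is never used.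
  have hex (j : ℕ) : ∃ F : ℝ → C(Torus, ℝ), j ≤ 4 → ContDiffOn ℝ 2 F (Icc 0 T) ∧
      ∀ t ∈ Icc 0 T, ∀ x : Torus, F t x = dx^[j] (η t) x := by
    by_cases hj : j ≤ 4
    · obtain ⟨F, h⟩ := hF j hj
      exact ⟨F, fun _ => h⟩
    · exact ⟨0, fun h => absurd h hj⟩
  choose F hF using hex
  let G (j : ℕ) : ℝ → C(Torus, ℝ) := derivWithin (F j) (Icc 0 T)
  let K (j : ℕ) : ℝ → C(Torus, ℝ) := derivWithin (G j) (Icc 0 T)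
  have hu : UniqueDiffOn ℝ (Icc 0 T) := uniqueDiffOn_Icc hT
  have cF (j : ℕ) (hj : j ≤ 4) : ContinuousOn (F j) (Icc 0 T) := (hF j hj).1.continuousOn
  have sG (j : ℕ) (hj : j ≤ 4) : ContDiffOn ℝ 1 (G j) (Icc 0 T) :=
    (hF j hj).1.derivWithin hu (by norm_num)
  have cG (j : ℕ) (hj : j ≤ 4) : ContinuousOn (G j) (Icc 0 T) := (sG j hj).continuousOn
  have cK (j : ℕ) (hj : j ≤ 4) : ContinuousOn (K j) (Icc 0 T) :=
    (sG j hj).continuousOn_derivWithin hu le_rfl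
  have dF (j : ℕ) (hj : j ≤ 4) : ∀ t ∈ Ioo 0 T, HasDerivAt (F j) (G j t) t := fun t ht =>
    (((hF j hj).1.differentiableOn (by norm_num)) t (Ioo_subset_Icc_self ht)).hasDerivWithinAt.hasDerivAt
      (Icc_mem_nhds ht.1 ht.2)
  have dG (j : ℕ) (hj : j ≤ 4) : ∀ t ∈ Ioo 0 T, HasDerivAt (G j) (K j t) t := fun t ht =>
    (((sG j hj).differentiableOn (by norm_num)) t (Ioo_subset_Icc_self ht)).hasDerivWithinAt.hasDerivAt
      (Icc_mem_nhds ht.1 ht.2)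
  have xF (j : ℕ) (hj : j < 4) : HasDX T (fun p => F j p.1 p.2) (fun p => F (j + 1) p.1 p.2) := by
    intro t ht x
    have ht' := Ioo_subset_Icc_self ht
    simp only [(hF j hj.le).2 t ht', (hF (j + 1) hj).2 t ht', Function.iterate_succ_apply']
    refine TorusContDiff.hasDerivAt (n := (1 : ℕ)) (TorusContDiff.iterate_dx 1 j ?_) (by norm_num) x
    refine ContDiff.of_le (hs t ht') ?_
    exact_mod_cast (by omega : 1 + j ≤ 4)
  -- Commutation of time and space derivatives is applied to the velocity here and, starting from
  -- this relation, to the acceleration in `xK`.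
  have xG (j : ℕ) (hj : j < 4) : HasDX T (fun p => G j p.1 p.2) (fun p => G (j + 1) p.1 p.2) :=
    hasDX_time_deriv (dF j hj.le) (dF (j + 1) hj) (xF j hj)
  have xK (j : ℕ) (hj : j < 4) : HasDX T (fun p => K j p.1 p.2) (fun p => K (j + 1) p.1 p.2) :=
    hasDX_time_deriv (dG j hj.le) (dG (j + 1) hj) (xG j hj)
  have mF (j : ℕ) (hj : j ≤ 4) : Moderate T k (fun p => F j p.1 p.2) :=
    moderate_of_continuousOn (cF j hj)
  have mG (j : ℕ) (hj : j ≤ 4) : Moderate T k (fun p => G j p.1 p.2) :=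
    moderate_of_continuousOn (cG j hj)
  have mK (j : ℕ) (hj : j ≤ 4) : Moderate T k (fun p => K j p.1 p.2) :=
    moderate_of_continuousOn (cK j hj)
  have tF (j : ℕ) (hj : j ≤ 4) := hasDT_of_hasDerivAt (dF j hj)
  have tG (j : ℕ) (hj : j ≤ 4) := hasDT_of_hasDerivAt (dG j hj)
  have dtF (j : ℕ) (hj : j ≤ 4) (t : ℝ) (ht : t ∈ Ioo 0 T) (x : Torus) :
      dt (fun τ => dx^[j] (η τ)) t x = G j t x := by
    obtain ⟨x, rfl⟩ := QuotientAddGroup.mk_surjective x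
    refine HasDerivAt.deriv ((tF j hj t ht x).congr_of_eventuallyEq ?_)
    filter_upwards [Ioo_mem_nhds ht.1 ht.2] with τ hτ
    exact ((hF j hj).2 τ (Ioo_subset_Icc_self hτ) _).symm
  have dtη (t : ℝ) (ht : t ∈ Ioo 0 T) : dt η t = fun x => G 0 t x :=
    funext fun x => dtF 0 (by norm_num) t ht x
  refine ⟨{
    h0 := fun p => F 0 p.1 p.2
    h1 := fun p => F 1 p.1 p.2
    h2 := fun p => F 2 p.1 p.2
    h3 := fun p => F 3 p.1 p.2
    h4 := fun p => F 4 p.1 p.2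
    v0 := fun p => G 0 p.1 p.2
    v1 := fun p => G 1 p.1 p.2
    v2 := fun p => G 2 p.1 p.2
    v3 := fun p => G 3 p.1 p.2
    w0 := fun p => K 0 p.1 p.2
    w1 := fun p => K 1 p.1 p.2
    mh0 := mF 0 (by norm_num)
    mh1 := mF 1 (by norm_num)
    mh2 := mF 2 (by norm_num)
    mh3 := mF 3 (by norm_num)
    mh4 := mF 4 (by norm_num)
    mv0 := mG 0 (by norm_num)
    mv1 := mG 1 (by norm_num)
    mv2 := mG 2 (by norm_num)
    mv3 := mG 3 (by norm_num)
    mw0 := mK 0 (by norm_num)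
    mw1 := mK 1 (by norm_num)
    xh0 := xF 0 (by norm_num)
    xh1 := xF 1 (by norm_num)
    xh2 := xF 2 (by norm_num)
    xh3 := xF 3 (by norm_num)
    xv0 := xG 0 (by norm_num)
    xv1 := xG 1 (by norm_num)
    xv2 := xG 2 (by norm_num)
    xw0 := xK 0 (by norm_num)
    th0 := tF 0 (by norm_num)
    th1 := tF 1 (by norm_num)
    th2 := tF 2 (by norm_num)
    th3 := tF 3 (by norm_num)
    tv0 := tG 0 (by norm_num)
    tv1 := tG 1 (by norm_num) }, fun p hp => ?_⟩
  have ht := hp.1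
  have ht' := Ioo_subset_Icc_self ht
  refine ⟨(hF 0 (by norm_num)).2 _ ht' _, (hF 1 (by norm_num)).2 _ ht' _,
    (hF 2 (by norm_num)).2 _ ht' _, (hF 3 (by norm_num)).2 _ ht' _,
    (hF 4 (by norm_num)).2 _ ht' _, (dtF 0 (by norm_num) _ ht _).symm,
    (dtF 1 (by norm_num) _ ht _).symm, ?_, ?_⟩
  · rw [dtη _ ht]
    have e (j : ℕ) (hj : j < 4) : dx (fun x => G j p.1 x) = fun x => G (j + 1) p.1 x := by
      funext x
      obtain ⟨x, rfl⟩ := QuotientAddGroup.mk_surjective x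
      exact dx_eq_of_hasDerivAt (xG j hj p.1 ht x)
    change _ = dx (dx fun x => G 0 p.1 x) p.2
    rw [e 0 (by norm_num), e 1 (by norm_num)]
  · obtain ⟨t, x⟩ := p
    obtain ⟨x, rfl⟩ := QuotientAddGroup.mk_surjective x
    refine (HasDerivAt.deriv ((tG 0 (by norm_num) t ht x).congr_of_eventuallyEq ?_)).symm
    filter_upwards [Ioo_mem_nhds ht.1 ht.2] with τ hτ
    exact congrFun (dtη τ hτ) _

/-- The Carleman estimate for the beam operator. -/
theorem carleman_estimate {J : Set Torus} (hJ : IsOpen J) {ψ : Torus → ℝ}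
    (hψ : IsTorusWeight J ψ) {Ψ k : ℝ} (hΨ : ∀ x, ψ x ≤ Ψ) (hk : 2 ≤ k) :
    ∃ c₀ μ₀ s₀ : ℝ, 0 < c₀ ∧ 1 ≤ μ₀ ∧ 1 ≤ s₀ ∧
      ∀ μ lam α T s : ℝ, μ₀ ≤ μ → μ ≤ lam → 0 ≤ α → 0 < T →
        s₀ * (1 + α) * (T ^ k + T ^ (k - 1)) ≤ s →
        ∀ η : ℝ → Torus → ℝ, IsC2C4On (Icc 0 T) η →
          IntegrableOn (energyDensity ψ Ψ k lam μ T s α η) (cyl T) ∧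
          IntegrableOn (observationDensity ψ Ψ k lam μ T s α η) (Ioo 0 T ×ˢ J) ∧
          IntegrableOn (velocityDensity ψ Ψ k lam μ T s η) (cyl T) ∧
          IntegrableOn (sourceDensity ψ Ψ k lam μ T s α η) (cyl T) ∧
          ∫ p in cyl T, energyDensity ψ Ψ k lam μ T s α η p ≤ c₀ *
            ((∫ p in Ioo 0 T ×ˢ J, observationDensity ψ Ψ k lam μ T s α η p)
              + α ^ 2 * s ^ 3 * μ ^ 4 * (∫ p in cyl T, velocityDensity ψ Ψ k lam μ T s η p)
              + ∫ p in cyl T, sourceDensity ψ Ψ k lam μ T s α η p) := by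
  obtain ⟨M, δ, hM, hδ, hδ1, ⟨P⟩⟩ := hψ.exists_profile hJ
  obtain ⟨C, hC, key⟩ := exists_carleman_constant hM hδ hδ1
  have hM0 : 0 < M := by linarith
  have hM4 : 1 ≤ M ^ 4 := one_le_pow₀ hM
  set ε := δ ^ 2 / (24 * M ^ 4) with hε
  have hε0 : 0 < ε := by positivity
  have hεM : 24 * M ^ 4 * ε = δ ^ 2 := by rw [hε]; field_simp
  have hε1 : ε ≤ 1 := by
    rw [hε, div_le_one (by positivity)]
    have : δ ^ 2 ≤ 1 := pow_le_one₀ hδ.le hδ1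
    linarith
  -- The constants depend only on the profile bounds M and δ and, for the last one, on k: μ₀
  -- enforces 2M ≤ δμ, and ε was chosen so that 24M⁴ε = δ².
  refine ⟨C, 2 * M / δ, k ^ 2 / ε, hC, ?_, ?_, ?_⟩
  · rw [le_div_iff₀ hδ]
    linarith
  · rw [le_div_iff₀ hε0]
    nlinarith
  intro μ lam α T s hμ hlam hα hT hs η hη
  have hμ' : 2 * M ≤ δ * μ := by
    rw [div_le_iff₀ hδ] at hμ
    linarith
  have hμ1 : 1 ≤ μ := by
    refine le_trans ?_ hμ
    rw [le_div_iff₀ hδ]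
    linarith
  obtain ⟨W, hθ, hE⟩ := P.exists_weight hk hε0 hε1 hμ1 hlam hα hT hs hΨ
  obtain ⟨H, hH⟩ := hη.exists_beamJet k hT
  have est := key J T k μ α ε W H hJ hμ' hεM.le
  have hE2 (p : ℝ × Torus) : Real.exp (2 * s * phi0 ψ Ψ k lam μ T p.1 p.2) = W.E p ^ 2 := by
    rw [hE, ← Real.exp_nat_mul]
    congr 1
    push_cast
    ring
  have eE : EqOn (fun p => W.term 8 7 H.h0 p + W.term 6 5 H.h1 p + W.term 4 3 H.h2 p
      + (1 + α ^ 2) * W.term 4 3 H.v0 p + W.term 2 1 H.h3 p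
      + (1 + α ^ 2) * W.term 2 1 H.v1 p) (energyDensity ψ Ψ k lam μ T s α η) (cyl T) := by
    intro p hp
    obtain ⟨h0, h1, h2, h3, -, v0, v1, -, -⟩ := hH p hp
    simp only [energyDensity, Weight.term, hE2, hθ, sq_abs, h0, h1, h2, h3, v0, v1]
    ring
  have eO : EqOn (fun p => W.term 8 7 H.h0 p + (1 + α ^ 2) * W.term 4 3 H.v0 p
      + W.term 2 1 H.h3 p + (1 + α ^ 2) * W.term 2 1 H.v1 p)
      (observationDensity ψ Ψ k lam μ T s α η) (cyl T) := by
    intro p hp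
    obtain ⟨h0, -, -, h3, -, v0, v1, -, -⟩ := hH p hp
    simp only [observationDensity, Weight.term, hE2, hθ, sq_abs, h0, h3, v0, v1]
    ring
  have eV : EqOn (fun p => W.term 4 3 H.v0 p)
      (fun p => s ^ 3 * μ ^ 4 * velocityDensity ψ Ψ k lam μ T s η p) (cyl T) := by
    intro p hp
    obtain ⟨-, -, -, -, -, v0, -, -, -⟩ := hH p hp
    simp only [velocityDensity, Weight.term, hE2, hθ, sq_abs, v0]
    ring
  have eS : EqOn (fun p => W.E p ^ 2 * (H.w0 p - α * H.v2 p + H.h4 p) ^ 2)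
      (sourceDensity ψ Ψ k lam μ T s α η) (cyl T) := by
    intro p hp
    obtain ⟨-, -, -, -, h4, -, -, v2, w0⟩ := hH p hp
    simp only [sourceDensity, beamOp, hE2, sq_abs, h4, v2, w0]
  have hsub : Ioo 0 T ×ˢ J ⊆ cyl T := prod_mono subset_rfl (subset_univ _)
  have hJm : MeasurableSet (Ioo 0 T ×ˢ J) := measurableSet_Ioo.prod hJ.measurableSet
  have I {i j : ℕ} {f : ℝ × Torus → ℝ} (hf : Moderate T k f) :
      IntegrableOn (fun p => W.term i j f p) (cyl T) := (W.rapid_term i j hf).integrableOn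
  have L {i j : ℕ} {f : ℝ × Torus → ℝ} (hf : Moderate T k f) :
      IntegrableOn (fun p => W.term i j f p) (Ioo 0 T ×ˢ J) := (I hf).mono_set hsub
  have iS : Rapid T k (fun p => W.E p ^ 2 * (H.w0 p - α * H.v2 p + H.h4 p) ^ 2) :=
    W.rapid_E_sq_mul (by fun_prop)
  -- the integrals of the densities
  have i1 : IntegrableOn (fun p => W.term 8 7 H.h0 p + W.term 6 5 H.h1 p) (cyl T) :=
    (I H.mh0).add (I H.mh1)
  have i2 : IntegrableOn (fun p => W.term 8 7 H.h0 p + W.term 6 5 H.h1 p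
    + W.term 4 3 H.h2 p) (cyl T) := i1.add (I H.mh2)
  have i3 : IntegrableOn (fun p => W.term 8 7 H.h0 p + W.term 6 5 H.h1 p + W.term 4 3 H.h2 p
      + (1 + α ^ 2) * W.term 4 3 H.v0 p) (cyl T) := i2.add ((I H.mv0).const_mul _)
  have i4 : IntegrableOn (fun p => W.term 8 7 H.h0 p + W.term 6 5 H.h1 p + W.term 4 3 H.h2 p
      + (1 + α ^ 2) * W.term 4 3 H.v0 p + W.term 2 1 H.h3 p) (cyl T) := i3.add (I H.mh3)
  have i5 := i4.add ((I (i := 2) (j := 1) H.mv1).const_mul (1 + α ^ 2))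
  have j1 : IntegrableOn (fun p => W.term 8 7 H.h0 p + (1 + α ^ 2) * W.term 4 3 H.v0 p)
    (Ioo 0 T ×ˢ J) := (L H.mh0).add ((L H.mv0).const_mul _)
  have j2 : IntegrableOn (fun p => W.term 8 7 H.h0 p + (1 + α ^ 2) * W.term 4 3 H.v0 p
    + W.term 2 1 H.h3 p) (Ioo 0 T ×ˢ J) := j1.add (L H.mh3)
  have j3 := j2.add ((L (i := 2) (j := 1) H.mv1).const_mul (1 + α ^ 2))
  have hs0 : 0 < s := lt_of_lt_of_le
    (by have := Real.rpow_pos_of_pos hT k; have := Real.rpow_pos_of_pos hT (k - 1); positivity) hs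
  have iV : IntegrableOn (velocityDensity ψ Ψ k lam μ T s η) (cyl T) := by
    have h := ((I (i := 4) (j := 3) H.mv0).congr_fun eV measurableSet_cyl).const_mul
      (s ^ 3 * μ ^ 4)⁻¹
    refine IntegrableOn.congr_fun h (fun p _ => ?_) measurableSet_cyl
    exact inv_mul_cancel_left₀ (by positivity) _
  refine ⟨i5.congr_fun eE measurableSet_cyl, j3.congr_fun (eO.mono hsub) hJm, iV,
    iS.integrableOn.congr_fun eS measurableSet_cyl, ?_⟩
  rw [← setIntegral_congr_fun measurableSet_cyl eE, ← setIntegral_congr_fun hJm (eO.mono hsub),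
    ← setIntegral_congr_fun measurableSet_cyl eS,
    integral_add i4 ((I H.mv1).const_mul _), integral_add i3 (I H.mh3),
    integral_add i2 ((I H.mv0).const_mul _), integral_add i1 (I H.mh2),
    integral_add (I H.mh0) (I H.mh1), integral_add j2 ((L H.mv1).const_mul _),
    integral_add j1 (L H.mh3), integral_add (L H.mh0) ((L H.mv0).const_mul _),
    integral_const_mul, integral_const_mul, integral_const_mul, integral_const_mul]
  have eV' := setIntegral_congr_fun (μ := volume) measurableSet_cyl eV
  rw [integral_const_mul] at eV'
  refine est.trans (le_of_eq ?_)
  rw [eV']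
  ring

end BeamCarleman

end

/-! ### Unique continuation. -/

noncomputable section

namespace BeamCarleman

open Filter Topology

/-- Every nonempty open subset of the torus admits a weight function. -/
theorem exists_isTorusWeight {J : Set Torus} (hJ : IsOpen J) (hne : J.Nonempty) :
    ∃ ψ : Torus → ℝ, IsTorusWeight J ψ := by
  obtain ⟨x₀, hx₀⟩ := hne
  obtain ⟨x₀, rfl⟩ := QuotientAddGroup.mk_surjective x₀
  obtain ⟨J₀, hJ₀, hx₀J₀, hsub⟩ : ∃ J₀ : Set Torus, IsOpen J₀ ∧ (x₀ : Torus) ∈ J₀ ∧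
      closure J₀ ⊆ J := by
    obtain ⟨t, ht, htc, htJ⟩ := exists_mem_nhds_isClosed_subset (hJ.mem_nhds hx₀)
    exact ⟨interior t, isOpen_interior, mem_interior_iff_mem_nhds.2 ht,
      (closure_minimal interior_subset htc).trans htJ⟩
  let C : Torus → ℝ := fun x => Real.Angle.cos (x - (x₀ : Torus))
  let S : Torus → ℝ := fun x => Real.Angle.sin (x - (x₀ : Torus))
  have hC (x : ℝ) : C (x : Torus) = Real.cos (x - x₀) := Real.Angle.cos_coe (x - x₀)
  have hS (x : ℝ) : S (x : Torus) = Real.sin (x - x₀) := Real.Angle.sin_coe (x - x₀)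
  have hCcont : Continuous C := Real.Angle.continuous_cos.comp (continuous_sub_right _)
  have hC1 (x : Torus) : C x ≤ 1 := by
    obtain ⟨x, rfl⟩ := QuotientAddGroup.mk_surjective x
    exact (hC x).trans_le (Real.cos_le_one _)
  have hCeq (x : Torus) (h : C x = 1) : x = (x₀ : Torus) := by
    have h' : Real.Angle.cos (x - (x₀ : Torus)) = Real.Angle.cos 0 := by
      rw [Real.Angle.cos_zero]; exact h
    rcases Real.Angle.cos_eq_iff_eq_or_eq_neg.1 h' with h | h
    · exact sub_eq_zero.1 h
    · exact sub_eq_zero.1 (h.trans neg_zero)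
  -- The cosine centred at x₀ equals 1 only at x₀, so by compactness it stays below some b < 1
  -- outside J₀.
  obtain ⟨b, hb0, hb1, hb⟩ : ∃ b : ℝ, 0 < b ∧ b < 1 ∧ ∀ x ∉ J₀, C x < b := by
    rcases (J₀ᶜ).eq_empty_or_nonempty with h | h
    · exact ⟨1 / 2, by norm_num, by norm_num,
        fun x hx => absurd (show x ∈ J₀ᶜ from hx) (by simp [h])⟩
    · obtain ⟨y, hy, hmax⟩ := hJ₀.isClosed_compl.isCompact.exists_isMaxOn h hCcont.continuousOn
      have hlt : C y < 1 := lt_of_le_of_ne (hC1 y) fun h1 => hy (hCeq y h1 ▸ hx₀J₀)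
      obtain ⟨b, hb, hb1⟩ := exists_between (max_lt hlt one_pos)
      exact ⟨b, (le_max_right _ _).trans_lt hb, hb1,
        fun x hx => (hmax hx).trans_lt ((le_max_left _ _).trans_lt hb)⟩
  have hden (y : ℝ) : 0 < 1 - b * Real.cos y := by nlinarith [Real.cos_le_one y]
  have hden' (y : ℝ) : 1 - b ≤ 1 - b * Real.cos y := by nlinarith [Real.cos_le_one y]
  -- The quotient sin/(1 − b cos) has derivative (cos − b)/(1 − b cos)², which vanishes only where
  -- cos = b, hence inside J₀. The constant 2/(1 − b) ensures positivity.
  let ψ : Torus → ℝ := fun x => 2 / (1 - b) + S x / (1 - b * C x)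
  have hψ : (fun x : ℝ => ψ (x : Torus)) =
      fun x => 2 / (1 - b) + Real.sin (x - x₀) / (1 - b * Real.cos (x - x₀)) := by
    funext x
    simp only [ψ, hC, hS]
  refine ⟨ψ, ?_, fun x => ?_, J₀, hJ₀, ⟨_, hx₀J₀⟩, hsub, fun x hx => ?_⟩
  · unfold TorusContDiff
    rw [hψ]
    refine contDiff_const.add (ContDiff.div ?_ ?_ fun x => (hden _).ne')
    · exact Real.contDiff_sin.comp (contDiff_id.sub contDiff_const)
    · exact contDiff_const.sub
        (contDiff_const.mul (Real.contDiff_cos.comp (contDiff_id.sub contDiff_const)))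
  · obtain ⟨x, rfl⟩ := QuotientAddGroup.mk_surjective x
    have h1 : 0 < 1 - b := by linarith
    have h2 : -(1 / (1 - b)) ≤ Real.sin (x - x₀) / (1 - b * Real.cos (x - x₀)) := by
      have h3 : |Real.sin (x - x₀) / (1 - b * Real.cos (x - x₀))| ≤ 1 / (1 - b) := by
        rw [abs_div, abs_of_pos (hden _)]
        exact div_le_div₀ zero_le_one (Real.abs_sin_le_one _) h1 (hden' _)
      exact (abs_le.1 h3).1
    have h4 : 0 < 1 / (1 - b) := by positivity
    have h5 : 2 / (1 - b) = 2 * (1 / (1 - b)) := by ring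
    have := congrFun hψ x
    change 0 < ψ (x : Torus)
    simp only [this]
    linarith
  · by_contra hxJ
    have hlt := hb x hxJ
    obtain ⟨x, rfl⟩ := QuotientAddGroup.mk_surjective x
    replace hlt : Real.cos (x - x₀) < b := (hC x).symm.trans_lt hlt
    have hd : HasDerivAt (fun y : ℝ => ψ (y : Torus))
        ((Real.cos (x - x₀) - b) / (1 - b * Real.cos (x - x₀)) ^ 2) x := by
      rw [hψ]
      have h1 := (hasDerivAt_id x).sub_const x₀
      have h2 := (h1.sin.div ((h1.cos.const_mul b).const_sub 1) (hden _).ne').const_add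
        (2 / (1 - b))
      refine h2.congr_deriv ?_
      simp only [id]
      congr 1
      linear_combination -b * Real.sin_sq_add_cos_sq (x - x₀)
    have h0 := (dx_eq_of_hasDerivAt hd).symm.trans hx
    rcases div_eq_zero_iff.1 h0 with h | h
    · linarith
    · exact (pow_pos (hden _) 2).ne' h

theorem dx_eq_zero_of_eqOn {f : Torus → ℝ} {J : Set Torus} (hJ : IsOpen J)
    (hf : ∀ x ∈ J, f x = 0) : ∀ x ∈ J, dx f x = 0 := by
  intro x hx
  have hc : Tendsto (fun h : ℝ => x + (h : Torus)) (𝓝 0) (𝓝 x) := by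
    have : Continuous fun h : ℝ => x + (h : Torus) :=
      continuous_const.add (AddCircle.continuous_mk' _)
    simpa using this.tendsto 0
  have he : (fun h : ℝ => f (x + (h : Torus))) =ᶠ[𝓝 0] fun _ => 0 := by
    filter_upwards [hc (hJ.mem_nhds hx)] with h hh using hf _ hh
  rw [dx, he.deriv_eq, deriv_const]

theorem iterate_dx_eq_zero_of_eqOn {f : Torus → ℝ} {J : Set Torus} (hJ : IsOpen J)
    (hf : ∀ x ∈ J, f x = 0) (j : ℕ) : ∀ x ∈ J, dx^[j] f x = 0 := by
  induction j with
  | zero => exact hf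
  | succ j ih =>
    rw [Function.iterate_succ_apply']
    exact dx_eq_zero_of_eqOn hJ ih

theorem dt_eq_zero_of_eqOn {η : ℝ → Torus → ℝ} {T t : ℝ} {x : Torus} (ht : t ∈ Ioo 0 T)
    (h : ∀ τ ∈ Ioo 0 T, η τ x = 0) : dt η t x = 0 := by
  have he : (fun τ => η τ x) =ᶠ[𝓝 t] fun _ => 0 := by
    filter_upwards [Ioo_mem_nhds ht.1 ht.2] with τ hτ using h τ hτ
  rw [dt, he.deriv_eq, deriv_const]

theorem IsC2C4On.comp_const_add {S S' : Set ℝ} {η : ℝ → Torus → ℝ} (hη : IsC2C4On S η) (a : ℝ)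
    (h : ∀ t ∈ S', a + t ∈ S) : IsC2C4On S' (fun t => η (a + t)) := by
  refine ⟨fun t ht => hη.1 _ (h t ht), fun j hj => ?_⟩
  obtain ⟨F, hF, hFη⟩ := hη.2 j hj
  exact ⟨fun t => F (a + t), hF.comp (contDiff_const.add contDiff_id).contDiffOn h,
    fun t ht => hFη _ (h t ht)⟩

/-- Unique continuation for the undamped beam on a closed time interval. -/
theorem eq_zero_of_beam_eq_zero {J : Set Torus} (hJ : IsOpen J) (hne : J.Nonempty) {T : ℝ}
    (hT : 0 < T) {η : ℝ → Torus → ℝ} (hη : IsC2C4On (Icc 0 T) η)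
    (heq : ∀ t ∈ Ioo 0 T, ∀ x, dt (dt η) t x + dx^[4] (η t) x = 0)
    (hzero : ∀ t ∈ Ioo 0 T, ∀ x ∈ J, η t x = 0) : ∀ t ∈ Ioo 0 T, ∀ x, η t x = 0 := by
  obtain ⟨ψ, hψ⟩ := exists_isTorusWeight hJ hne
  obtain ⟨Ψ, hΨ⟩ := exists_bound_of_continuous hψ.1.continuous
  obtain ⟨c₀, μ₀, s₀, -, hμ₀, hs₀, key⟩ := carleman_estimate hJ hψ
    (fun x => (le_abs_self _).trans (hΨ x)) le_rfl
  have hTp : 0 < T ^ (2 : ℝ) + T ^ ((2 : ℝ) - 1) :=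
    add_pos (Real.rpow_pos_of_pos hT _) (Real.rpow_pos_of_pos hT _)
  -- One admissible choice of parameters suffices: k = 2, λ = μ = μ₀, the smallest s, and α = 0,
  -- which removes the velocity term. Any upper bound Ψ of ψ is allowed, so no cylinder weight is
  -- required.
  obtain ⟨hint, -, -, -, hle⟩ := key μ₀ μ₀ 0 T _ le_rfl le_rfl le_rfl hT le_rfl η hη
  set s := s₀ * (1 + 0) * (T ^ (2 : ℝ) + T ^ ((2 : ℝ) - 1)) with hs
  have hs0 : 0 < s := by positivity
  have hμ0 : 0 < μ₀ := by linarith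
  have hobs : ∫ p in Ioo 0 T ×ˢ J, observationDensity ψ Ψ 2 μ₀ μ₀ T s 0 η p = 0 := by
    refine setIntegral_eq_zero_of_forall_eq_zero fun p hp => ?_
    have h0 := hzero p.1 hp.1 p.2 hp.2
    have h1 := dt_eq_zero_of_eqOn hp.1 fun τ hτ => hzero τ hτ p.2 hp.2
    have h3 := iterate_dx_eq_zero_of_eqOn hJ (hzero p.1 hp.1) 3 p.2 hp.2
    have h2 := dt_eq_zero_of_eqOn (η := fun τ => dx (η τ)) hp.1
      fun τ hτ => dx_eq_zero_of_eqOn hJ (hzero τ hτ) p.2 hp.2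
    simp only [observationDensity, h0, h1, h2, h3]
    simp
  have hsrc : ∫ p in cyl T, sourceDensity ψ Ψ 2 μ₀ μ₀ T s 0 η p = 0 := by
    refine setIntegral_eq_zero_of_forall_eq_zero fun p hp => ?_
    have h0 : beamOp 0 η p.1 p.2 = 0 := by
      rw [beamOp, zero_mul, sub_zero, heq p.1 hp.1]
    simp [sourceDensity, h0]
  rw [hobs, hsrc] at hle
  have hξ (p : ℝ × Torus) (hp : p ∈ cyl T) : 0 < xi0 ψ Ψ 2 μ₀ μ₀ T p.1 p.2 :=
    div_pos (Real.exp_pos _) (Real.rpow_pos_of_pos (ell_pos hp.1) _)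
  have hnonneg (p : ℝ × Torus) (hp : p ∈ cyl T) : 0 ≤ energyDensity ψ Ψ 2 μ₀ μ₀ T s 0 η p := by
    have := hξ p hp
    unfold energyDensity
    positivity
  have hae : energyDensity ψ Ψ 2 μ₀ μ₀ T s 0 η =ᵐ[volume.restrict (cyl T)] 0 := by
    refine (setIntegral_eq_zero_iff_of_nonneg_ae ?_ hint).1 (le_antisymm (by simpa using hle)
      (setIntegral_nonneg measurableSet_cyl hnonneg))
    filter_upwards [ae_restrict_mem measurableSet_cyl] with p hp using hnonneg p hp
  obtain ⟨H, hH⟩ := hη.exists_beamJet 2 hT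
  have hηae : H.h0 =ᵐ[volume.restrict (cyl T)] 0 := by
    filter_upwards [hae, ae_restrict_mem measurableSet_cyl] with p hp hpT
    have hx := hξ p hpT
    rw [(hH p hpT).1]
    by_contra hne0
    have hpos : 0 < |η p.1 p.2| := abs_pos.2 hne0
    have : 0 < energyDensity ψ Ψ 2 μ₀ μ₀ T s 0 η p := by
      unfold energyDensity
      positivity
    exact this.ne' hp
  intro t ht x
  have hp : (t, x) ∈ cyl T := ⟨ht, mem_univ x⟩
  rw [← (hH (t, x) hp).1]
  -- Two continuous functions equal almost everywhere on an open set agree there pointwise.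
  exact Measure.eqOn_open_of_ae_eq hηae isOpen_cyl H.mh0.cont continuousOn_const hp

/-- Unique continuation for the undamped beam. -/
theorem unique_continuation {J : Set Torus} (hJ : IsOpen J) (hne : J.Nonempty) {T : ℝ}
    {η : ℝ → Torus → ℝ} (hη : IsC2C4On (Ioo 0 T) η)
    (heq : ∀ t ∈ Ioo 0 T, ∀ x, dt (dt η) t x + dx^[4] (η t) x = 0)
    (hzero : ∀ t ∈ Ioo 0 T, ∀ x ∈ J, η t x = 0) : ∀ t ∈ Ioo 0 T, ∀ x, η t x = 0 := by
  intro t ht x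
  have hT : 0 < T := ht.1.trans ht.2
  -- The closed interval [t/2, t/2 + T/2] lies in (0, T) and contains t in its interior. After
  -- translation it becomes [0, T/2], and t corresponds to t/2.
  set a := t / 2 with ha
  have ha0 : 0 < a := half_pos ht.1
  have hmem (τ : ℝ) (hτ : τ ∈ Icc 0 (T / 2)) : a + τ ∈ Ioo 0 T :=
    ⟨by linarith [hτ.1], by linarith [hτ.2, ht.2]⟩
  have hdt (ζ : ℝ → Torus → ℝ) : dt (fun τ => ζ (a + τ)) = fun τ => dt ζ (a + τ) := by
    funext τ y
    exact deriv_comp_const_add (fun τ => ζ τ y) a τ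
  have := eq_zero_of_beam_eq_zero hJ hne (half_pos hT) (hη.comp_const_add a hmem)
    (fun τ hτ y => by
      rw [hdt, hdt]
      exact heq _ (hmem τ (Ioo_subset_Icc_self hτ)) y)
    (fun τ hτ => hzero _ (hmem τ (Ioo_subset_Icc_self hτ))) (t / 2)
    ⟨half_pos ht.1, by linarith [ht.2]⟩ x
  rwa [ha, add_halves] at this

/-- The supremum over the cylinder only adds a nonnegative amount, and the bound ψ ≤ Ψ is all that
the estimate asks of Ψ. -/
theorem IsTorusWeight.le_Psi {J : Set Torus} {ψI : Torus → ℝ} (hψ : IsTorusWeight J ψI)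
    (ψΩ : Torus → ℝ → ℝ) (x : Torus) : ψI x ≤ Psi ψI ψΩ := by
  obtain ⟨C, hC⟩ := exists_bound_of_continuous hψ.1.continuous
  have h1 : |ψI x| ≤ ⨆ x : Torus, |ψI x| :=
    le_ciSup (f := fun x => |ψI x|) ⟨C, by rintro _ ⟨y, rfl⟩; exact hC y⟩ x
  have h2 : 0 ≤ ⨆ p : Omega, |ψΩ p.1.1 p.1.2| := Real.iSup_nonneg fun _ => abs_nonneg _
  unfold Psi
  linarith [le_abs_self (ψI x)]

end BeamCarleman

end

theorem mainTheorem7 (J : Set BeamCarleman.Torus) (hJopen : IsOpen J) (hJne : J.Nonempty) :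
    -- the Carleman estimate
    (∀ (W : Set (BeamCarleman.Torus × ℝ)) (ψI : BeamCarleman.Torus → ℝ)
        (ψΩ : BeamCarleman.Torus → ℝ → ℝ) (k : ℝ),
      IsOpen W → W.Nonempty → W ⊆ BeamCarleman.Omega →
      BeamCarleman.IsTorusWeight J ψI → BeamCarleman.IsCylinderWeight W ψΩ → 2 ≤ k →
      ∃ c₀ μ₀ s₀ : ℝ, 0 < c₀ ∧ 1 ≤ μ₀ ∧ 1 ≤ s₀ ∧
        ∀ μ lam α T s : ℝ, μ₀ ≤ μ → μ ≤ lam → 0 ≤ α → 0 < T →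
          s₀ * (1 + α) * (T ^ k + T ^ (k - 1)) ≤ s →
          ∀ η : ℝ → BeamCarleman.Torus → ℝ, BeamCarleman.IsC2C4On (Icc 0 T) η →
            -- the integrals converge
            IntegrableOn
              (BeamCarleman.energyDensity ψI (BeamCarleman.Psi ψI ψΩ) k lam μ T s α η)
              (Ioo 0 T ×ˢ univ) ∧
            IntegrableOn
              (BeamCarleman.observationDensity ψI (BeamCarleman.Psi ψI ψΩ) k lam μ T s α η)
              (Ioo 0 T ×ˢ J) ∧
            IntegrableOn
              (BeamCarleman.velocityDensity ψI (BeamCarleman.Psi ψI ψΩ) k lam μ T s η)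
              (Ioo 0 T ×ˢ univ) ∧
            IntegrableOn
              (BeamCarleman.sourceDensity ψI (BeamCarleman.Psi ψI ψΩ) k lam μ T s α η)
              (Ioo 0 T ×ˢ univ) ∧
            -- and satisfy the inequality
            ∫ p in Ioo 0 T ×ˢ univ,
                BeamCarleman.energyDensity ψI (BeamCarleman.Psi ψI ψΩ) k lam μ T s α η p
              ≤ c₀ *
                ((∫ p in Ioo 0 T ×ˢ J,
                    BeamCarleman.observationDensity ψI (BeamCarleman.Psi ψI ψΩ) k lam μ T s α η p)
                  + α ^ 2 * s ^ 3 * μ ^ 4 *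
                    (∫ p in Ioo 0 T ×ˢ univ,
                      BeamCarleman.velocityDensity ψI (BeamCarleman.Psi ψI ψΩ) k lam μ T s η p)
                  + ∫ p in Ioo 0 T ×ˢ univ,
                      BeamCarleman.sourceDensity ψI (BeamCarleman.Psi ψI ψΩ) k lam μ T s α η p)) ∧
    -- unique continuation for the undamped beam
    (∀ (T : ℝ) (η : ℝ → BeamCarleman.Torus → ℝ), 0 < T → BeamCarleman.IsC2C4On (Ioo 0 T) η →
      (∀ t ∈ Ioo 0 T, ∀ x, BeamCarleman.dt (BeamCarleman.dt η) t x
        + BeamCarleman.dx^[4] (η t) x = 0) →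
      (∀ t ∈ Ioo 0 T, ∀ x ∈ J, η t x = 0) →
      ∀ t ∈ Ioo 0 T, ∀ x, η t x = 0) := by
  refine ⟨fun W ψI ψΩ k _ _ _ hψ _ hk => ?_, fun T η _ hη heq hzero =>
    BeamCarleman.unique_continuation hJopen hJne hη heq hzero⟩
  exact BeamCarleman.carleman_estimate hJopen hψ (hψ.le_Psi ψΩ) hk
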